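/- Let $K$ be a number field of degree $n$, with ring of integers $\mathcal{O}_K$, class number $h$, regulator $R$, $w$ roots of unity, $r_2$ complex places, unit rank $r$, absolute discriminant $d_K$ and Dedekind zeta function $\zeta_K$. For $x \in K^{N+1}\setminus\{0\}$ let $H(x) = \prod_v |x|_v^{n_v/n}$ be the absolute multiplicative Weil height. The product is over all places $v$ of $K$, the absolute value $|\cdot|_v$ extends the standard one on $\mathbf{Q}$, $n_v = [K_v:\mathbf{Q}_v]$ is the local degree, and the absolute value of a tuple is the maximum over its entries. $H$ descends to $\mathbf{P}^N(K)$. A morphism $f : \mathbf{P}^m \to \mathbf{P}^M$ of degree $d$ defined over $K$ is given by a lift $F = (F_0,\dots,F_M)$, consisting of forms of degree $d$ in $m+1$ variables over $K$ with no common zero in $\mathbf{P}^m(\bar K)$. The lift is unique up to a nonzero scalar. Let $|F|_v$ be the maximum of the $v$-adic absolute values of the coefficients of $F$, and let $H(f)$ be the height of the tuple of all coefficients of $F$. For $m, d \ge 1$ put \[ c_K(f) := \frac{hR(m+1)^r}{w\,\zeta_K(m+1)}\Big(\frac{2^{r_2}}{\sqrt{d_K}}\Big)^{m+1} \cdot \frac{\prod_{v}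 c_{K,v}(f)}{H(f)^{n(m+1)/d}}, \] where the product is over all places $v$ of $K$ and \[ c_{K,v}(f) := \begin{cases} \mu_v\{z \in K_v^{m+1} : |F(z)|_v \le |F|_v\} & v \mid \infty,\\[4pt] \displaystyle\int_{O_v^{m+1}} \Big(\frac{|z|_v\,|F|_v^{1/d}}{|F(z)|_v^{1/d}}\Big)^{n_v(m+1)} d\mu_v(z) & v \nmid \infty. \end{cases} \] Here $\mu_v$ is Lebesgue measure on $K_v^{m+1} = \mathbf{R}^{m+1}$ or $\mathbf{C}^{m+1} = \mathbf{R}^{2(m+1)}$ if $v \mid \infty$. If $v \nmid \infty$, then $O_v^{m+1}$ is the unit polydisc $\{z \in K_v^{m+1} : |z|_v \le 1\}$ and $\mu_v$ is the Haar measure on $K_v^{m+1}$ with $\mu_v(O_v^{m+1}) = 1$. All but finitely many factors $c_{K,v}(f)$ are equal to $1$. **Theorem.** Let $f$ be an endomorphism of $\mathbf{P}^M$ of degree $d \ge 2$ defined over $K$, and let \[ \hat H_f(P) = \lim_{i\to\infty} H(f^i(P))^{1/d^i} \qquad (P \in \mathbf{P}^M(K)) \] be its (exponential, Call–Silverman)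 canonical height; this limit exists. Let $m \ge 1$ and let $g : \mathbf{P}^m \to \mathbf{P}^M$ be a morphism of degree $e \ge 1$ defined over $K$. Then: (i) the constants $c_K(f^i \circ g)$ converge to a finite positive limit $\hat c_{K,f}(g)$ as $i \to \infty$; (ii) for every real $X$ the set $\{P \in \mathbf{P}^m(K) : \hat H_f(g(P)) \le X\}$ is finite, and as $X \to \infty$ \[ \#\{P \in \mathbf{P}^m(K) : \hat H_f(g(P)) \le X\} \sim \hat c_{K,f}(g)\, X^{n(m+1)/e}. \] -/

import Mathlib

open Filter Topology MeasureTheory NumberField IsDedekindDomain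

noncomputable section

/-! ### Local compactness of the nonarchimedean completions -/

namespace AdicHaar

variable (K : Type*) [Field K] [NumberField K] (v : HeightOneSpectrum (𝓞 K))

theorem exists_integer_sub_lt_one (x : v.adicCompletion K)
    (hx : Valued.v x ≤ (1 : WithZero (Multiplicative ℤ))) :
    ∃ a : 𝓞 K, Valued.v (x - algebraMap K (v.adicCompletion K) (algebraMap (𝓞 K) K a))
      < (1 : WithZero (Multiplicative ℤ)) := by
  have hopen : IsOpen {y : v.adicCompletion K |
      Valued.v (x - y) < (1 : WithZero (Multiplicative ℤ))} := by
    have h1 : IsOpen {y : v.adicCompletion K |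
        Valued.v y < (1 : WithZero (Multiplicative ℤ))} := by
      simpa [Valuation.restrict_lt_one_iff] using Valued.isOpen_ball (v.adicCompletion K) 1
    exact h1.preimage (continuous_const.sub continuous_id)
  obtain ⟨k, hk⟩ := (HeightOneSpectrum.denseRange_algebraMap (K := K) (v := v)).exists_mem_open
    hopen ⟨x, by simp⟩
  have hval (t : K) : Valued.v (algebraMap K (v.adicCompletion K) t) = v.valuation K t :=
    HeightOneSpectrum.valuedAdicCompletion_eq_valuation' v t
  have hk' : Valued.v (x - algebraMap K (v.adicCompletion K) k)
      < (1 : WithZero (Multiplicative ℤ)) := hk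
  have hk1 : v.valuation K k ≤ 1 := by
    rw [← hval]
    have : algebraMap K (v.adicCompletion K) k
      = x - (x - algebraMap K (v.adicCompletion K) k) := by ring
    rw [this]
    exact (Valuation.map_sub _ _ _).trans (max_le hx hk'.le)
  obtain ⟨a, ha⟩ := v.exists_valuation_sub_lt_of_integer hk1 1
  refine ⟨a, ?_⟩
  have h2 : x - algebraMap K (v.adicCompletion K) (algebraMap (𝓞 K) K a)
      = (x - algebraMap K (v.adicCompletion K) k)
        - algebraMap K (v.adicCompletion K) (algebraMap (𝓞 K) K a - k) := by
    rw [map_sub]; ring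
  rw [h2]
  refine (Valuation.map_sub _ _ _).trans_lt (max_lt hk' ?_)
  rw [hval]
  simpa using ha

instance finite_residueField :
    Finite (IsLocalRing.ResidueField (Valued.integer (v.adicCompletion K))) := by
  have hfin : Finite (𝓞 K ⧸ v.asIdeal) := v.asIdeal.finiteQuotientOfFreeOfNeBot v.ne_bot
  have hval (t : K) : Valued.v (algebraMap K (v.adicCompletion K) t) = v.valuation K t :=
    HeightOneSpectrum.valuedAdicCompletion_eq_valuation' v t
  let φ : 𝓞 K →+* Valued.integer (v.adicCompletion K) :=
    ((algebraMap K (v.adicCompletion K)).comp (algebraMap (𝓞 K) K)).codRestrict _ (fun a => by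
      change Valued.v (algebraMap K (v.adicCompletion K) (algebraMap (𝓞 K) K a)) ≤ 1
      rw [hval]; exact v.valuation_le_one a)
  have hφ (a : 𝓞 K) (ha : a ∈ v.asIdeal) :
      ((IsLocalRing.residue _).comp φ) a = 0 := by
    rw [RingHom.comp_apply, IsLocalRing.residue_eq_zero_iff, IsLocalRing.mem_maximalIdeal,
      mem_nonunits_iff, Valuation.Integer.not_isUnit_iff_valuation_lt_one]
    change Valued.v (algebraMap K (v.adicCompletion K) (algebraMap (𝓞 K) K a)) < 1
    rw [hval]
    exact (v.valuation_lt_one_iff_mem a).2 ha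
  refine Finite.of_surjective (Ideal.Quotient.lift v.asIdeal _ hφ) ?_
  intro y
  obtain ⟨x, rfl⟩ := IsLocalRing.residue_surjective y
  obtain ⟨a, ha⟩ := exists_integer_sub_lt_one K v x.1 x.2
  refine ⟨Ideal.Quotient.mk _ a, ?_⟩
  rw [Ideal.Quotient.lift_mk, RingHom.comp_apply, eq_comm, ← sub_eq_zero, ← map_sub,
    IsLocalRing.residue_eq_zero_iff, IsLocalRing.mem_maximalIdeal,
    mem_nonunits_iff, Valuation.Integer.not_isUnit_iff_valuation_lt_one]
  exact ha

instance properSpace_adicCompletion : ProperSpace (v.adicCompletion K) := by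
  refine
    Valued.integer.properSpace_iff_completeSpace_and_isDiscreteValuationRing_integer_and_finite_residueField.2
    ⟨inferInstance, ?_, finite_residueField K v⟩
  exact inferInstanceAs (IsDiscreteValuationRing (v.adicCompletionIntegers K))

instance measurableSpace_adicCompletion : MeasurableSpace (v.adicCompletion K) := borel _

instance borelSpace_adicCompletion : BorelSpace (v.adicCompletion K) := ⟨rfl⟩

/-- The unit polydisc `O_v^{m+1} = {z ∈ K_v^{m+1} : |z|_v ≤ 1}`. -/
def unitPolydisc (m : ℕ) :
    TopologicalSpace.PositiveCompacts (Fin (m + 1) → v.adicCompletion K) where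
  carrier := Metric.closedBall 0 1
  isCompact' := isCompact_closedBall 0 1
  interior_nonempty' :=
    ⟨0, interior_maximal Metric.ball_subset_closedBall Metric.isOpen_ball (by simp)⟩

/-- The Haar measure on `K_v^{m+1}` that gives the unit polydisc measure `1`. -/
def polydiscHaar (m : ℕ) : Measure (Fin (m + 1) → v.adicCompletion K) :=
  Measure.addHaarMeasure (unitPolydisc K v m)

end AdicHaar

/-! ### Morphisms of projective spaces -/

/-- A morphism `ℙ^m → ℙ^M` of degree `deg` defined over the field `K`, given by a homogeneous lift:
`M + 1` forms of degree `deg` in `m + 1` variables with coefficients in `K` and without a common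
zero in `ℙ^m` over the algebraic closure of `K`. Every morphism arises so, and its lift is unique up
to a nonzero scalar in `K`; a statement about all terms of this type is a statement about all
morphisms and all choices of their lifts. -/
structure ProjMorphism (K : Type*) [Field K] (m M : ℕ) where
  /-- the degree -/
  deg : ℕ
  /-- the forms `F_0, …, F_M` -/
  lift : Fin (M + 1) → MvPolynomial (Fin (m + 1)) K
  isHomogeneous : ∀ j, (lift j).IsHomogeneous deg
  eq_zero_of_aeval_eq_zero : ∀ z : Fin (m + 1) → AlgebraicClosure K,
    (∀ j, MvPolynomial.aeval z (lift j) = 0) → z = 0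

namespace ProjMorphism

section Field

variable {K : Type*} [Field K] {l m M : ℕ}

theorem eval_ne_zero (f : ProjMorphism K m M) {x : Fin (m + 1) → K} (hx : x ≠ 0) :
    (fun j => MvPolynomial.eval x (f.lift j)) ≠ 0 := by
  intro h
  apply hx
  have h0 := f.eq_zero_of_aeval_eq_zero (fun i => algebraMap K (AlgebraicClosure K) (x i))
    (fun j => by
      have hj : MvPolynomial.eval x (f.lift j) = 0 := congrFun h j
      have := MvPolynomial.aeval_algebraMap_apply (AlgebraicClosure K) x (f.lift j)
      rw [show (fun i => algebraMap K (AlgebraicClosure K) (x i))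
        = (algebraMap K (AlgebraicClosure K) ∘ x) from rfl, this]
      simp [MvPolynomial.aeval_eq_eval, hj])
  funext i
  have hi := congrFun h0 i
  simpa using hi

theorem smul_eval_eq {n d : ℕ} {p : MvPolynomial (Fin n) K} (hp : p.IsHomogeneous d) (t : K)
    (b : Fin n → K) : t ^ d • MvPolynomial.eval b p = MvPolynomial.eval (t • b) p := by
  rw [MvPolynomial.eval_eq', MvPolynomial.eval_eq', Finset.smul_sum]
  refine Finset.sum_congr rfl fun α hα => ?_
  have h : ∑ i, α i = d := by
    have := hp (MvPolynomial.mem_support_iff.1 hα)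
    rw [← this, Finsupp.weight_apply, Finsupp.sum_fintype _ _ (by simp)]
    simp
  simp only [Pi.smul_apply, smul_eq_mul, mul_pow, Finset.prod_mul_distrib,
    Finset.prod_pow_eq_pow_sum, h]
  ring

/-- The map `ℙ^m(K) → ℙ^M(K)`, `[x] ↦ [F_0(x) : … : F_M(x)]`, induced on `K`-rational points. -/
def onPoints (f : ProjMorphism K m M) :
    Projectivization K (Fin (m + 1) → K) → Projectivization K (Fin (M + 1) → K) :=
  Projectivization.lift
    (fun x => Projectivization.mk K (fun j => MvPolynomial.eval x.1 (f.lift j))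
      (f.eval_ne_zero x.2))
    (by
      rintro ⟨a, ha⟩ ⟨b, hb⟩ t (hab : a = t • b)
      rw [Projectivization.mk_eq_mk_iff']
      refine ⟨t ^ f.deg, ?_⟩
      funext j
      subst hab
      exact smul_eval_eq (f.isHomogeneous j) t b)

/-- The composition `f ∘ g`, of degree `deg f * deg g`. -/
def comp (f : ProjMorphism K m M) (g : ProjMorphism K l m) : ProjMorphism K l M where
  deg := f.deg * g.deg
  lift j := MvPolynomial.bind₁ g.lift (f.lift j)
  isHomogeneous j := by
    rw [mul_comm]
    exact (f.isHomogeneous j).aeval _ g.isHomogeneous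
  eq_zero_of_aeval_eq_zero z hz := by
    refine g.eq_zero_of_aeval_eq_zero z fun k => ?_
    have := f.eq_zero_of_aeval_eq_zero (fun k => MvPolynomial.aeval z (g.lift k)) fun j => by
      rw [← MvPolynomial.aeval_bind₁]; exact hz j
    exact congrFun this k

/-- The morphism `f^i ∘ g`, where `f^i` is the `i`-th iterate of the endomorphism `f`. -/
def iterComp (f : ProjMorphism K M M) (g : ProjMorphism K m M) : ℕ → ProjMorphism K m M
  | 0 => g
  | i + 1 => f.comp (iterComp f g i)

/-- The coefficients `F_{j,α}` of the lift, where `α` runs over all the multiindices with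
`α_0 + ⋯ + α_m = deg`. -/
def coeffs (f : ProjMorphism K m M) :
    Fin (M + 1) × ↥(Finset.finsuppAntidiag (Finset.univ : Finset (Fin (m + 1))) f.deg) → K :=
  fun p => (f.lift p.1).coeff p.2.1

/-- The value `F(z)` at a point with coordinates in an extension `φ : K → L`. -/
def evalAt {L : Type*} [Field L] (φ : K →+* L) (f : ProjMorphism K m M) (z : Fin (m + 1) → L) :
    Fin (M + 1) → L :=
  fun j => MvPolynomial.eval₂ φ z (f.lift j)

/-- `|F|`, the largest absolute value of a coefficient, for the absolute value on `K` induced by an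
embedding `φ` in a normed field (the norm of a tuple is the maximum of the norms of its entries). -/
def coeffNorm {L : Type*} [NormedField L] (φ : K →+* L) (f : ProjMorphism K m M) : ℝ :=
  ‖fun p => φ (f.coeffs p)‖

/-- The local fundamental domain `{z : |F(z)| ≤ |F|}`. -/
def localDomain {L : Type*} [NormedField L] (φ : K →+* L) (f : ProjMorphism K m M) :
    Set (Fin (m + 1) → L) :=
  {z | ‖f.evalAt φ z‖ ≤ f.coeffNorm φ}

end Field

section NumberField

variable {K : Type*} [Field K] [NumberField K] {m M : ℕ}

open Classical in
/-- The local factor at an archimedean place: the Lebesgue measure of the local fundamental domain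
in `K_v^{m+1}`, with `K_v = ℝ` at a real place and `K_v = ℂ` (with `dx dy`) at a complex one. -/
def archFactor (f : ProjMorphism K m M) (v : InfinitePlace K) : ℝ :=
  if hv : v.IsReal then
    (volume (f.localDomain (InfinitePlace.embedding_of_isReal hv))).toReal
  else (volume (f.localDomain v.embedding)).toReal

/-- The local factor at a nonarchimedean place. Here `‖·‖` is the normalized absolute value
`|·|_v ^ n_v` with `n_v = [K_v : ℚ_v]`, so that
`(|z|_v |F|_v^{1/d} / |F(z)|_v^{1/d})^{n_v (m+1)}` is the integrand below. -/
def finiteFactor (f : ProjMorphism K m M) (v : HeightOneSpectrum (𝓞 K)) : ℝ :=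
  ∫ z in (AdicHaar.unitPolydisc K v m : Set (Fin (m + 1) → v.adicCompletion K)),
    (‖z‖ * f.coeffNorm (FinitePlace.embedding v) ^ (1 / (f.deg : ℝ))
      / ‖f.evalAt (FinitePlace.embedding v) z‖ ^ (1 / (f.deg : ℝ))) ^ (m + 1)
    ∂(AdicHaar.polydiscHaar K v m)

/-- The absolute multiplicative height `H(f)` of the tuple of coefficients of a lift. -/
def height (f : ProjMorphism K m M) : ℝ :=
  Height.mulHeight f.coeffs ^ (1 / (Module.finrank ℚ K : ℝ))

end NumberField

end ProjMorphism

/-! ### The constants and the heights -/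

section Constants

/-- `c_K(m) = h R (m+1)^r / (w ζ_K(m+1)) * (2^{r_2} / √d_K)^{m+1}`. -/
def schanuelConst (K : Type*) [Field K] [NumberField K] (m : ℕ) : ℝ :=
  (classNumber K * Units.regulator K * ((m : ℝ) + 1) ^ Units.rank K)
    / (Units.torsionOrder K * (dedekindZeta K ((m : ℂ) + 1)).re)
    * ((2 : ℝ) ^ InfinitePlace.nrComplexPlaces K / √|(discr K : ℝ)|) ^ (m + 1)

variable {K : Type*} [Field K] [NumberField K] {m M : ℕ}

/-- `c_K(f) = c_K(m) c_{K,∞}(f) c_{K,0}(f) / H(f)^{n(m+1)/d}`. -/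
def pullbackConst (f : ProjMorphism K m M) : ℝ :=
  schanuelConst K m
    * (∏ v : InfinitePlace K, f.archFactor v)
    * (∏ᶠ v : HeightOneSpectrum (𝓞 K), f.finiteFactor v)
    / f.height ^ ((Module.finrank ℚ K : ℝ) * ((m : ℝ) + 1) / (f.deg : ℝ))

/-- The absolute multiplicative Weil height on `ℙ^M(K)`. -/
def weilHeight (P : Projectivization K (Fin (M + 1) → K)) : ℝ :=
  P.mulHeight ^ (1 / (Module.finrank ℚ K : ℝ))

/-- The sequence `H(f^i(P))^{1/d^i}`. -/
def canonicalHeightSeq (f : ProjMorphism K M M) (P : Projectivization K (Fin (M + 1) → K))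
    (i : ℕ) : ℝ :=
  weilHeight (f.onPoints^[i] P) ^ (1 / (f.deg : ℝ) ^ i)

/-- The exponential canonical height `lim_i H(f^i(P))^{1/d^i}`. -/
def canonicalHeight (f : ProjMorphism K M M) (P : Projectivization K (Fin (M + 1) → K)) : ℝ :=
  limUnder atTop (canonicalHeightSeq f P)

/-- The number of `P ∈ ℙ^m(K)` with `Ĥ_f(g(P)) ≤ X`. -/
def canonicalCount (f : ProjMorphism K M M) (g : ProjMorphism K m M) (X : ℝ) : ℕ :=
  Set.ncard {P : Projectivization K (Fin (m + 1) → K) | canonicalHeight f (g.onPoints P) ≤ X}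

end Constants

end

noncomputable section

/-! ### Evaluation of homogeneous forms -/

namespace MvPolynomial

/-! A morphism multiplies logarithmic heights by its degree up to a bounded error, so by telescoping
H(f^i(Q))^{1/d^i} tends to Ĥ_f(Q) with a multiplicative error exp(±B/2^i) uniform in Q
(`exists_canonicalHeight_bounds`). At Q = g(P) each term is a root of the height pulled back by the
single morphism f^i ∘ g. It therefore suffices to have a Schanuel theorem for pulled back heights:
for a morphism F of degree D ≥ 1, the number of P with H(F(P)) ≤ X is asymptotic to c_K(F)
X^{n(m+1)/D}. Replacing X by X^{d^i} makes the exponent n(m+1)/e for every i. Squeezing the count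
for Ĥ_f between the counts for the i-th terms then shows that the logarithms of the constants are
Cauchy and that their limit gives the leading constant (`exists_tendsto_count_of_uniform_limit`).

The Schanuel theorem is `tendsto_ncard_boundedPoints_div`. Represent P by an integral vector x. By
the Nullstellensatz |F(z)|_v = |z|_v^D outside a finite set S of finite places. Hence H(F(P))^{n/D}
times the norm of the content ideal of x is the product of the archimedean gauges |F(x)|^{1/D} and
of finitely many factors at S (`rootHeight_mul_absNorm`). For x primitive at S these factors depend
only on x modulo some ideal c. So one counts lattice points in congruence classes, inside a cone
that is a fundamental domain for the units modulo torsion. The count is a volume divided by a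
covolume (`tendsto_ncard_smul_mem_div`, `volume_unitDomain`). Averaging over residues produces the
local densities times Euler factors at S (`exists_modulus`), summing over ideal classes produces h,
and each point occurs w times (`ncard_coneVectors`).

Away from S the content is not controlled, so this really counts pairs (P, b) with b an ideal
coprime to S and H(F(P))^{n/D} ≤ T/N(b). The limit is c_K(F) Z_S, where Z_S is the sum of
N(b)^{-(m+1)} over such b. No Möbius inversion is needed: the pairs with b ≠ 1 contribute at most C
(Z_S - 1) T^{m+1}, and Z_S tends to 1 as S grows. -/

theorem homogeneousComponent_mul_of_isHomogeneous {σ R : Type*} [CommSemiring R]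
    {q : MvPolynomial σ R} {d : ℕ} (hq : q.IsHomogeneous d) (p : MvPolynomial σ R) (k : ℕ) :
    homogeneousComponent (k + d) (p * q) = homogeneousComponent k p * q := by
  conv_lhs => rw [← sum_homogeneousComponent p, Finset.sum_mul, map_sum]
  have key (i : ℕ) : homogeneousComponent (k + d) (homogeneousComponent i p * q) =
      if i = k then homogeneousComponent k p * q else 0 := by
    have h := (homogeneousComponent_isHomogeneous i p).mul hq
    rw [homogeneousComponent_of_mem ((mem_homogeneousSubmodule _ _).2 h)]
    by_cases hik : i = k
    · simp [hik]
    · simp [hik, Ne.symm hik]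
  simp_rw [key]
  rw [Finset.sum_ite_eq']
  split_ifs with h
  · rfl
  · rw [homogeneousComponent_eq_zero, zero_mul]
    simpa using h

theorem norm_eval₂_le_of_isHomogeneous {K L σ : Type*} [Fintype σ] [Field K] [NormedField L]
    (φ : K →+* L) {p : MvPolynomial σ K} {N : ℕ} (hp : p.IsHomogeneous N) (z : σ → L) :
    ‖eval₂ φ z p‖ ≤ (∑ s ∈ p.support, ‖φ (p.coeff s)‖) * ‖z‖ ^ N := by
  rw [eval₂_eq', Finset.sum_mul]
  refine (norm_sum_le _ _).trans (Finset.sum_le_sum fun s hs => ?_)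
  rw [norm_mul, norm_prod]
  refine mul_le_mul_of_nonneg_left ?_ (norm_nonneg _)
  have h : ∑ i, s i = N := by
    rw [← hp (mem_support_iff.1 hs), Finsupp.weight_apply, Finsupp.sum_fintype _ _ (by simp)]
    simp
  rw [← h, ← Finset.prod_pow_eq_pow_sum]
  refine Finset.prod_le_prod (fun _ _ => norm_nonneg _) fun i _ => ?_
  rw [norm_pow]
  exact pow_le_pow_left₀ (norm_nonneg _) (norm_le_pi_norm z i) _

theorem norm_eval₂_le_of_isHomogeneous_of_isUltrametricDist {K L σ : Type*} [Fintype σ] [Field K]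
    [NormedField L] [IsUltrametricDist L] (φ : K →+* L) {p : MvPolynomial σ K} {N : ℕ}
    (hp : p.IsHomogeneous N) {C : ℝ} (hC : 0 ≤ C) (hpC : ∀ s, ‖φ (p.coeff s)‖ ≤ C) (z : σ → L) :
    ‖eval₂ φ z p‖ ≤ C * ‖z‖ ^ N := by
  rw [eval₂_eq']
  refine IsUltrametricDist.norm_sum_le_of_forall_le_of_nonneg (by positivity) fun s hs => ?_
  rw [norm_mul, norm_prod]
  refine mul_le_mul (hpC s) ?_ (by positivity) hC
  have h : ∑ i, s i = N := by
    rw [← hp (mem_support_iff.1 hs), Finsupp.weight_apply, Finsupp.sum_fintype _ _ (by simp)]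
    simp
  rw [← h, ← Finset.prod_pow_eq_pow_sum]
  refine Finset.prod_le_prod (fun _ _ => norm_nonneg _) fun i _ => ?_
  rw [norm_pow]
  exact pow_le_pow_left₀ (norm_nonneg _) (norm_le_pi_norm z i) _

end MvPolynomial

theorem exists_norm_apply_eq_pi_norm {ι E : Type*} [Fintype ι] [Nonempty ι]
    [SeminormedAddCommGroup E] (z : ι → E) : ∃ i, ‖z i‖ = ‖z‖ := by
  obtain ⟨i, -, hi⟩ := Finset.exists_mem_eq_sup' Finset.univ_nonempty fun i => ‖z i‖₊
  refine ⟨i, ?_⟩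
  rw [Pi.norm_def, ← Finset.sup'_eq_sup Finset.univ_nonempty, hi, coe_nnnorm]

namespace ProjMorphism

open MvPolynomial

section Field

variable {K : Type*} [Field K] {l m M : ℕ}

/-- By the Nullstellensatz the absence of common zeros puts every variable in the radical of the
ideal generated by the forms. A common exponent is obtained by summing the individual ones, and the
multipliers may be cut down to their components of degree k because the forms are homogeneous. This
identity is the source of all lower bounds for |F|. -/
theorem exists_sum_mul_lift_eq_X_pow (f : ProjMorphism K m M) :
    ∃ (k : ℕ) (A : Fin (m + 1) × Fin (M + 1) → MvPolynomial (Fin (m + 1)) K),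
      (∀ a, (A a).IsHomogeneous k) ∧ ∀ i, ∑ j, A (i, j) * f.lift j = X i ^ (k + f.deg) := by
  have hrad (i : Fin (m + 1)) : X i ∈ (Ideal.span (Set.range f.lift)).radical := by
    rw [← vanishingIdeal_zeroLocus_eq_radical (K := AlgebraicClosure K), mem_vanishingIdeal_iff]
    intro x hx
    rw [zeroLocus_span] at hx
    have := f.eq_zero_of_aeval_eq_zero x fun j => hx _ ⟨j, rfl⟩
    simp [this]
  choose e he using fun i => Ideal.mem_radical_iff.1 (hrad i)
  let k := ∑ i, e i
  have hk (i) : X i ^ (k + f.deg) ∈ Ideal.span (Set.range f.lift) := by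
    have : e i ≤ k + f.deg := (Finset.single_le_sum (f := e) (fun _ _ => Nat.zero_le _)
      (Finset.mem_univ i)).trans (Nat.le_add_right _ _)
    exact Ideal.pow_mem_of_pow_mem _ (he i) this
  have hB (i) : ∃ B : Fin (M + 1) → MvPolynomial (Fin (m + 1)) K,
      ∑ j, B j * f.lift j = X i ^ (k + f.deg) := by
    have := hk i
    rw [Ideal.mem_span_range_iff_exists_fun] at this
    exact this
  choose B hB using hB
  refine ⟨k, fun a => homogeneousComponent k (B a.1 a.2),
    fun a => homogeneousComponent_isHomogeneous _ _, fun i => ?_⟩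
  have h := congrArg (homogeneousComponent (k + f.deg)) (hB i)
  rw [map_sum] at h
  simp_rw [homogeneousComponent_mul_of_isHomogeneous (f.isHomogeneous _)] at h
  rw [h, homogeneousComponent_of_mem ((mem_homogeneousSubmodule _ _).2
    (by simpa using (isHomogeneous_X K i).pow (k + f.deg))), if_pos rfl]

theorem evalAt_smul {L : Type*} [Field L] (φ : K →+* L) (f : ProjMorphism K m M) (t : L)
    (z : Fin (m + 1) → L) : f.evalAt φ (t • z) = t ^ f.deg • f.evalAt φ z := by
  funext j
  simp only [evalAt, Pi.smul_apply]
  have h := smul_eval_eq (K := L) ((f.isHomogeneous j).map φ) t z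
  rw [eval_map, eval_map] at h
  exact h.symm

theorem evalAt_comp {L : Type*} [Field L] (φ : K →+* L) (f : ProjMorphism K m M)
    (x : Fin (m + 1) → K) : f.evalAt φ (φ ∘ x) = φ ∘ fun j => eval x (f.lift j) := by
  funext j
  simp only [evalAt, Function.comp_apply]
  rw [← MvPolynomial.eval₂_id, MvPolynomial.eval₂_comp_left, RingHom.comp_id]

theorem continuous_evalAt {L : Type*} [NormedField L] (φ : K →+* L) (f : ProjMorphism K m M) :
    Continuous (f.evalAt φ) := by
  refine continuous_pi fun j => ?_
  simp only [evalAt, eval₂_eq_eval_map]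
  exact MvPolynomial.continuous_eval _

theorem pow_mul_eq_sum_evalAt {L : Type*} [Field L] (φ : K →+* L) (f : ProjMorphism K m M) {k : ℕ}
    {A : Fin (m + 1) × Fin (M + 1) → MvPolynomial (Fin (m + 1)) K}
    (hA : ∀ i, ∑ j, A (i, j) * f.lift j = X i ^ (k + f.deg)) (z : Fin (m + 1) → L)
    (i : Fin (m + 1)) :
    ∑ j, eval₂ φ z (A (i, j)) * f.evalAt φ z j = z i ^ (k + f.deg) := by
  have := congrArg (eval₂ φ z) (hA i)
  simpa [evalAt, eval₂_sum, eval₂_mul, eval₂_pow] using this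

/-- Evaluate the identity for X_i^{k + deg} at an index i with |z_i| = ‖z‖, bound the multipliers by
a constant times ‖z‖^k, and cancel ‖z‖^k. -/
theorem exists_le_norm_evalAt {L : Type*} [NormedField L] (φ : K →+* L) (f : ProjMorphism K m M)
    (hd : f.deg ≠ 0) : ∃ c, 0 < c ∧ ∀ z, c * ‖z‖ ^ f.deg ≤ ‖f.evalAt φ z‖ := by
  obtain ⟨k, A, hAh, hA⟩ := f.exists_sum_mul_lift_eq_X_pow
  -- The summand 1 stands outside the sums and only makes C positive.
  set C : ℝ := ∑ a, ∑ s ∈ (A a).support, ‖φ ((A a).coeff s)‖ + 1 with hC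
  have hC0 : 0 < C := by positivity
  refine ⟨C⁻¹, by positivity, fun z => ?_⟩
  rcases eq_or_ne z 0 with rfl | hz
  · simp [hd]
  obtain ⟨i, hi⟩ := exists_norm_apply_eq_pi_norm z
  have hz0 : 0 < ‖z‖ := norm_pos_iff.2 hz
  rw [inv_mul_le_iff₀ hC0]
  refine le_of_mul_le_mul_left ?_ (pow_pos hz0 k)
  rw [← pow_add, ← hi, ← norm_pow, ← f.pow_mul_eq_sum_evalAt φ hA, hi, hC, add_mul, mul_add]
  refine (norm_sum_le _ _).trans (le_trans ?_ (le_add_of_nonneg_right (by positivity)))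
  rw [Finset.sum_mul, Fintype.sum_prod_type, Finset.mul_sum]
  refine le_trans ?_ (Finset.single_le_sum (f := fun i => ‖z‖ ^ k * ∑ j,
    (∑ s ∈ (A (i, j)).support, ‖φ ((A (i, j)).coeff s)‖) * ‖f.evalAt φ z‖)
    (fun _ _ => by positivity) (Finset.mem_univ i))
  rw [Finset.mul_sum]
  refine Finset.sum_le_sum fun j _ => ?_
  rw [norm_mul, ← mul_assoc, mul_comm (‖z‖ ^ k)]
  exact mul_le_mul (norm_eval₂_le_of_isHomogeneous φ (hAh (i, j)) z) (norm_le_pi_norm _ j)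
    (norm_nonneg _) (by positivity)

/-- When the forms and the Nullstellensatz multipliers have v-integral coefficients, the ultrametric
inequality gives the upper and the lower bound for |F(z)| with constant 1. -/
theorem norm_evalAt_eq_of_coeff_le_one {L : Type*} [NormedField L] [IsUltrametricDist L]
    (φ : K →+* L) (f : ProjMorphism K m M) (hd : f.deg ≠ 0) {k : ℕ}
    {A : Fin (m + 1) × Fin (M + 1) → MvPolynomial (Fin (m + 1)) K}
    (hAh : ∀ a, (A a).IsHomogeneous k)
    (hA : ∀ i, ∑ j, A (i, j) * f.lift j = X i ^ (k + f.deg))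
    (hAφ : ∀ a s, ‖φ ((A a).coeff s)‖ ≤ 1) (hfφ : ∀ j s, ‖φ ((f.lift j).coeff s)‖ ≤ 1)
    (z : Fin (m + 1) → L) : ‖f.evalAt φ z‖ = ‖z‖ ^ f.deg := by
  refine le_antisymm ((pi_norm_le_iff_of_nonneg (by positivity)).2 fun j => ?_) ?_
  · simpa [evalAt] using norm_eval₂_le_of_isHomogeneous_of_isUltrametricDist φ (f.isHomogeneous j)
      zero_le_one (hfφ j) z
  rcases eq_or_ne z 0 with rfl | hz
  · simp [hd]
  obtain ⟨i, hi⟩ := exists_norm_apply_eq_pi_norm z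
  have hz0 : 0 < ‖z‖ := norm_pos_iff.2 hz
  refine le_of_mul_le_mul_left ?_ (pow_pos hz0 k)
  rw [← pow_add, ← hi, ← norm_pow, ← f.pow_mul_eq_sum_evalAt φ hA, hi]
  refine IsUltrametricDist.norm_sum_le_of_forall_le_of_nonneg (by positivity) fun j _ => ?_
  rw [norm_mul]
  refine mul_le_mul ?_ (norm_le_pi_norm _ j) (norm_nonneg _) (by positivity)
  simpa using norm_eval₂_le_of_isHomogeneous_of_isUltrametricDist φ (hAh (i, j))
      zero_le_one (hAφ (i, j)) z

end Field

/-! ### Good reduction outside finitely many places -/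

section NumberField

variable {K : Type*} [Field K] [NumberField K] {m M : ℕ}

theorem finite_one_lt_norm_embedding (c : K) :
    {v : HeightOneSpectrum (𝓞 K) | 1 < ‖FinitePlace.embedding v c‖}.Finite := by
  rcases eq_or_ne c 0 with rfl | hc
  · simp [not_lt.2 (zero_le_one' ℝ)]
  have h := (FinitePlace.hasFiniteMulSupport hc).preimage
    (FinitePlace.equivHeightOneSpectrum (K := K)).symm.injective.injOn
  refine h.subset fun v hv => ?_
  simp only [Set.mem_preimage, Function.mem_mulSupport,
    FinitePlace.equivHeightOneSpectrum_symm_apply]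
  exact (ne_of_gt hv)

theorem finite_one_lt_norm_embedding_coeff {ι : Type*} [Finite ι] {σ : Type*}
    (p : ι → MvPolynomial σ K) :
    {v : HeightOneSpectrum (𝓞 K) | ∃ i s, 1 < ‖FinitePlace.embedding v ((p i).coeff s)‖}.Finite := by
  have : {v : HeightOneSpectrum (𝓞 K) | ∃ i s, 1 < ‖FinitePlace.embedding v ((p i).coeff s)‖} ⊆
      ⋃ i, ⋃ s ∈ (p i).support,
        {v : HeightOneSpectrum (𝓞 K) | 1 < ‖FinitePlace.embedding v ((p i).coeff s)‖} := by
    rintro v ⟨i, s, h⟩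
    simp only [Set.mem_iUnion]
    refine ⟨i, s, ?_, h⟩
    rw [mem_support_iff]
    intro h0
    rw [h0, map_zero, norm_zero] at h
    linarith
  exact (Set.finite_iUnion fun i => (p i).support.finite_toSet.biUnion
    fun s _ => finite_one_lt_norm_embedding _).subset this

/-- Outside a finite set of places the lift of a morphism is isometric. -/
theorem exists_finset_norm_evalAt_eq (f : ProjMorphism K m M) (hd : f.deg ≠ 0) :
    ∃ S : Finset (HeightOneSpectrum (𝓞 K)), ∀ v ∉ S, ∀ z : Fin (m + 1) → v.adicCompletion K,
      ‖f.evalAt (FinitePlace.embedding v) z‖ = ‖z‖ ^ f.deg := by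
  obtain ⟨k, A, hAh, hA⟩ := f.exists_sum_mul_lift_eq_X_pow
  refine ⟨((finite_one_lt_norm_embedding_coeff A).union
    (finite_one_lt_norm_embedding_coeff f.lift)).toFinset, fun v hv z => ?_⟩
  simp only [Set.Finite.mem_toFinset, Set.mem_union, Set.mem_ofPred_eq, not_or, not_exists,
    not_lt] at hv
  exact f.norm_evalAt_eq_of_coeff_le_one _ hd hAh hA hv.1 hv.2 z

end NumberField

end ProjMorphism

end

noncomputable section

/-! ### Counting with respect to a limit of heights -/

/-- If a height `h` is a multiplicatively uniform limit of heights `h_i` with power-law counting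
functions, then the leading constants converge and `h` has a power-law counting function. -/
theorem exists_tendsto_count_of_uniform_limit {α : Type*} {h : ℕ → α → ℝ} {hlim : α → ℝ}
    {ε : ℕ → ℝ} {c : ℕ → ℝ} {a : ℝ} (hε : Tendsto ε atTop (𝓝 0))
    (h1 : ∀ i P, Real.exp (-ε i) * h i P ≤ hlim P) (h2 : ∀ i P, hlim P ≤ Real.exp (ε i) * h i P)
    (hfin : ∀ i X, {P | h i P ≤ X}.Finite) (hc : ∀ i, 0 < c i)
    (hcount : ∀ i, Tendsto (fun X : ℝ => ({P | h i P ≤ X}.ncard : ℝ) / X ^ a) atTop (𝓝 (c i))) :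
    (∀ X, {P | hlim P ≤ X}.Finite) ∧ ∃ c' : ℝ, 0 < c' ∧ Tendsto c atTop (𝓝 c') ∧
      Tendsto (fun X : ℝ => ({P | hlim P ≤ X}.ncard : ℝ) / X ^ a) atTop (𝓝 c') := by
  have hup (i : ℕ) (X : ℝ) : {P | hlim P ≤ X} ⊆ {P | h i P ≤ Real.exp (ε i) * X} := by
    intro P (hP : hlim P ≤ X)
    have := (h1 i P).trans hP
    rw [Real.exp_neg, inv_mul_le_iff₀ (Real.exp_pos _)] at this
    exact this
  have hlo (i : ℕ) (X : ℝ) : {P | h i P ≤ Real.exp (-ε i) * X} ⊆ {P | hlim P ≤ X} := by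
    intro P (hP : h i P ≤ _)
    rw [Real.exp_neg, ← div_eq_inv_mul, le_div_iff₀' (Real.exp_pos _)] at hP
    exact (h2 i P).trans hP
  have hfin' (X) : {P | hlim P ≤ X}.Finite := (hfin 0 _).subset (hup 0 X)
  have hscale (i : ℕ) (t : ℝ) : Tendsto
      (fun X : ℝ => ({P | h i P ≤ Real.exp t * X}.ncard : ℝ) / X ^ a) atTop
      (𝓝 (c i * Real.exp (t * a))) := by
    have h3 := ((hcount i).comp (tendsto_id.const_mul_atTop (Real.exp_pos t))).mul_const
      (Real.exp (t * a))
    refine h3.congr' ?_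
    filter_upwards [eventually_gt_atTop 0] with X hX
    simp only [Function.comp_apply, id]
    rw [Real.mul_rpow (Real.exp_pos _).le hX.le, ← Real.exp_mul]
    field_simp
  have hle (i : ℕ) (X : ℝ) (hX : 0 < X) : ({P | hlim P ≤ X}.ncard : ℝ) / X ^ a ≤
      ({P | h i P ≤ Real.exp (ε i) * X}.ncard : ℝ) / X ^ a := by
    exact div_le_div_of_nonneg_right (Nat.cast_le.2 (Set.ncard_le_ncard (hup i X) (hfin _ _)))
      (by positivity)
  have hge (i : ℕ) (X : ℝ) (hX : 0 < X) : ({P | h i P ≤ Real.exp (-ε i) * X}.ncard : ℝ) / X ^ a ≤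
      ({P | hlim P ≤ X}.ncard : ℝ) / X ^ a := by
    exact div_le_div_of_nonneg_right (Nat.cast_le.2 (Set.ncard_le_ncard (hlo i X) (hfin' _)))
      (by positivity)
  -- Both counts are compared with the count for the limit height; letting X grow compares the
  -- constants for i and j.
  have hcc (i j : ℕ) : c i * Real.exp (-ε i * a) ≤ c j * Real.exp (ε j * a) := by
    refine le_of_tendsto_of_tendsto (hscale i (-ε i)) (hscale j (ε j)) ?_
    filter_upwards [eventually_gt_atTop 0] with X hX
    exact (hge i X hX).trans (hle j X hX)
  have hlog (i j : ℕ) : Real.log (c i) - Real.log (c j) ≤ (ε i + ε j) * a := by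
    have := Real.log_le_log (by have := hc i; positivity) (hcc i j)
    rw [Real.log_mul (hc i).ne' (Real.exp_pos _).ne', Real.log_mul (hc j).ne' (Real.exp_pos _).ne',
      Real.log_exp, Real.log_exp] at this
    linarith
  have hcau : CauchySeq fun i => Real.log (c i) := by
    -- The sequence ε need not be monotone, so the Cauchy modulus is a tail supremum. The factor 2
    -- lets each of the two errors take half of it.
    refine cauchySeq_of_le_tendsto_0 (fun N => ⨆ n : Set.Ici N, 2 * |ε n * a|) ?_ ?_
    · have hbdd (N : ℕ) : BddAbove (Set.range fun n : Set.Ici N => 2 * |ε n * a|) := by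
        obtain ⟨C, hC⟩ := ((hε.mul_const a).abs.const_mul 2).bddAbove_range
        exact ⟨C, by rintro _ ⟨n, rfl⟩; exact hC ⟨n, rfl⟩⟩
      intro n m' N hn hm'
      have e1 := le_ciSup (hbdd N) ⟨n, hn⟩
      have e2 := le_ciSup (hbdd N) ⟨m', hm'⟩
      rw [Real.dist_eq, abs_le]
      have l1 := hlog n m'
      have l2 := hlog m' n
      have a1 := le_abs_self (ε n * a)
      have a2 := le_abs_self (ε m' * a)
      simp only at e1 e2
      constructor <;> nlinarith
    · have ht : Tendsto (fun n => 2 * |ε n * a|) atTop (𝓝 0) := by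
        simpa using ((hε.mul_const a).abs.const_mul 2)
      rw [Metric.tendsto_atTop] at ht ⊢
      intro δ hδ
      obtain ⟨N, hN⟩ := ht (δ / 2) (by positivity)
      refine ⟨N, fun n hn => ?_⟩
      rw [Real.dist_eq, sub_zero, abs_of_nonneg (Real.iSup_nonneg fun _ => by positivity)]
      refine (ciSup_le fun k => ?_ : _ ≤ δ / 2).trans_lt (by linarith)
      have := hN k (hn.trans k.2)
      rw [Real.dist_eq, sub_zero, abs_of_nonneg (by positivity)] at this
      exact this.le
  obtain ⟨L, hL⟩ := cauchySeq_tendsto_of_complete hcau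
  have hcL : Tendsto c atTop (𝓝 (Real.exp L)) := by
    refine ((Real.continuous_exp.tendsto L).comp hL).congr fun i => ?_
    simp [Real.exp_log (hc i)]
  -- For a bound y on either side of the limit, a single index i whose rescaled constant is still on
  -- the correct side of y suffices.
  refine ⟨hfin', Real.exp L, Real.exp_pos L, hcL, tendsto_order.2 ⟨fun y hy => ?_, fun y hy => ?_⟩⟩
  · have ht : Tendsto (fun i => c i * Real.exp (-ε i * a)) atTop (𝓝 (Real.exp L)) := by
      simpa using hcL.mul ((Real.continuous_exp.tendsto _).comp (hε.neg.mul_const a))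
    obtain ⟨i, hi⟩ := (ht.eventually_const_lt hy).exists
    filter_upwards [(hscale i (-ε i)).eventually_const_lt hi, eventually_gt_atTop 0] with X h3 hX
    exact h3.trans_le (hge i X hX)
  · have ht : Tendsto (fun i => c i * Real.exp (ε i * a)) atTop (𝓝 (Real.exp L)) := by
      simpa using hcL.mul ((Real.continuous_exp.tendsto _).comp (hε.mul_const a))
    obtain ⟨i, hi⟩ := (ht.eventually_lt_const hy).exists
    filter_upwards [(hscale i (ε i)).eventually_lt_const hi, eventually_gt_atTop 0] with X h3 hX
    exact (hle i X hX).trans_lt h3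

/-! ### The canonical height -/

namespace ProjMorphism

variable {K : Type*} [Field K] {l m M : ℕ}

theorem onPoints_mk (f : ProjMorphism K m M) {x : Fin (m + 1) → K} (hx : x ≠ 0) :
    f.onPoints (Projectivization.mk K x hx) =
      Projectivization.mk K (fun j => MvPolynomial.eval x (f.lift j)) (f.eval_ne_zero hx) :=
  rfl

theorem onPoints_comp (f : ProjMorphism K m M) (g : ProjMorphism K l m)
    (P : Projectivization K (Fin (l + 1) → K)) :
    (f.comp g).onPoints P = f.onPoints (g.onPoints P) := by
  induction P using Projectivization.ind with
  | h x hx =>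
    rw [onPoints_mk, onPoints_mk, onPoints_mk]
    congr 1
    funext j
    simp only [comp]
    rw [← MvPolynomial.aeval_eq_eval, ← MvPolynomial.aeval_eq_eval, MvPolynomial.aeval_bind₁]

theorem onPoints_iterComp (f : ProjMorphism K M M) (g : ProjMorphism K m M) (i : ℕ)
    (P : Projectivization K (Fin (m + 1) → K)) :
    (f.iterComp g i).onPoints P = f.onPoints^[i] (g.onPoints P) := by
  induction i with
  | zero => rfl
  | succ i ih => rw [iterComp, onPoints_comp, ih, Function.iterate_succ_apply']

theorem deg_iterComp (f : ProjMorphism K M M) (g : ProjMorphism K m M) (i : ℕ) :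
    (f.iterComp g i).deg = f.deg ^ i * g.deg := by
  induction i with
  | zero => simp [iterComp]
  | succ i ih =>
    change f.deg * (f.iterComp g i).deg = _
    rw [ih, pow_succ']
    ring

variable [NumberField K]

/-- The upper bound is the triangle inequality at each place; the lower one comes from the
Nullstellensatz identity. -/
theorem exists_abs_log_mulHeight_onPoints_sub_le (f : ProjMorphism K m M) :
    ∃ B : ℝ, 0 ≤ B ∧ ∀ P, |Real.log (f.onPoints P).mulHeight - f.deg * Real.log P.mulHeight| ≤ B := by
  obtain ⟨k, A, hAh, hA⟩ := f.exists_sum_mul_lift_eq_X_pow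
  obtain ⟨C₁, hC₁, h₁⟩ := Height.mulHeight_eval_le' f.isHomogeneous
  obtain ⟨C₂, hC₂, h₂⟩ := Height.mulHeight_eval_ge' (N := f.deg) hAh
  refine ⟨max |Real.log C₁| |Real.log C₂|, by positivity, fun P => ?_⟩
  induction P using Projectivization.ind with
  | h x hx =>
    rw [onPoints_mk, Projectivization.mulHeight_mk, Projectivization.mulHeight_mk]
    have hx0 := Height.mulHeight_pos x
    have hy0 := Height.mulHeight_pos fun j => MvPolynomial.eval x (f.lift j)
    have l₁ := Real.log_le_log hy0 (h₁ x)
    have l₂ := Real.log_le_log (by positivity) (h₂ f.lift (x := x) fun i => by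
      simpa using congrArg (MvPolynomial.eval x) (hA i))
    rw [Real.log_mul (by positivity) (by positivity), Real.log_pow] at l₁ l₂
    rw [abs_le]
    have := le_max_left |Real.log C₁| |Real.log C₂|
    have := le_max_right |Real.log C₁| |Real.log C₂|
    have := le_abs_self (Real.log C₁)
    have := neg_abs_le (Real.log C₂)
    constructor <;> linarith

end ProjMorphism

/-! ### The canonical height as a uniform limit, and the reduction to pulled back heights -/

section Canonical

variable {K : Type*} [Field K] [NumberField K] {m M : ℕ}

theorem log_canonicalHeightSeq (f : ProjMorphism K M M) (P : Projectivization K (Fin (M + 1) → K))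
    (i : ℕ) : Real.log (canonicalHeightSeq f P i) =
      Real.log (f.onPoints^[i] P).mulHeight / (Module.finrank ℚ K * (f.deg : ℝ) ^ i) := by
  have h := (f.onPoints^[i] P).mulHeight_pos
  rw [canonicalHeightSeq, weilHeight, Real.log_rpow (by positivity), Real.log_rpow h]
  ring

theorem canonicalHeightSeq_pos (f : ProjMorphism K M M) (P : Projectivization K (Fin (M + 1) → K))
    (i : ℕ) : 0 < canonicalHeightSeq f P i := by
  have h := (f.onPoints^[i] P).mulHeight_pos
  rw [canonicalHeightSeq, weilHeight]
  positivity

/-- Tate's telescoping argument: consecutive logarithms differ by at most B/(n d^{i+1}), uniformly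
in the point, so the sequence of logarithms converges geometrically and the tail bounds the error.
-/
theorem exists_canonicalHeight_bounds (f : ProjMorphism K M M) (hf : 2 ≤ f.deg) :
    ∃ B : ℝ, ∀ P, Tendsto (canonicalHeightSeq f P) atTop (𝓝 (canonicalHeight f P)) ∧
      ∀ i : ℕ, Real.exp (-(B * (1 / 2) ^ i)) * canonicalHeightSeq f P i ≤ canonicalHeight f P ∧
        canonicalHeight f P ≤ Real.exp (B * (1 / 2) ^ i) * canonicalHeightSeq f P i := by
  obtain ⟨B, hB0, hB⟩ := f.exists_abs_log_mulHeight_onPoints_sub_le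
  have hd : (2 : ℝ) ≤ f.deg := by exact_mod_cast hf
  have hn : (1 : ℝ) ≤ Module.finrank ℚ K := by
    exact_mod_cast Module.finrank_pos (R := ℚ) (M := K)
  -- The sum of the geometric tail from index i is B (1/2)^i / (1 - 1/2).
  refine ⟨B / (1 - 1 / 2), fun P => ?_⟩
  have hstep (i : ℕ) : dist (Real.log (canonicalHeightSeq f P i))
      (Real.log (canonicalHeightSeq f P (i + 1))) ≤ B * (1 / 2) ^ i := by
    rw [dist_comm, Real.dist_eq, log_canonicalHeightSeq, log_canonicalHeightSeq,
      Function.iterate_succ_apply']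
    have h := hB (f.onPoints^[i] P)
    set a := Real.log (f.onPoints (f.onPoints^[i] P)).mulHeight
    set b := Real.log (f.onPoints^[i] P).mulHeight
    have e : a / (Module.finrank ℚ K * (f.deg : ℝ) ^ (i + 1)) -
        b / (Module.finrank ℚ K * (f.deg : ℝ) ^ i) =
        (a - f.deg * b) / (Module.finrank ℚ K * (f.deg : ℝ) ^ (i + 1)) := by
      field_simp
      ring
    rw [e, abs_div, abs_of_pos (by positivity : (0 : ℝ) < Module.finrank ℚ K * (f.deg : ℝ) ^ (i + 1)),
      one_div, inv_pow, ← div_eq_mul_inv]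
    -- The crude ratio 1/2 works for every degree d ≥ 2.
    have hden : (2 : ℝ) ^ i ≤ Module.finrank ℚ K * (f.deg : ℝ) ^ (i + 1) := by
      calc (2 : ℝ) ^ i ≤ (f.deg : ℝ) ^ i := by gcongr
        _ ≤ (f.deg : ℝ) ^ (i + 1) := pow_le_pow_right₀ (by linarith) (Nat.le_succ i)
        _ ≤ _ := le_mul_of_one_le_left (by positivity) hn
    gcongr
  obtain ⟨L, hL⟩ := cauchySeq_tendsto_of_complete
    (cauchySeq_of_le_geometric (1 / 2) B (by norm_num) hstep)
  have hdist := dist_le_of_le_geometric_of_tendsto (1 / 2) B (by norm_num) hstep hL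
  have hlim : Tendsto (canonicalHeightSeq f P) atTop (𝓝 (Real.exp L)) := by
    refine ((Real.continuous_exp.tendsto L).comp hL).congr fun i => ?_
    simp [Real.exp_log (canonicalHeightSeq_pos f P i)]
  have heq : canonicalHeight f P = Real.exp L := hlim.limUnder_eq
  refine ⟨heq ▸ hlim, fun i => ?_⟩
  have h := abs_le.1 ((Real.dist_eq _ _).symm.trans_le (hdist i))
  have hr : B * (1 / 2) ^ i / (1 - 1 / 2) = B / (1 - 1 / 2) * (1 / 2) ^ i := by ring
  rw [hr] at h
  rw [heq, ← Real.exp_log (canonicalHeightSeq_pos f P i), ← Real.exp_add, ← Real.exp_add,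
    Real.exp_le_exp, Real.exp_le_exp]
  constructor <;> linarith [h.1, h.2]

/-- The canonical counting asymptotics follow from the counting asymptotics for the heights
`H(f^i(g(P)))`. -/
theorem canonical_asymptotics_of_pullback_asymptotics {a : ℝ} (f : ProjMorphism K M M)
    (hf : 2 ≤ f.deg) (g : ProjMorphism K m M)
    (hfin : ∀ (i : ℕ) (X : ℝ), {P | ((f.iterComp g i).onPoints P).mulHeight ≤ X}.Finite)
    (hpos : ∀ i : ℕ, 0 < pullbackConst (f.iterComp g i))
    (hlim : ∀ i : ℕ, Tendsto
      (fun X : ℝ => ({P | ((f.iterComp g i).onPoints P).mulHeight ≤ X}.ncard : ℝ) /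
        X ^ (a / (f.iterComp g i).deg)) atTop (𝓝 (pullbackConst (f.iterComp g i)))) :
    ∃ c : ℝ, 0 < c ∧
      Tendsto (fun i : ℕ => pullbackConst (f.iterComp g i)) atTop (𝓝 c) ∧
      (∀ X : ℝ, {P | canonicalHeight f (g.onPoints P) ≤ X}.Finite) ∧
      Asymptotics.IsEquivalent atTop (fun X : ℝ => (canonicalCount f g X : ℝ))
        (fun X : ℝ => c * X ^ ((Module.finrank ℚ K : ℝ) * a / (g.deg : ℝ))) := by
  obtain ⟨B, hB⟩ := exists_canonicalHeight_bounds f hf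
  have hn : (0 : ℝ) < Module.finrank ℚ K := by
    exact_mod_cast Module.finrank_pos (R := ℚ) (M := K)
  have hd : (0 : ℝ) < f.deg := by exact_mod_cast (by lia : 0 < f.deg)
  -- The exponent n d^i undoes both the root 1/d^i and the normalization 1/n of the absolute height,
  -- since `mulHeight` is the height relative to K.
  set k : ℕ → ℝ := fun i => Module.finrank ℚ K * (f.deg : ℝ) ^ i with hk
  have hk0 (i) : 0 < k i := by positivity
  have hset (i : ℕ) (X : ℝ) (hX : 0 ≤ X) : {P | canonicalHeightSeq f (g.onPoints P) i ≤ X} =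
      {P | ((f.iterComp g i).onPoints P).mulHeight ≤ X ^ k i} := by
    ext P
    have h := (f.onPoints^[i] (g.onPoints P)).mulHeight_pos
    simp only [Set.mem_ofPred_eq, ProjMorphism.onPoints_iterComp]
    rw [canonicalHeightSeq, weilHeight, ← Real.rpow_mul h.le, one_div_mul_one_div, one_div,
      Real.rpow_inv_le_iff_of_pos h.le hX (hk0 i)]
  have hfin' (i : ℕ) (X : ℝ) : {P | canonicalHeightSeq f (g.onPoints P) i ≤ X}.Finite := by
    rcases le_or_gt 0 X with hX | hX
    · rw [hset i X hX]
      exact hfin i _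
    · convert Set.finite_empty
      refine Set.eq_empty_of_forall_notMem fun P (hP : _ ≤ X) => ?_
      exact absurd (canonicalHeightSeq_pos f (g.onPoints P) i) (not_lt.2 (hP.trans hX.le))
  obtain ⟨h1, c, hc, hcl, hcount⟩ := exists_tendsto_count_of_uniform_limit
    (h := fun i P => canonicalHeightSeq f (g.onPoints P) i)
    (hlim := fun P => canonicalHeight f (g.onPoints P)) (ε := fun i => B * (1 / 2) ^ i)
    (c := fun i => pullbackConst (f.iterComp g i)) (a := Module.finrank ℚ K * a / g.deg)
    (by simpa using (tendsto_pow_atTop_nhds_zero_of_lt_one (by norm_num : (0 : ℝ) ≤ 1 / 2)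
      (by norm_num)).const_mul B)
    (fun i P => ((hB _).2 i).1) (fun i P => ((hB _).2 i).2) hfin' hpos (fun i => by
      -- The substitution of X^{n d^i} turns the exponent a/(d^i e) into na/e, which does not depend
      -- on i.
      refine ((hlim i).comp (tendsto_rpow_atTop (hk0 i))).congr' ?_
      filter_upwards [eventually_ge_atTop 0] with X hX
      simp only [Function.comp_apply]
      rw [hset i X hX, ← Real.rpow_mul hX, ProjMorphism.deg_iterComp]
      congr 2
      rw [hk]
      push_cast
      field_simp)
  refine ⟨c, hc, hcl, h1, ?_⟩
  rw [Asymptotics.isEquivalent_iff_tendsto_one]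
  · have := hcount.div_const c
    rw [div_self hc.ne'] at this
    refine this.congr fun X => ?_
    simp only [canonicalCount, Pi.div_apply]
    rw [div_div, mul_comm c]
  · filter_upwards [eventually_gt_atTop 0] with X hX
    positivity

end Canonical

end

noncomputable section

/-! ### Counting the points of a tiling -/

section Tiling

open Metric Module ENNReal

variable {E ι : Type*} [NormedAddCommGroup E] [NormedSpace ℝ E] [FiniteDimensional ℝ E]
  [MeasurableSpace E] [BorelSpace E] {μ : Measure E} [μ.IsAddHaarMeasure] {p : ι → E} {F D : Set E}

theorem measure_preimage_smul_sub (F : Set E) (x : E) {R : ℝ} (hR : 0 < R) :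
    μ ((fun y => R • y - x) ⁻¹' F) = ENNReal.ofReal (R ^ finrank ℝ E)⁻¹ * μ F := by
  have : (fun y => R • y - x) ⁻¹' F = (R • ·) ⁻¹' ((· - x) ⁻¹' F) := rfl
  rw [this, Measure.addHaar_preimage_smul μ hR.ne', abs_of_pos (by positivity)]
  congr 1
  simp_rw [sub_eq_add_neg]
  exact measure_preimage_add_right μ _ F

theorem dist_smul_le_of_mem_tile {E : Type*} [NormedAddCommGroup E] [NormedSpace ℝ E] {F : Set E} {ρ R : ℝ} (hR : 0 < R) (hρ : ∀ x ∈ F, ‖x‖ ≤ ρ) {x y : E}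
    (h : R • y - x ∈ F) : dist y (R⁻¹ • x) ≤ ρ / R := by
  have : y - R⁻¹ • x = R⁻¹ • (R • y - x) := by
    rw [smul_sub, smul_smul, inv_mul_cancel₀ hR.ne', one_smul]
  rw [dist_eq_norm, this, norm_smul, Real.norm_of_nonneg (by positivity), div_eq_inv_mul]
  exact mul_le_mul_of_nonneg_left (hρ _ h) (by positivity)

/-- The rescaled tiles are disjoint with equal volume, and a tile whose base point lies in D stays
within ρ/R of D. -/
theorem card_mul_le_measure_cthickening (hF : MeasurableSet F) {ρ R : ℝ}
    (hρ : ∀ x ∈ F, ‖x‖ ≤ ρ) (hR : 0 < R)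
    (htile : ∀ y, ∃! i, y - p i ∈ F) (s : Finset ι) (hs : ∀ i ∈ s, R⁻¹ • p i ∈ D) :
    s.card * (ENNReal.ofReal (R ^ finrank ℝ E)⁻¹ * μ F) ≤ μ (cthickening (ρ / R) D) := by
  have hdisj : (s : Set ι).PairwiseDisjoint fun i => (fun y => R • y - p i) ⁻¹' F := by
    intro i _ j _ hij
    refine Set.disjoint_left.2 fun y hy hy' => hij ?_
    exact (htile (R • y)).unique hy hy'
  have hmeas (i) : MeasurableSet ((fun y => R • y - p i) ⁻¹' F) :=
    hF.preimage (by fun_prop)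
  calc _ = ∑ i ∈ s, μ ((fun y => R • y - p i) ⁻¹' F) := by
        simp_rw [measure_preimage_smul_sub F _ hR]
        rw [Finset.sum_const, nsmul_eq_mul]
    _ = μ (⋃ i ∈ s, (fun y => R • y - p i) ⁻¹' F) :=
        (measure_biUnion_finset hdisj fun i _ => hmeas i).symm
    _ ≤ _ := by
        refine measure_mono (Set.iUnion₂_subset fun i hi y hy => ?_)
        exact mem_cthickening_of_dist_le _ _ _ _ (hs i hi) (dist_smul_le_of_mem_tile hR hρ hy)

/-- A point of D that lies in a tile with base point outside D is within ρ/R of the complement of D;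
this boundary layer is the error term. -/
theorem measure_le_card_mul_add (hD : MeasurableSet D) {ρ R : ℝ}
    (hρ : ∀ x ∈ F, ‖x‖ ≤ ρ) (hR : 0 < R)
    (htile : ∀ y, ∃! i, y - p i ∈ F) (s : Finset ι) (hs : ∀ i, R⁻¹ • p i ∈ D → i ∈ s) :
    μ D ≤ s.card * (ENNReal.ofReal (R ^ finrank ℝ E)⁻¹ * μ F) +
      μ.restrict D (cthickening (ρ / R) Dᶜ) := by
  have hsub : D ⊆ (⋃ i ∈ s, (fun y => R • y - p i) ⁻¹' F) ∪ (cthickening (ρ / R) Dᶜ ∩ D) := by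
    intro y hy
    obtain ⟨i, hi, -⟩ := htile (R • y)
    by_cases h : R⁻¹ • p i ∈ D
    · exact Or.inl (Set.mem_biUnion (hs i h) hi)
    · exact Or.inr ⟨mem_cthickening_of_dist_le _ _ _ _ h (dist_smul_le_of_mem_tile hR hρ hi), hy⟩
  refine (measure_mono hsub).trans ((measure_union_le _ _).trans ?_)
  rw [Measure.restrict_apply' hD]
  gcongr
  refine (measure_biUnion_finset_le _ _).trans (le_of_eq ?_)
  simp_rw [measure_preimage_smul_sub F _ hR]
  rw [Finset.sum_const, nsmul_eq_mul]

/-- Infinitely many disjoint tiles of the same positive volume do not fit into a bounded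
neighbourhood of D. -/
theorem finite_setOf_smul_mem (hF : MeasurableSet F) (hFb : Bornology.IsBounded F)
    (hF0 : μ F ≠ 0) (hDb : Bornology.IsBounded D) (htile : ∀ y, ∃! i, y - p i ∈ F) {R : ℝ}
    (hR : 0 < R) : {i | R⁻¹ • p i ∈ D}.Finite := by
  obtain ⟨ρ, hρ⟩ := hFb.exists_norm_le
  by_contra hinf
  have hfin : μ (cthickening (ρ / R) D) < ∞ := hDb.cthickening.measure_lt_top
  have hq0 : ENNReal.ofReal (R ^ finrank ℝ E)⁻¹ * μ F ≠ 0 :=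
    mul_ne_zero (by simpa using (by positivity : 0 < R ^ finrank ℝ E)) hF0
  obtain ⟨n, hn⟩ := ENNReal.exists_nat_mul_gt hq0 hfin.ne
  obtain ⟨s, hs, hsn⟩ := Set.Infinite.exists_subset_card_eq hinf n
  have := card_mul_le_measure_cthickening (μ := μ) hF hρ hR htile s hs
  rw [hsn] at this
  exact absurd this (not_le.2 hn)

/-- If the translates of `F` by the points `p i` tile the space, then the number of points in `R D`
is asymptotic to `vol(D) / vol(F) * R ^ dim`. -/
theorem tendsto_ncard_smul_mem_div (hF : MeasurableSet F) (hFb : Bornology.IsBounded F)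
    (hF0 : μ F ≠ 0) (hD : MeasurableSet D) (hDb : Bornology.IsBounded D)
    (hDf : μ (frontier D) = 0) (htile : ∀ y, ∃! i, y - p i ∈ F) :
    Tendsto (fun R : ℝ => ({i | R⁻¹ • p i ∈ D}.ncard : ℝ) / R ^ finrank ℝ E) atTop
      (𝓝 ((μ D).toReal / (μ F).toReal)) := by
  obtain ⟨ρ, hρ⟩ := hFb.exists_norm_le
  have hFtop : μ F ≠ ∞ := hFb.measure_lt_top.ne
  have hF0' : 0 < (μ F).toReal := ENNReal.toReal_pos hF0 hFtop
  have hDtop : μ D ≠ ∞ := hDb.measure_lt_top.ne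
  have : IsFiniteMeasure (μ.restrict D) := ⟨by simpa using hDtop.lt_top⟩
  have hρR : Tendsto (fun R : ℝ => ρ / R) atTop (𝓝 0) := tendsto_const_nhds.div_atTop tendsto_id
  have hcl : μ (closure D) = μ D := by
    refine le_antisymm ?_ (measure_mono subset_closure)
    rw [closure_eq_interior_union_frontier]
    exact (measure_union_le _ _).trans (by rw [hDf, add_zero]; exact measure_mono interior_subset)
  have hup : Tendsto (fun R => (μ (cthickening (ρ / R) D)).toReal / (μ F).toReal) atTop
      (𝓝 ((μ D).toReal / (μ F).toReal)) := by
    refine Tendsto.div_const ?_ _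
    refine (ENNReal.tendsto_toReal hDtop).comp ?_
    rw [← hcl]
    exact (tendsto_measure_cthickening ⟨1, one_pos, hDb.cthickening.measure_lt_top.ne⟩).comp hρR
  have hlo : Tendsto (fun R => ((μ D).toReal - (μ.restrict D (cthickening (ρ / R) Dᶜ)).toReal) /
      (μ F).toReal) atTop (𝓝 ((μ D).toReal / (μ F).toReal)) := by
    refine Tendsto.div_const ?_ _
    -- The part of D in the closure of its complement lies in the frontier, so the boundary layer
    -- shrinks to a null set.
    have h0 : μ.restrict D (closure Dᶜ) = 0 := by
      rw [Measure.restrict_apply' hD]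
      refine measure_mono_null ?_ hDf
      rintro x ⟨hx, hx'⟩
      rw [frontier_eq_closure_inter_closure]
      exact ⟨subset_closure hx', hx⟩
    have h1 := (tendsto_measure_cthickening (μ := μ.restrict D) (s := Dᶜ)
      ⟨1, one_pos, measure_ne_top _ _⟩).comp hρR
    rw [h0] at h1
    have h2 := (ENNReal.tendsto_toReal zero_ne_top).comp h1
    simpa using h2.const_sub (μ D).toReal
  refine tendsto_of_tendsto_of_tendsto_of_le_of_le' hlo hup ?_ ?_
  · filter_upwards [eventually_gt_atTop 0] with R hR
    have hfin := finite_setOf_smul_mem (μ := μ) hF hFb hF0 hDb htile hR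
    have h := measure_le_card_mul_add (μ := μ) hD hρ hR htile hfin.toFinset (by simp)
    rw [← Set.ncard_eq_toFinset_card _ hfin] at h
    have h' := ENNReal.toReal_mono (by finiteness) h
    rw [ENNReal.toReal_add (by finiteness) (by finiteness), ENNReal.toReal_mul,
      ENNReal.toReal_mul, ENNReal.toReal_ofReal (by positivity), ENNReal.toReal_natCast] at h'
    rw [div_le_div_iff₀ hF0' (by positivity)]
    have hRn : 0 < R ^ finrank ℝ E := by positivity
    calc _ ≤ _ := mul_le_mul_of_nonneg_right (sub_le_iff_le_add.2 h') hRn.le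
      _ = _ := by field_simp
  · filter_upwards [eventually_gt_atTop 0] with R hR
    have hfin := finite_setOf_smul_mem (μ := μ) hF hFb hF0 hDb htile hR
    have h := card_mul_le_measure_cthickening (μ := μ) (D := D) hF hρ hR htile hfin.toFinset
      (by simp)
    rw [← Set.ncard_eq_toFinset_card _ hfin] at h
    have h' := ENNReal.toReal_mono hDb.cthickening.measure_lt_top.ne h
    rw [ENNReal.toReal_mul,
      ENNReal.toReal_mul, ENNReal.toReal_ofReal (by positivity), ENNReal.toReal_natCast] at h'
    rw [div_le_div_iff₀ (by positivity) hF0']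
    have hRn : 0 < R ^ finrank ℝ E := by positivity
    calc _ = _ := ?_
      _ ≤ _ := mul_le_mul_of_nonneg_right h' hRn.le
    field_simp

end Tiling

end

noncomputable section

/-! ### Product measures -/

section ProductMeasure

open Measure ENNReal

theorem lintegral_fin_prod_eq_prod {n : ℕ} {E : Fin n → Type*}
    {mE : ∀ i, MeasurableSpace (E i)} {μ : (i : Fin n) → Measure (E i)} [∀ i, SigmaFinite (μ i)]
    {f : (i : Fin n) → E i → ℝ≥0∞} (hf : ∀ i, Measurable (f i)) :
    ∫⁻ x : (i : Fin n) → E i, ∏ i, f i (x i) ∂(Measure.pi μ) = ∏ i, ∫⁻ x, f i x ∂(μ i) := by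
  induction n with
  | zero => simp
  | succ n ih =>
      calc
        _ = ∫⁻ x : E 0 × ((i : Fin n) → E (Fin.succ i)),
            f 0 x.1 * ∏ i : Fin n, f (Fin.succ i) (x.2 i)
            ∂((μ 0).prod (Measure.pi (fun i ↦ μ i.succ))) := by
          rw [← ((measurePreserving_piFinSuccAbove μ 0).symm).lintegral_comp_emb
            (MeasurableEquiv.measurableEmbedding _)]
          refine lintegral_congr fun x => ?_
          rw [Fin.prod_univ_succ]
          rfl
        _ = (∫⁻ x, f 0 x ∂μ 0)
            * ∏ i : Fin n, ∫⁻ (x : E (Fin.succ i)), f (Fin.succ i) x ∂(μ i.succ) := by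
          rw [← ih fun i => hf _]
          exact lintegral_prod_mul (hf 0).aemeasurable
            (Finset.measurable_prod _ fun i _ => (hf _).comp (measurable_pi_apply i)).aemeasurable
        _ = ∏ i, ∫⁻ x, f i x ∂(μ i) := by rw [Fin.prod_univ_succ]

theorem lintegral_fintype_prod_eq_prod {ι : Type*} [Fintype ι] {E : ι → Type*}
    {mE : ∀ i, MeasurableSpace (E i)} {μ : (i : ι) → Measure (E i)} [∀ i, SigmaFinite (μ i)]
    {f : (i : ι) → E i → ℝ≥0∞} (hf : ∀ i, Measurable (f i)) :
    ∫⁻ x : (i : ι) → E i, ∏ i, f i (x i) ∂(Measure.pi μ) = ∏ i, ∫⁻ x, f i x ∂(μ i) := by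
  let e := (Fintype.equivFin ι).symm
  rw [← (measurePreserving_piCongrLeft _ e).lintegral_comp_emb
    (MeasurableEquiv.measurableEmbedding _)]
  simp_rw [← e.prod_comp, MeasurableEquiv.coe_piCongrLeft, Equiv.piCongrLeft_apply_apply]
  exact lintegral_fin_prod_eq_prod fun i => hf _

theorem pi_withDensity {ι : Type*} [Fintype ι] {E : ι → Type*}
    {mE : ∀ i, MeasurableSpace (E i)} {μ : (i : ι) → Measure (E i)} [∀ i, SigmaFinite (μ i)]
    {f : (i : ι) → E i → ℝ≥0∞} (hf : ∀ i, Measurable (f i))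
    [∀ i, SigmaFinite ((μ i).withDensity (f i))] :
    Measure.pi (fun i => (μ i).withDensity (f i)) =
      (Measure.pi μ).withDensity fun x => ∏ i, f i (x i) := by
  refine Measure.pi_eq fun s hs => ?_
  rw [withDensity_apply _ (MeasurableSet.univ_pi hs), Measure.restrict_pi_pi,
    lintegral_fintype_prod_eq_prod hf]
  exact Finset.prod_congr rfl fun i _ => (withDensity_apply _ (hs i)).symm

/-- This regroups an (m+1)-tuple of vectors indexed by places into a family of (m+1)-tuples, one for
each place. The two product measures agree on boxes of boxes, and these generate the σ-algebra. -/
theorem measurePreserving_flip (ι κ α : Type*) [Fintype ι] [Fintype κ] [MeasurableSpace α]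
    (μ : Measure α) [SigmaFinite μ] :
    MeasurePreserving (fun (z : ι → κ → α) k i => z i k)
      (Measure.pi fun _ => Measure.pi fun _ => μ) (Measure.pi fun _ => Measure.pi fun _ => μ) := by
  have hmeas : Measurable (fun (z : ι → κ → α) k i => z i k) := by fun_prop
  refine ⟨hmeas, (Measure.pi_eq_generateFrom (fun _ => generateFrom_pi)
    (fun _ => isPiSystem_pi)
    (fun _ => FiniteSpanningSetsIn.pi fun _ => μ.toFiniteSpanningSetsIn) ?_).symm⟩
  intro s hs
  choose t ht hts using hs
  have hm (k i) : MeasurableSet (t k i) := ht k i (Set.mem_univ i)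
  rw [map_apply hmeas (MeasurableSet.univ_pi fun k => hts k ▸ MeasurableSet.univ_pi (hm k))]
  have : (fun (z : ι → κ → α) k i => z i k) ⁻¹' Set.univ.pi s =
      Set.univ.pi fun i => Set.univ.pi fun k => t k i := by
    ext z
    simp only [Set.mem_preimage, Set.mem_univ_pi, ← hts]
    exact forall_comm
  rw [this, Measure.pi_pi]
  simp_rw [Measure.pi_pi, ← hts, Measure.pi_pi]
  exact Finset.prod_comm

end ProductMeasure

/-! ### Pushforward under a homogeneous gauge -/

section Gauge

open ENNReal Module
open scoped Pointwise

/-- The density of the pushforward of Lebesgue measure under a gauge whose unit ball has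
volume `V` in dimension `k`. -/
def gaugeDensity (V : ℝ) (k : ℕ) (t : ℝ) : ℝ≥0∞ :=
  (Set.Ioi (0 : ℝ)).indicator (fun t => ENNReal.ofReal (V * (k * t ^ (k - 1)))) t

theorem measurable_gaugeDensity (V : ℝ) (k : ℕ) : Measurable (gaugeDensity V k) :=
  Measurable.indicator (by fun_prop) measurableSet_Ioi

theorem withDensity_gaugeDensity_Iic {V : ℝ} (hV : 0 ≤ V) {k : ℕ} (hk : k ≠ 0) (b : ℝ) :
    volume.withDensity (gaugeDensity V k) (Set.Iic b) =
      if 0 ≤ b then ENNReal.ofReal (V * b ^ k) else 0 := by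
  rw [withDensity_apply _ measurableSet_Iic]
  unfold gaugeDensity
  rw [lintegral_indicator measurableSet_Ioi, Measure.restrict_restrict measurableSet_Ioi,
    Set.Ioi_inter_Iic]
  split_ifs with hb
  · rw [← ofReal_integral_eq_lintegral_ofReal]
    · congr 1
      rw [← intervalIntegral.integral_of_le hb, intervalIntegral.integral_const_mul,
        intervalIntegral.integral_const_mul, integral_pow]
      have : k - 1 + 1 = k := Nat.sub_add_cancel (Nat.one_le_iff_ne_zero.2 hk)
      have hk' : (k : ℝ) ≠ 0 := by exact_mod_cast hk
      rw [this, zero_pow hk, sub_zero, ← Nat.cast_add_one, this]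
      field_simp
    · exact ((continuous_const.mul (continuous_const.mul (continuous_pow _))).intervalIntegrable
        0 b).1
    · filter_upwards [ae_restrict_mem measurableSet_Ioc] with t ht
      have := ht.1.le
      positivity
  · rw [Set.Ioc_eq_empty (by push Not at hb; exact not_lt.2 hb.le)]
    simp

instance sigmaFinite_withDensity_gaugeDensity (V : ℝ) (k : ℕ) :
    SigmaFinite ((volume : Measure ℝ).withDensity (gaugeDensity V k)) := by
  refine SigmaFinite.withDensity_of_ne_top (Eventually.of_forall fun t => ?_)
  unfold gaugeDensity Set.indicator
  split_ifs
  exacts [ENNReal.ofReal_ne_top, ENNReal.zero_ne_top]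

variable {E : Type*} [NormedAddCommGroup E] [NormedSpace ℝ E] [FiniteDimensional ℝ E]
  [MeasurableSpace E] [BorelSpace E] {μ : Measure E} [μ.IsAddHaarMeasure] {N : E → ℝ}

/-- By homogeneity a sublevel set of height b > 0 is b times the unit ball, so its volume is V b^k.
The measures of the half-lines (-∞, b] determine the pushforward. -/
theorem map_gauge_eq_withDensity [Nontrivial E] (hN : Continuous N)
    (hsmul : ∀ (t : ℝ) z, 0 ≤ t → N (t • z) = t * N z) {c : ℝ} (hc : 0 < c)
    (hle : ∀ z, c * ‖z‖ ≤ N z) :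
    μ.map N = volume.withDensity (gaugeDensity (μ {z | N z ≤ 1}).toReal (finrank ℝ E)) := by
  have hk : finrank ℝ E ≠ 0 := finrank_pos.ne'
  have hbd (b : ℝ) : Bornology.IsBounded {z | N z ≤ b} := by
    refine (Metric.isBounded_closedBall (x := (0 : E)) (r := b / c)).subset fun z (hz : _ ≤ b) => ?_
    rw [mem_closedBall_zero_iff, le_div_iff₀' hc]
    exact (hle z).trans hz
  have hone : μ {z | N z ≤ 1} ≠ ∞ := (hbd 1).measure_lt_top.ne
  have hIic (b : ℝ) : μ {z | N z ≤ b} =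
      if 0 ≤ b then ENNReal.ofReal ((μ {z | N z ≤ 1}).toReal * b ^ finrank ℝ E) else 0 := by
    split_ifs with hb
    · rcases hb.eq_or_lt with rfl | hb
      · rw [zero_pow hk, mul_zero, ENNReal.ofReal_zero]
        refine measure_mono_null (t := {0}) (fun z (hz : N z ≤ 0) => ?_) (measure_singleton 0)
        have := (hle z).trans hz
        rw [Set.mem_singleton_iff, ← norm_le_zero_iff]
        exact nonpos_of_mul_nonpos_right this hc
      · have : {z | N z ≤ b} = b • {z | N z ≤ 1} := by
          ext z
          rw [Set.mem_smul_set_iff_inv_smul_mem₀ hb.ne', Set.mem_ofPred_eq, Set.mem_ofPred_eq,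
            hsmul _ _ (by positivity), inv_mul_le_iff₀ hb, mul_one]
        rw [this, Measure.addHaar_smul, ENNReal.ofReal_mul ENNReal.toReal_nonneg,
          ENNReal.ofReal_toReal hone, mul_comm, abs_of_pos (by positivity)]
    · convert measure_empty (μ := μ)
      refine Set.eq_empty_of_forall_notMem fun z (hz : N z ≤ b) => hb ?_
      exact ((mul_nonneg hc.le (norm_nonneg z)).trans (hle z)).trans hz
  refine Measure.ext_of_generateFrom_of_iUnion (Set.range Set.Iic) (fun n : ℕ => Set.Iic (n : ℝ))
    ?_ isPiSystem_Iic ?_ (fun n => ⟨_, rfl⟩) ?_ ?_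
  · rw [BorelSpace.measurable_eq (α := ℝ), borel_eq_generateFrom_Iic]
  · exact Set.eq_univ_of_forall fun x => Set.mem_iUnion.2 (exists_nat_ge x)
  · intro n
    rw [Measure.map_apply hN.measurable measurableSet_Iic]
    exact (hbd n).measure_lt_top.ne
  · rintro _ ⟨b, rfl⟩
    rw [Measure.map_apply hN.measurable measurableSet_Iic,
      withDensity_gaugeDensity_Iic ENNReal.toReal_nonneg hk]
    exact hIic b

end Gauge

end

noncomputable section

/-! ### Gauges at the infinite places -/

open NumberField.InfinitePlace NumberField.mixedEmbedding NumberField.mixedEmbedding.fundamentalCone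

open ENNReal Module

/-- A family of continuous gauges on the spaces `K_w ^ {m+1}`, for `w` an infinite place of `K`. -/
structure PlaceGauge (K : Type*) [Field K] (m : ℕ) where
  /-- the gauge at a real place -/
  re : {w : InfinitePlace K // IsReal w} → (Fin (m + 1) → ℝ) → ℝ
  /-- the gauge at a complex place -/
  im : {w : InfinitePlace K // IsComplex w} → (Fin (m + 1) → ℂ) → ℝ
  continuous_re : ∀ w, Continuous (re w)
  continuous_im : ∀ w, Continuous (im w)
  re_smul : ∀ w (t : ℝ) z, re w (t • z) = |t| * re w z
  im_smul : ∀ w (t : ℂ) z, im w (t • z) = ‖t‖ * im w z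
  exists_le_re : ∀ w, ∃ c > 0, ∀ z, c * ‖z‖ ≤ re w z
  exists_le_im : ∀ w, ∃ c > 0, ∀ z, c * ‖z‖ ≤ im w z

namespace PlaceGauge

variable {K : Type*} [Field K] {m : ℕ} (G : PlaceGauge K m)

open Classical in
/-- The vector of the values of the gauges at all infinite places. -/
def val (z : Fin (m + 1) → mixedSpace K) : realSpace K := fun w =>
  if h : w.IsReal then G.re ⟨w, h⟩ fun i => (z i).1 ⟨w, h⟩
  else G.im ⟨w, not_isReal_iff_isComplex.1 h⟩ fun i => (z i).2 ⟨w, not_isReal_iff_isComplex.1 h⟩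

open Classical in
/-- The volume of the unit ball of the gauge at a place. -/
def vol (w : InfinitePlace K) : ℝ :=
  if h : w.IsReal then (volume {z | G.re ⟨w, h⟩ z ≤ 1}).toReal
  else (volume {z | G.im ⟨w, not_isReal_iff_isComplex.1 h⟩ z ≤ 1}).toReal

theorem val_real (z : Fin (m + 1) → mixedSpace K) (w : {w : InfinitePlace K // IsReal w}) :
    G.val z w = G.re w fun i => (z i).1 w := by
  simp [val, w.2]

theorem val_complex (z : Fin (m + 1) → mixedSpace K) (w : {w : InfinitePlace K // IsComplex w}) :
    G.val z w = G.im w fun i => (z i).2 w := by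
  simp [val, not_isReal_iff_isComplex.2 w.2]

theorem re_nonneg (w) (z) : 0 ≤ G.re w z := by
  obtain ⟨c, hc, h⟩ := G.exists_le_re w
  exact le_trans (by positivity) (h z)

theorem im_nonneg (w) (z) : 0 ≤ G.im w z := by
  obtain ⟨c, hc, h⟩ := G.exists_le_im w
  exact le_trans (by positivity) (h z)

theorem val_nonneg (z : Fin (m + 1) → mixedSpace K) (w : InfinitePlace K) : 0 ≤ G.val z w := by
  unfold val
  split_ifs
  exacts [G.re_nonneg _ _, G.im_nonneg _ _]

theorem vol_nonneg (w : InfinitePlace K) : 0 ≤ G.vol w := by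
  unfold vol
  split_ifs <;> exact ENNReal.toReal_nonneg

theorem continuous_val : Continuous G.val := by
  refine continuous_pi fun w => ?_
  unfold val
  split_ifs
  · exact (G.continuous_re _).comp (by fun_prop)
  · exact (G.continuous_im _).comp (by fun_prop)

theorem val_smul {t : ℝ} (ht : 0 ≤ t) (z : Fin (m + 1) → mixedSpace K) :
    G.val (t • z) = t • G.val z := by
  funext w
  by_cases h : w.IsReal
  · have h1 := G.val_real (t • z) ⟨w, h⟩
    have h2 := G.val_real z ⟨w, h⟩
    simp only at h1 h2
    rw [Pi.smul_apply, h1, h2, smul_eq_mul, ← abs_of_nonneg ht, ← G.re_smul, abs_of_nonneg ht]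
    rfl
  · have hc := not_isReal_iff_isComplex.1 h
    have h1 := G.val_complex (t • z) ⟨w, hc⟩
    have h2 := G.val_complex z ⟨w, hc⟩
    simp only at h1 h2
    have hn : ‖(t : ℂ)‖ = t := by simp [abs_of_nonneg ht]
    rw [Pi.smul_apply, h1, h2, smul_eq_mul]
    nth_rewrite 2 [← hn]
    rw [← G.im_smul]
    congr 1

/-- The action of a scalar of K on tuples becomes multiplication by its absolute values on gauge
vectors. Hence a fundamental domain for the units can be pulled back along `val`. -/
theorem val_mul (x : K) (z : Fin (m + 1) → mixedSpace K) (w : InfinitePlace K) :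
    G.val (fun i => mixedEmbedding K x * z i) w = w x * G.val z w := by
  by_cases h : w.IsReal
  · have h1 := G.val_real (fun i => mixedEmbedding K x * z i) ⟨w, h⟩
    have h2 := G.val_real z ⟨w, h⟩
    simp only at h1 h2
    rw [h1, h2]
    have hw : w x = |(mixedEmbedding K x).1 ⟨w, h⟩| := by
      rw [← normAtPlace_apply w x, normAtPlace_apply_of_isReal h, Real.norm_eq_abs]
    rw [hw, ← G.re_smul]
    rfl
  · have hc := not_isReal_iff_isComplex.1 h
    have h1 := G.val_complex (fun i => mixedEmbedding K x * z i) ⟨w, hc⟩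
    have h2 := G.val_complex z ⟨w, hc⟩
    simp only at h1 h2
    rw [h1, h2]
    have hw : w x = ‖(mixedEmbedding K x).2 ⟨w, hc⟩‖ := by
      rw [← normAtPlace_apply w x, normAtPlace_apply_of_isComplex hc]
    rw [hw, ← G.im_smul]
    rfl

variable [NumberField K]

open scoped Classical

/-- After regrouping by places, Lebesgue measure is a product whose factors are pushed forward
separately by one gauge each. The real dimension at w is `w.mult * (m + 1)`. -/
theorem map_val_volume : (volume : Measure (Fin (m + 1) → mixedSpace K)).map G.val =
    Measure.pi fun w => volume.withDensity (gaugeDensity (G.vol w) (w.mult * (m + 1))) := by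
  refine (Measure.pi_eq fun s hs => ?_).symm
  rw [Measure.map_apply G.continuous_val.measurable (MeasurableSet.univ_pi hs)]
  set Φ : (Fin (m + 1) → mixedSpace K) → ({w : InfinitePlace K // IsReal w} → Fin (m + 1) → ℝ) ×
    ({w : InfinitePlace K // IsComplex w} → Fin (m + 1) → ℂ) :=
    fun z => (fun w i => (z i).1 w, fun w i => (z i).2 w) with hΦ
  have hΦm : MeasurePreserving Φ volume volume :=
    ((measurePreserving_flip (Fin (m + 1)) {w : InfinitePlace K // IsReal w} ℝ volume).prod
      (measurePreserving_flip (Fin (m + 1)) {w : InfinitePlace K // IsComplex w} ℂ volume)).comp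
      (volume_measurePreserving_arrowProdEquivProdArrow _ _ (Fin (m + 1)))
  have hset : G.val ⁻¹' Set.univ.pi s = Φ ⁻¹' ((Set.univ.pi fun w => G.re w ⁻¹' s w) ×ˢ
      (Set.univ.pi fun w => G.im w ⁻¹' s w)) := by
    ext z
    simp only [Set.mem_preimage, Set.mem_univ_pi, Set.mem_prod, hΦ]
    constructor
    · intro h
      exact ⟨fun w => G.val_real z w ▸ h w, fun w => G.val_complex z w ▸ h w⟩
    · rintro ⟨h1, h2⟩ w
      by_cases h : w.IsReal
      · exact (G.val_real z ⟨w, h⟩) ▸ h1 ⟨w, h⟩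
      · exact (G.val_complex z ⟨w, not_isReal_iff_isComplex.1 h⟩) ▸ h2 ⟨w, _⟩
  have hm1 : MeasurableSet (Set.univ.pi fun w : {w : InfinitePlace K // IsReal w} =>
      G.re w ⁻¹' s w) := MeasurableSet.univ_pi fun w => (G.continuous_re w).measurable (hs w)
  have hm2 : MeasurableSet (Set.univ.pi fun w : {w : InfinitePlace K // IsComplex w} =>
      G.im w ⁻¹' s w) := MeasurableSet.univ_pi fun w => (G.continuous_im w).measurable (hs w)
  rw [hset, hΦm.measure_preimage (hm1.prod hm2).nullMeasurableSet, Measure.volume_eq_prod,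
    Measure.prod_prod, volume_pi_pi, volume_pi_pi, prod_eq_prod_mul_prod]
  congr 1
  · refine Finset.prod_congr rfl fun w _ => ?_
    obtain ⟨c, hc, hle⟩ := G.exists_le_re w
    rw [← Measure.map_apply (G.continuous_re w).measurable (hs w),
      map_gauge_eq_withDensity (G.continuous_re w)
        (fun t z ht => by rw [G.re_smul, abs_of_nonneg ht]) hc hle]
    simp [vol, w.2, mult_isReal]
  · refine Finset.prod_congr rfl fun w _ => ?_
    obtain ⟨c, hc, hle⟩ := G.exists_le_im w
    rw [← Measure.map_apply (G.continuous_im w).measurable (hs w),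
      map_gauge_eq_withDensity (G.continuous_im w)
        (fun t z ht => by
          rw [← Complex.coe_smul, G.im_smul, Complex.norm_real, Real.norm_of_nonneg ht]) hc hle]
    have : finrank ℝ (Fin (m + 1) → ℂ) = 2 * (m + 1) := by
      rw [Module.finrank_pi_fintype]
      simp [mul_comm]
    rw [this]
    simp [vol, not_isReal_iff_isComplex.2 w.2, mult_isComplex]

theorem volume_preimage_val {B : Set (realSpace K)} (hB : MeasurableSet B) :
    volume (G.val ⁻¹' B) =
      ∫⁻ x in B, ∏ w, gaugeDensity (G.vol w) (w.mult * (m + 1)) (x w) := by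
  rw [← Measure.map_apply G.continuous_val.measurable hB, map_val_volume,
    pi_withDensity fun w => measurable_gaugeDensity _ _, withDensity_apply _ hB]
  rfl

/-- The left side is the integrand produced by the change of variables `expMapBasis`. It depends on
the single coordinate `w₀`, because the product of the `t w ^ w.mult` is the exponential of n times
that coordinate. -/
theorem prod_gaugeDensity_expMapBasis (x : realSpace K) :
    ENNReal.ofReal (Real.exp (x Units.dirichletUnitTheorem.w₀ * finrank ℚ K)) *
      (∏ i : {w : InfinitePlace K // IsComplex w},
        ENNReal.ofReal (expMapBasis (fun w ↦ x w) i))⁻¹ *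
      ∏ w, gaugeDensity (G.vol w) (w.mult * (m + 1)) (expMapBasis x w) =
    ENNReal.ofReal ((∏ w, G.vol w) * (2 ^ nrComplexPlaces K * (m + 1) ^ Fintype.card
      (InfinitePlace K))) *
      ENNReal.ofReal (Real.exp (x Units.dirichletUnitTheorem.w₀ *
        (finrank ℚ K * (m + 1) : ℕ))) := by
  set t := expMapBasis x with ht
  have ht0 (w) : 0 < t w := expMapBasis_pos x w
  have hV := G.vol_nonneg
  have hd (w : InfinitePlace K) : gaugeDensity (G.vol w) (w.mult * (m + 1)) (t w) =
      ENNReal.ofReal (G.vol w * ((w.mult * (m + 1) : ℕ) * t w ^ (w.mult * (m + 1) - 1))) :=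
    Set.indicator_of_mem (ht0 w) _
  have hcx : 0 < ∏ i : {w : InfinitePlace K // IsComplex w}, t i := Finset.prod_pos fun i _ => ht0 i
  simp_rw [hd]
  rw [← ENNReal.ofReal_prod_of_nonneg fun (i : {w : InfinitePlace K // IsComplex w}) _ => (ht0 i).le,
    ← ENNReal.ofReal_prod_of_nonneg fun w _ => by have := (ht0 w).le; have := hV w; positivity, ← ENNReal.ofReal_inv_of_pos hcx,
    ← ENNReal.ofReal_mul (Real.exp_pos _).le, ← ENNReal.ofReal_mul (by positivity),
    ← ENNReal.ofReal_mul (mul_nonneg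
      (Finset.prod_nonneg fun w _ => hV w) (by positivity))]
  congr 1
  have hexp := prod_expMapBasis_pow x
  rw [← ht] at hexp
  -- Split the exponent as mult·m + (mult - 1). The first part gives the m-th power of the norm. The
  -- second survives only at complex places, where it cancels the inverse product in the Jacobian.
  have h1 : ∏ w : InfinitePlace K, t w ^ (w.mult * (m + 1) - 1) =
      Real.exp (x Units.dirichletUnitTheorem.w₀ * finrank ℚ K) ^ m *
        ∏ i : {w : InfinitePlace K // IsComplex w}, t i := by
    have h2 : ∏ w : InfinitePlace K, t w ^ (w.mult - 1) =
        ∏ i : {w : InfinitePlace K // IsComplex w}, t i := by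
      rw [prod_eq_prod_mul_prod]
      have e1 : ∏ w : {w : InfinitePlace K // IsReal w}, t w ^ (w.1.mult - 1) = 1 :=
        Finset.prod_eq_one fun w _ => by simp [mult_isReal]
      have e2 : ∏ w : {w : InfinitePlace K // IsComplex w}, t w ^ (w.1.mult - 1) = ∏ i :
          {w : InfinitePlace K // IsComplex w}, t i :=
        Finset.prod_congr rfl fun w _ => by simp [mult_isComplex]
      rw [e1, e2, one_mul]
    rw [mul_comm (x _), Real.exp_nat_mul, ← hexp, ← Finset.prod_pow, ← h2,
      ← Finset.prod_mul_distrib]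
    refine Finset.prod_congr rfl fun w _ => ?_
    rw [← pow_mul, ← pow_add]
    congr 1
    have := w.mult_pos
    rw [Nat.mul_succ]
    lia
  have h3 : ∏ w : InfinitePlace K, ((w.mult * (m + 1) : ℕ) : ℝ) =
      2 ^ nrComplexPlaces K * (m + 1) ^ Fintype.card (InfinitePlace K) := by
    push_cast
    rw [Finset.prod_mul_distrib, Finset.prod_const, Finset.card_univ, prod_eq_prod_mul_prod]
    have e1 : ∏ w : {w : InfinitePlace K // IsReal w}, (w.1.mult : ℝ) = 1 :=
      Finset.prod_eq_one fun w _ => by simp [mult_isReal]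
    have e2 : ∏ w : {w : InfinitePlace K // IsComplex w}, (w.1.mult : ℝ) =
        2 ^ nrComplexPlaces K := by
      rw [Finset.prod_congr rfl (g := fun _ => (2 : ℝ)) fun w _ => by simp [mult_isComplex],
        Finset.prod_const, Finset.card_univ]
    rw [e1, e2, one_mul]
  rw [Finset.prod_mul_distrib, Finset.prod_mul_distrib, h1, h3]
  have h4 : Real.exp (x Units.dirichletUnitTheorem.w₀ * (finrank ℚ K * (m + 1) : ℕ)) =
      Real.exp (x Units.dirichletUnitTheorem.w₀ * finrank ℚ K) *
      Real.exp (x Units.dirichletUnitTheorem.w₀ * finrank ℚ K) ^ m := by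
    rw [← pow_succ', ← Real.exp_nat_mul]
    congr 1
    push_cast
    ring
  rw [h4]
  field_simp

theorem measurableSet_image_expMapBasis {s : Set (realSpace K)} (hs : MeasurableSet s) :
    MeasurableSet (expMapBasis '' s) :=
  hs.image_of_continuousOn_injOn (continuous_expMapBasis K).continuousOn
    (injective_expMapBasis K).injOn

theorem volume_preimage_val_image_expMapBasis {s : Set (realSpace K)} (hs : MeasurableSet s) :
    volume (G.val ⁻¹' (expMapBasis '' s)) =
      ENNReal.ofReal ((∏ w, G.vol w) * (m + 1) ^ Fintype.card (InfinitePlace K) *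
        Units.regulator K * finrank ℚ K) *
      ∫⁻ x in s, ENNReal.ofReal (Real.exp (x Units.dirichletUnitTheorem.w₀ *
        (finrank ℚ K * (m + 1) : ℕ))) := by
  have hmeas : Measurable fun x : realSpace K =>
      ∏ w, gaugeDensity (G.vol w) (w.mult * (m + 1)) (x w) :=
    Finset.measurable_prod _ fun w _ => (measurable_gaugeDensity _ _).comp (measurable_pi_apply w)
  have hV : 0 ≤ ∏ w, G.vol w := Finset.prod_nonneg fun w _ => G.vol_nonneg w
  have hR := (Units.regulator_pos K).le
  rw [G.volume_preimage_val (measurableSet_image_expMapBasis hs),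
    setLIntegral_expMapBasis_image hs hmeas]
  simp_rw [prod_gaugeDensity_expMapBasis]
  rw [lintegral_const_mul _ (by fun_prop), ← mul_assoc]
  congr 1
  rw [ENNReal.inv_pow.symm, ← ENNReal.ofReal_ofNat, ← ENNReal.ofReal_pow (by norm_num),
    ← ENNReal.ofReal_inv_of_pos (by positivity), ← ENNReal.ofReal_mul (by positivity),
    ← ENNReal.ofReal_natCast, ← ENNReal.ofReal_mul (by positivity),
    ← ENNReal.ofReal_mul (by positivity)]
  congr 1
  field_simp

/-- The elements of the fundamental domain for the action of the units of gauge at most one. -/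
def unitDomain : Set (Fin (m + 1) → mixedSpace K) := G.val ⁻¹' (expMapBasis '' paramSet K)

theorem measurableSet_unitDomain : MeasurableSet G.unitDomain :=
  G.continuous_val.measurable (measurableSet_image_expMapBasis (measurableSet_paramSet K))

/-- The exponential integrates over the parameter set to 1/(n(m+1)). This removes n and one of the r
+ 1 factors m + 1, one for each infinite place, which explains the exponent r in the constant. -/
theorem volume_unitDomain : volume G.unitDomain =
    ENNReal.ofReal ((∏ w, G.vol w) * (m + 1) ^ Units.rank K * Units.regulator K) := by
  have hn : 0 < finrank ℚ K := finrank_pos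
  have hn' : (0 : ℝ) < finrank ℚ K := by exact_mod_cast hn
  have hV : 0 ≤ ∏ w, G.vol w := Finset.prod_nonneg fun w _ => G.vol_nonneg w
  have hR := (Units.regulator_pos K).le
  rw [unitDomain, G.volume_preimage_val_image_expMapBasis (measurableSet_paramSet K),
    setLIntegral_paramSet_exp K (by positivity), ← ENNReal.ofReal_natCast,
    ← ENNReal.ofReal_inv_of_pos (by positivity), ← ENNReal.ofReal_mul (by positivity)]
  congr 1
  have : Fintype.card (InfinitePlace K) = Units.rank K + 1 := by
    rw [Units.rank, Nat.sub_add_cancel Fintype.card_pos]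
  rw [this, pow_succ]
  push_cast
  field_simp

theorem isBounded_preimage_val {B : Set (realSpace K)} (hB : Bornology.IsBounded B) :
    Bornology.IsBounded (G.val ⁻¹' B) := by
  obtain ⟨C, hC⟩ := hB.exists_norm_le
  choose c hc hcle using G.exists_le_re
  choose d hd hdle using G.exists_le_im
  refine isBounded_iff_forall_norm_le.2 ⟨∑ w, |C / c w| + ∑ w, |C / d w|, fun z hz => ?_⟩
  have hzw (w) : G.val z w ≤ C :=
    (le_abs_self _).trans ((norm_le_pi_norm (G.val z) w).trans (hC _ hz))
  have h0 : 0 ≤ ∑ w, |C / c w| := Finset.sum_nonneg fun _ _ => abs_nonneg _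
  have h0' : 0 ≤ ∑ w, |C / d w| := Finset.sum_nonneg fun _ _ => abs_nonneg _
  refine (pi_norm_le_iff_of_nonneg (add_nonneg h0 h0')).2 fun i => ?_
  rw [Prod.norm_def]
  refine max_le ((pi_norm_le_iff_of_nonneg (add_nonneg h0 h0')).2 fun w => ?_)
    ((pi_norm_le_iff_of_nonneg (add_nonneg h0 h0')).2 fun w => ?_)
  · have h1 := (hcle w _).trans ((G.val_real z w).symm.trans_le (hzw w))
    rw [← le_div_iff₀' (hc w)] at h1
    have h2 := Finset.single_le_sum (f := fun w => |C / c w|) (fun _ _ => abs_nonneg _)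
      (Finset.mem_univ w)
    exact (norm_le_pi_norm (fun i => (z i).1 w) i).trans (h1.trans
      ((le_abs_self _).trans (h2.trans (le_add_of_nonneg_right h0'))))
  · have h1 := (hdle w _).trans ((G.val_complex z w).symm.trans_le (hzw w))
    rw [← le_div_iff₀' (hd w)] at h1
    have h2 := Finset.single_le_sum (f := fun w => |C / d w|) (fun _ _ => abs_nonneg _)
      (Finset.mem_univ w)
    exact (norm_le_pi_norm (fun i => (z i).2 w) i).trans (h1.trans
      ((le_abs_self _).trans (h2.trans (le_add_of_nonneg_left h0))))

theorem isBounded_unitDomain : Bornology.IsBounded G.unitDomain :=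
  (G.isBounded_preimage_val (isCompact_compactSet K).isBounded).subset <| Set.preimage_mono <|
    (Set.image_mono subset_closure).trans (expMapBasis_closure_subset_compactSet K)

/-- The frontier lies over the boundary of the parameter set, which is null, together with the fibre
over 0, the only point that `compactSet` adds to the image of the closure. -/
theorem volume_frontier_unitDomain : volume (frontier G.unitDomain) = 0 := by
  have hcl : closure G.unitDomain ⊆ G.val ⁻¹' compactSet K := by
    refine (G.continuous_val.closure_preimage_subset _).trans (Set.preimage_mono ?_)
    refine (isCompact_compactSet K).isClosed.closure_subset_iff.mpr ?_
    exact (Set.image_mono subset_closure).trans (expMapBasis_closure_subset_compactSet _)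
  have h_int : G.val ⁻¹' (expMapBasis '' interior (paramSet K)) ⊆ interior G.unitDomain := by
    refine subset_trans (Set.preimage_mono ?_) <|
      preimage_interior_subset_interior_preimage G.continuous_val
    have : IsOpen (expMapBasis '' (interior (paramSet K))) :=
      expMapBasis.isOpen_image_of_subset_source isOpen_interior (by simp [expMapBasis_source])
    exact interior_maximal (Set.image_mono interior_subset) this
  have hsub : frontier G.unitDomain ⊆ G.val ⁻¹' (expMapBasis ''
      (closure (paramSet K) \ interior (paramSet K))) ∪ G.val ⁻¹' {0} := by
    rintro z ⟨hz1, hz2⟩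
    have h1 := hcl hz1
    have h2 := fun h => hz2 (h_int h)
    rw [Set.mem_preimage, compactSet_eq_union] at h1
    rcases h1 with ⟨y, hy, hyz⟩ | h1
    · exact Or.inl ⟨y, ⟨hy, fun hy' => h2 ⟨y, hy', hyz⟩⟩, hyz⟩
    · exact Or.inr h1
  refine measure_mono_null hsub (measure_union_null ?_ ?_)
  · rw [G.volume_preimage_val_image_expMapBasis
      (measurableSet_closure.diff measurableSet_interior)]
    have h0 : volume (closure (paramSet K) \ interior (paramSet K)) = 0 :=
      (ae_le_set.1 (closure_paramSet_ae_interior K).le)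
    rw [setLIntegral_measure_zero _ _ h0, mul_zero]
  · rw [G.volume_preimage_val (measurableSet_singleton 0)]
    exact setLIntegral_measure_zero _ _ (by simp)

theorem mem_unitDomain_iff (z : Fin (m + 1) → mixedSpace K) : z ∈ G.unitDomain ↔
    mixedSpaceOfRealSpace (G.val z) ∈ fundamentalCone K ∧ ∏ w, G.val z w ^ w.mult ≤ 1 := by
  have h1 : mixedSpaceOfRealSpace (G.val z) ∈ normLeOne K ↔ z ∈ G.unitDomain := by
    rw [normLeOne_eq_preimage, Set.mem_preimage,
      normAtAllPlaces_mixedSpaceOfRealSpace (G.val_nonneg z)]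
    rfl
  rw [← h1, mem_normLeOne, mixedEmbedding.norm_apply]
  simp_rw [normAtPlace_mixedSpaceOfRealSpace (G.val_nonneg z _)]

end PlaceGauge

end

noncomputable section

/-! ### Counting integral vectors in a congruence class modulo units -/

open NumberField.InfinitePlace NumberField.mixedEmbedding NumberField.mixedEmbedding.fundamentalCone

open ENNReal Module nonZeroDivisors

section IntegralVectors

open scoped Classical

variable {K : Type*} [Field K] [NumberField K] {m : ℕ}

instance borelSpace_mixedSpace_pi : BorelSpace (Fin (m + 1) → mixedSpace K) :=
  inferInstanceAs
    (BorelSpace (Fin (m + 1) → ({w : InfinitePlace K // w.IsReal} → ℝ) ×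
      ({w : InfinitePlace K // w.IsComplex} → ℂ)))

instance isAddHaarMeasure_mixedSpace_pi :
    (volume : Measure (Fin (m + 1) → mixedSpace K)).IsAddHaarMeasure :=
  have h : MeasurableAdd (mixedSpace K) := inferInstance
  @Measure.pi.isAddHaarMeasure (Fin (m + 1)) (fun _ => mixedSpace K) _ _ (fun _ => volume) _ _ _ _
    fun _ => h

/-- The image of an integral vector in `(K ⊗ ℝ) ^ {m+1}`. -/
def integralVector (x : Fin (m + 1) → 𝓞 K) : Fin (m + 1) → mixedSpace K :=
  fun i => mixedEmbedding K (x i)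

/-- A bounded fundamental domain for the lattice `I ^ {m+1}`. -/
theorem exists_fundamentalDomain_ideal_pow (I : Ideal (𝓞 K)) (hI : I ≠ ⊥) :
    ∃ F : Set (Fin (m + 1) → mixedSpace K), MeasurableSet F ∧ Bornology.IsBounded F ∧
      volume F ≠ 0 ∧
      (volume F).toReal =
        (I.absNorm * (√|(discr K : ℝ)| / 2 ^ nrComplexPlaces K)) ^ (m + 1) ∧
      ∀ (x₀ : Fin (m + 1) → 𝓞 K) (y : Fin (m + 1) → mixedSpace K),
        ∃! x : {x : Fin (m + 1) → 𝓞 K // ∀ i, x i - x₀ i ∈ I}, y - integralVector x.1 ∈ F := by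
  let J : (FractionalIdeal (𝓞 K)⁰ K)ˣ := FractionalIdeal.mk0 K ⟨I, mem_nonZeroDivisors_of_ne_zero hI⟩
  have hJ : (J : FractionalIdeal (𝓞 K)⁰ K) = (I : FractionalIdeal (𝓞 K)⁰ K) :=
    FractionalIdeal.coe_mk0 K _
  let b := fractionalIdealLatticeBasis K J
  have hvol : volume (ZSpan.fundamentalDomain b) ≠ 0 := ZSpan.measure_fundamentalDomain_ne_zero _
  refine ⟨Set.univ.pi fun _ => ZSpan.fundamentalDomain b,
    MeasurableSet.univ_pi fun _ => ZSpan.fundamentalDomain_measurableSet _,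
    Bornology.IsBounded.pi fun _ => ZSpan.fundamentalDomain_isBounded _, ?_, ?_, ?_⟩
  · rw [volume_pi_pi, Finset.prod_const]
    exact pow_ne_zero _ hvol
  · rw [volume_pi_pi, Finset.prod_const, Finset.card_univ, Fintype.card_fin, toReal_pow]
    congr 1
    rw [volume_fundamentalDomain_fractionalIdealLatticeBasis, hJ, FractionalIdeal.coeIdeal_absNorm,
      volume_fundamentalDomain_latticeBasis, toReal_mul, toReal_mul]
    simp only [div_eq_inv_mul, toReal_pow, toReal_inv]
    simp [Int.norm_eq_abs]
  · intro x₀ y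
    have key (i : Fin (m + 1)) : ∃! a : 𝓞 K, a - x₀ i ∈ I ∧
        y i - mixedEmbedding K a ∈ ZSpan.fundamentalDomain b := by
      obtain ⟨⟨v, hv⟩, hv1, hv2⟩ := ZSpan.exist_unique_vadd_mem_fundamentalDomain b
        (y i - mixedEmbedding K (x₀ i))
      have hv' := (mem_span_fractionalIdealLatticeBasis K J).1 hv
      obtain ⟨k, hk, rfl⟩ := hv'
      rw [hJ, SetLike.mem_coe] at hk
      obtain ⟨c, hc, rfl⟩ := (FractionalIdeal.mem_coeIdeal _).1 hk
      refine ⟨x₀ i - c, ⟨by simpa using hc, ?_⟩, ?_⟩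
      · convert hv1 using 1
        rw [Submodule.vadd_def, vadd_eq_add]
        simp only [map_sub]
        abel
      · rintro a ⟨ha, ha'⟩
        have hmem : mixedEmbedding K (algebraMap (𝓞 K) K (x₀ i - a)) ∈
            Submodule.span ℤ (Set.range b) := by
          refine (mem_span_fractionalIdealLatticeBasis K J).2 ⟨_, ?_, rfl⟩
          rw [hJ, SetLike.mem_coe]
          refine (FractionalIdeal.mem_coeIdeal _).2 ⟨_, ?_, rfl⟩
          rw [← neg_sub]
          exact I.neg_mem ha
        have h3 := hv2 ⟨_, hmem⟩ (by
          convert ha' using 1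
          rw [Submodule.vadd_def, vadd_eq_add]
          simp only [map_sub]
          abel)
        have h4 := (mixedEmbedding_injective K) (congrArg Subtype.val h3)
        have h5 : x₀ i - a = c := RingOfIntegers.coe_injective h4
        rw [← h5]
        ring
    choose a ha hau using key
    refine ⟨⟨a, fun i => (ha i).1⟩, fun i _ => (ha i).2, ?_⟩
    rintro ⟨x, hx⟩ h
    exact Subtype.ext (funext fun i => hau i _ ⟨hx i, h i (Set.mem_univ i)⟩)

namespace PlaceGauge

variable (G : PlaceGauge K m)

/-- A fundamental domain for the action of the units modulo torsion. -/
def cone : Set (Fin (m + 1) → mixedSpace K) :=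
  {z | mixedSpaceOfRealSpace (G.val z) ∈ fundamentalCone K}

/-- The product of all the gauges. -/
def norm (z : Fin (m + 1) → mixedSpace K) : ℝ := ∏ w, G.val z w ^ w.mult

theorem norm_nonneg (z : Fin (m + 1) → mixedSpace K) : 0 ≤ G.norm z :=
  Finset.prod_nonneg fun w _ => pow_nonneg (G.val_nonneg z w) _

theorem inv_smul_mem_unitDomain_iff {R : ℝ} (hR : 0 < R) (z : Fin (m + 1) → mixedSpace K) :
    R⁻¹ • z ∈ G.unitDomain ↔ z ∈ G.cone ∧ G.norm z ≤ R ^ finrank ℚ K := by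
  have hR' : 0 < R⁻¹ := by positivity
  rw [mem_unitDomain_iff, G.val_smul hR'.le, map_smul, smul_mem_iff_mem hR'.ne']
  have : ∏ w, (R⁻¹ • G.val z) w ^ w.mult = (R ^ finrank ℚ K)⁻¹ * G.norm z := by
    simp only [Pi.smul_apply, smul_eq_mul, mul_pow, Finset.prod_mul_distrib, norm]
    rw [Finset.prod_pow_eq_pow_sum, sum_mult_eq, inv_pow]
  rw [this, inv_mul_le_iff₀ (by positivity), mul_one]
  rfl

/-- The leading constant for the number of integral vectors modulo units. -/
def latticeConst : ℝ :=
  (∏ w, G.vol w) * (m + 1) ^ Units.rank K * Units.regulator K *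
    (2 ^ nrComplexPlaces K / √|(discr K : ℝ)|) ^ (m + 1)

/-- The integral vectors in a congruence class that lie in the cone and have bounded norm. -/
def congruenceSet (I : Ideal (𝓞 K)) (x₀ : Fin (m + 1) → 𝓞 K) (T : ℝ) :
    Set (Fin (m + 1) → 𝓞 K) :=
  {x | (∀ i, x i - x₀ i ∈ I) ∧ integralVector x ∈ G.cone ∧ G.norm (integralVector x) ≤ T}

/-- The product of the gauges has degree n, so the bound T on it corresponds to dilating
`unitDomain` by T^{1/n}. This is the form needed for the tiling count. -/
theorem congruenceSet_eq_image (I : Ideal (𝓞 K)) (x₀ : Fin (m + 1) → 𝓞 K) {T : ℝ} (hT : 0 < T) :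
    G.congruenceSet I x₀ T = Subtype.val '' {x : {x : Fin (m + 1) → 𝓞 K // ∀ i, x i - x₀ i ∈ I} |
      (T ^ (finrank ℚ K : ℝ)⁻¹)⁻¹ • integralVector x.1 ∈ G.unitDomain} := by
  have hn : (finrank ℚ K) ≠ 0 := finrank_pos.ne'
  have hTn : (T ^ (finrank ℚ K : ℝ)⁻¹) ^ finrank ℚ K = T := Real.rpow_inv_natCast_pow hT.le hn
  ext x
  simp only [congruenceSet, Set.mem_image, Set.mem_ofPred_eq,
    G.inv_smul_mem_unitDomain_iff (Real.rpow_pos_of_pos hT _), hTn]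
  constructor
  · rintro ⟨h1, h2⟩
    exact ⟨⟨x, h1⟩, h2, rfl⟩
  · rintro ⟨y, hy, rfl⟩
    exact ⟨y.2, hy⟩

theorem finite_congruenceSet (I : Ideal (𝓞 K)) (hI : I ≠ ⊥) (x₀ : Fin (m + 1) → 𝓞 K) (T : ℝ) :
    (G.congruenceSet I x₀ T).Finite := by
  -- The description as a dilate requires a positive bound; enlarging T only enlarges the set.
  have hmax : 0 < max T 1 := lt_max_of_lt_right one_pos
  refine Set.Finite.subset (s := G.congruenceSet I x₀ (max T 1)) ?_
    fun x hx => ⟨hx.1, hx.2.1, hx.2.2.trans (le_max_left _ _)⟩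
  obtain ⟨F, hF, hFb, hF0, -, htile⟩ := exists_fundamentalDomain_ideal_pow (m := m) I hI
  rw [G.congruenceSet_eq_image I x₀ hmax]
  exact (finite_setOf_smul_mem (μ := volume) hF hFb hF0 G.isBounded_unitDomain (htile x₀)
    (Real.rpow_pos_of_pos hmax _)).image _

/-- The limit is the volume of `unitDomain` over the covolume of I^{m+1}. The ambient dimension is
n(m+1), so the power of the dilation factor is T^{m+1}. -/
theorem tendsto_ncard_congruenceSet_div (I : Ideal (𝓞 K)) (hI : I ≠ ⊥)
    (x₀ : Fin (m + 1) → 𝓞 K) :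
    Tendsto (fun T : ℝ => ((G.congruenceSet I x₀ T).ncard : ℝ) / T ^ (m + 1)) atTop
      (𝓝 (G.latticeConst / I.absNorm ^ (m + 1))) := by
  obtain ⟨F, hF, hFb, hF0, hFvol, htile⟩ := exists_fundamentalDomain_ideal_pow (m := m) I hI
  have hn : (finrank ℚ K) ≠ 0 := finrank_pos.ne'
  have h := tendsto_ncard_smul_mem_div (μ := volume) hF hFb hF0 G.measurableSet_unitDomain
    G.isBounded_unitDomain G.volume_frontier_unitDomain (htile x₀)
  have hlim : (volume G.unitDomain).toReal / (volume F).toReal =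
      G.latticeConst / I.absNorm ^ (m + 1) := by
    have hV : 0 ≤ ∏ w, G.vol w := Finset.prod_nonneg fun w _ => G.vol_nonneg w
    have hR := (Units.regulator_pos K).le
    have hd : 0 < √|(discr K : ℝ)| := Real.sqrt_pos.2 (abs_pos.2 (by
      exact_mod_cast discr_ne_zero K))
    have hI' : (I.absNorm : ℝ) ≠ 0 := by
      exact_mod_cast Ideal.absNorm_eq_zero_iff.not.2 hI
    rw [volume_unitDomain, ENNReal.toReal_ofReal (by positivity), hFvol, latticeConst]
    rw [div_pow, mul_pow, div_pow]
    field_simp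
  rw [hlim] at h
  have hrank : finrank ℝ (Fin (m + 1) → mixedSpace K) = finrank ℚ K * (m + 1) := by
    rw [Module.finrank_pi_fintype]
    rw [Finset.sum_const, mixedEmbedding.finrank K, Finset.card_univ, Fintype.card_fin,
      smul_eq_mul, mul_comm]
  refine (h.comp (tendsto_rpow_atTop (y := (finrank ℚ K : ℝ)⁻¹) (by positivity))).congr' ?_
  filter_upwards [eventually_gt_atTop 0] with T hT
  have hTn : (T ^ (finrank ℚ K : ℝ)⁻¹) ^ finrank ℚ K = T := Real.rpow_inv_natCast_pow hT.le hn
  simp only [Function.comp_apply]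
  rw [G.congruenceSet_eq_image I x₀ hT, Set.ncard_image_of_injective _ Subtype.val_injective,
    hrank, pow_mul, hTn]

end PlaceGauge

end IntegralVectors

end

noncomputable section

/-! ### The gauges of a morphism -/

open NumberField.InfinitePlace NumberField.mixedEmbedding NumberField.mixedEmbedding.fundamentalCone

open ENNReal Module

open scoped Pointwise

theorem toReal_volume_gauge_le_pos {E : Type*} [NormedAddCommGroup E] [NormedSpace ℝ E]
    [FiniteDimensional ℝ E] [MeasurableSpace E] [BorelSpace E] {μ : Measure E} [μ.IsAddHaarMeasure]
    {g : E → ℝ} (hg : Continuous g) (h0 : g 0 = 0) {c : ℝ} (hc : 0 < c)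
    (hle : ∀ z, c * ‖z‖ ≤ g z) : 0 < (μ {z | g z ≤ 1}).toReal := by
  refine ENNReal.toReal_pos ?_ ?_
  · have hopen : IsOpen {z | g z < 1} := isOpen_lt hg continuous_const
    refine ((hopen.measure_pos μ ⟨0, by simp [h0]⟩).trans_le (measure_mono ?_)).ne'
    exact fun z (hz : g z < 1) => hz.le
  · refine ((Metric.isBounded_closedBall (x := (0 : E)) (r := c⁻¹)).subset ?_).measure_lt_top.ne
    intro z hz
    rw [mem_closedBall_zero_iff, ← one_div, le_div_iff₀' hc]
    exact (hle z).trans hz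

theorem toReal_volume_gauge_le {E : Type*} [NormedAddCommGroup E] [NormedSpace ℝ E]
    [FiniteDimensional ℝ E] [MeasurableSpace E] [BorelSpace E] {μ : Measure E} [μ.IsAddHaarMeasure]
    {g : E → ℝ} (hg : ∀ (t : ℝ) z, 0 ≤ t → g (t • z) = t * g z) {l : ℝ} (hl : 0 < l) :
    (μ {z | g z ≤ l}).toReal = l ^ finrank ℝ E * (μ {z | g z ≤ 1}).toReal := by
  have : {z | g z ≤ l} = l • {z | g z ≤ 1} := by
    ext z
    rw [Set.mem_smul_set_iff_inv_smul_mem₀ hl.ne', Set.mem_ofPred_eq, Set.mem_ofPred_eq,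
      hg _ _ (by positivity), inv_mul_le_iff₀ hl, mul_one]
  rw [this, Measure.addHaar_smul, toReal_mul, toReal_ofReal (abs_nonneg _),
    abs_of_nonneg (by positivity)]

namespace ProjMorphism

variable {K : Type*} [Field K] {m M : ℕ} (f : ProjMorphism K m M)

/-- `|F(z)| ^ {1/d}` -/
def localGauge {L : Type*} [NormedField L] (φ : K →+* L) (z : Fin (m + 1) → L) : ℝ :=
  ‖f.evalAt φ z‖ ^ (1 / (f.deg : ℝ))

theorem coeffs_ne_zero : f.coeffs ≠ 0 := by
  intro h
  refine f.eval_ne_zero (x := fun _ => 1) (fun h1 => one_ne_zero (congrFun h1 0)) ?_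
  funext j
  suffices f.lift j = 0 by simp [this]
  ext α
  rw [MvPolynomial.coeff_zero]
  by_contra hα
  have hmem : α ∈ Finset.finsuppAntidiag (Finset.univ : Finset (Fin (m + 1))) f.deg := by
    rw [Finset.mem_finsuppAntidiag]
    refine ⟨?_, Finset.subset_univ _⟩
    have := f.isHomogeneous j hα
    rw [← this, Finsupp.weight_apply, Finsupp.sum_fintype _ _ (by simp)]
    simp
  exact hα (congrFun h (j, ⟨α, hmem⟩))

theorem nonempty_index_coeffs : Nonempty (Fin (M + 1) ×
    ↥(Finset.finsuppAntidiag (Finset.univ : Finset (Fin (m + 1))) f.deg)) := by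
  by_contra h
  rw [not_nonempty_iff] at h
  exact f.coeffs_ne_zero (funext fun p => h.elim p)

section LocalGauge

variable {L : Type*} [NormedField L] (φ : K →+* L)

theorem localGauge_nonneg (z : Fin (m + 1) → L) : 0 ≤ f.localGauge φ z :=
  Real.rpow_nonneg (norm_nonneg _) _

theorem localGauge_pow (hd : f.deg ≠ 0) (z : Fin (m + 1) → L) :
    f.localGauge φ z ^ f.deg = ‖f.evalAt φ z‖ := by
  rw [localGauge, one_div, Real.rpow_inv_natCast_pow (norm_nonneg _) hd]

theorem localGauge_smul (hd : f.deg ≠ 0) (t : L) (z : Fin (m + 1) → L) :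
    f.localGauge φ (t • z) = ‖t‖ * f.localGauge φ z := by
  rw [localGauge, evalAt_smul, _root_.norm_smul, norm_pow, Real.mul_rpow (by positivity) (norm_nonneg _),
    one_div, Real.pow_rpow_inv_natCast (norm_nonneg _) hd, localGauge, one_div]

theorem continuous_localGauge : Continuous (f.localGauge φ) :=
  (f.continuous_evalAt φ).norm.rpow_const fun _ => Or.inr (by positivity)

theorem exists_le_localGauge (hd : f.deg ≠ 0) :
    ∃ c > 0, ∀ z, c * ‖z‖ ≤ f.localGauge φ z := by
  obtain ⟨c, hc, h⟩ := exists_le_norm_evalAt φ f hd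
  refine ⟨c ^ (1 / (f.deg : ℝ)), Real.rpow_pos_of_pos hc _, fun z => ?_⟩
  refine le_of_pow_le_pow_left₀ hd (f.localGauge_nonneg φ z) ?_
  rw [f.localGauge_pow φ hd, mul_pow, one_div, Real.rpow_inv_natCast_pow hc.le hd]
  exact h z

theorem localGauge_pos (hd : f.deg ≠ 0) {z : Fin (m + 1) → L} (hz : z ≠ 0) :
    0 < f.localGauge φ z := by
  obtain ⟨c, hc, h⟩ := f.exists_le_localGauge φ hd
  exact (mul_pos hc (norm_pos_iff.2 hz)).trans_le (h z)

theorem coeffNorm_pos : 0 < f.coeffNorm φ := by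
  refine norm_pos_iff.2 fun h => f.coeffs_ne_zero ?_
  funext p
  simpa using congrFun h p

theorem localDomain_eq (hd : f.deg ≠ 0) :
    f.localDomain φ = {z | f.localGauge φ z ≤ f.coeffNorm φ ^ (1 / (f.deg : ℝ))} := by
  ext z
  simp only [localDomain, localGauge, Set.mem_ofPred_eq]
  rw [Real.rpow_le_rpow_iff (norm_nonneg _) (f.coeffNorm_pos φ).le (by positivity)]

end LocalGauge

/-- The gauges `|F(z)| ^ {1/d}` at the infinite places. -/
def placeGauge (hd : f.deg ≠ 0) : PlaceGauge K m where
  re w := f.localGauge (embedding_of_isReal w.2)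
  im w := f.localGauge w.1.embedding
  continuous_re w := f.continuous_localGauge _
  continuous_im w := f.continuous_localGauge _
  re_smul w t z := by rw [f.localGauge_smul _ hd, Real.norm_eq_abs]
  im_smul w t z := f.localGauge_smul _ hd t z
  exists_le_re w := f.exists_le_localGauge _ hd
  exists_le_im w := f.exists_le_localGauge _ hd

theorem placeGauge_vol_pos (hd : f.deg ≠ 0) (w : InfinitePlace K) : 0 < (f.placeGauge hd).vol w := by
  unfold PlaceGauge.vol
  split_ifs with h
  · obtain ⟨c, hc, hle⟩ := (f.placeGauge hd).exists_le_re ⟨w, h⟩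
    refine toReal_volume_gauge_le_pos ((f.placeGauge hd).continuous_re _) ?_ hc hle
    simpa using (f.placeGauge hd).re_smul ⟨w, h⟩ 0 0
  · obtain ⟨c, hc, hle⟩ := (f.placeGauge hd).exists_le_im ⟨w, not_isReal_iff_isComplex.1 h⟩
    refine toReal_volume_gauge_le_pos ((f.placeGauge hd).continuous_im _) ?_ hc hle
    simpa using (f.placeGauge hd).im_smul ⟨w, not_isReal_iff_isComplex.1 h⟩ 0 0

theorem norm_map_eq_iSup {ι L : Type*} [Fintype ι] [Nonempty ι] [NormedField L] (φ : K →+* L)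
    (x : ι → K) : ‖fun p => φ (x p)‖ = ⨆ p, ‖φ (x p)‖ := by
  refine le_antisymm ((pi_norm_le_iff_of_nonempty _).2 fun p => ?_) (ciSup_le fun p => ?_)
  · exact le_ciSup (f := fun p => ‖φ (x p)‖) (Set.finite_range _).bddAbove p
  · exact norm_le_pi_norm (fun p => φ (x p)) p

theorem coeffNorm_eq_iSup {L : Type*} [NormedField L] (φ : K →+* L) :
    f.coeffNorm φ = ⨆ p, ‖φ (f.coeffs p)‖ := by
  have := f.nonempty_index_coeffs
  exact norm_map_eq_iSup φ f.coeffs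

/-- The local domain is the dilate of the gauge ball by |F|^{1/d} in real dimension `w.mult * (m +
1)`. The coefficient norm is split off because it will cancel against the height of f. -/
theorem archFactor_eq (hd : f.deg ≠ 0) (w : InfinitePlace K) :
    f.archFactor w = (⨆ p, w (f.coeffs p)) ^ (w.mult * ((m : ℝ) + 1) / f.deg) *
      (f.placeGauge hd).vol w := by
  have := f.nonempty_index_coeffs
  unfold archFactor PlaceGauge.vol
  split_ifs with h
  · have hc : f.coeffNorm (embedding_of_isReal h) = ⨆ p, w (f.coeffs p) := by
      simp only [coeffNorm, norm_map_eq_iSup, norm_embedding_of_isReal]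
    have hpos : 0 < ⨆ p, w (f.coeffs p) := hc ▸ f.coeffNorm_pos _
    rw [f.localDomain_eq _ hd, hc, toReal_volume_gauge_le
      (fun t z ht => by rw [f.localGauge_smul _ hd, Real.norm_of_nonneg ht])
      (Real.rpow_pos_of_pos hpos _), ← Real.rpow_mul_natCast hpos.le]
    congr 2
    simp only [finrank_fintype_fun_eq_card, Fintype.card_fin, mult, h, if_true]
    push_cast
    ring
  · have hc : f.coeffNorm w.embedding = ⨆ p, w (f.coeffs p) := by
      simp only [coeffNorm, norm_map_eq_iSup, norm_embedding_eq]
    have hpos : 0 < ⨆ p, w (f.coeffs p) := hc ▸ f.coeffNorm_pos _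
    rw [f.localDomain_eq _ hd, hc, toReal_volume_gauge_le
      (fun t z ht => by
        have := f.localGauge_smul w.embedding hd (t : ℂ) z
        rw [Complex.norm_real, Real.norm_of_nonneg ht] at this
        exact this)
      (Real.rpow_pos_of_pos hpos _), ← Real.rpow_mul_natCast hpos.le]
    congr 2
    rw [finrank_pi_fintype]
    simp only [Complex.finrank_real_complex, Finset.sum_const, Finset.card_univ, Fintype.card_fin,
      mult, h, if_false, smul_eq_mul]
    push_cast
    ring

theorem val_placeGauge_integralVector (hd : f.deg ≠ 0) (x : Fin (m + 1) → 𝓞 K)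
    (w : InfinitePlace K) :
    (f.placeGauge hd).val (integralVector x) w ^ f.deg =
      ⨆ j, w (MvPolynomial.eval (fun i => (x i : K)) (f.lift j)) := by
  by_cases h : w.IsReal
  · have h1 := (f.placeGauge hd).val_real (integralVector x) ⟨w, h⟩
    simp only at h1
    have h2 : (fun i => (integralVector x i).1 ⟨w, h⟩) =
        embedding_of_isReal h ∘ fun i => (x i : K) := by
      funext i
      exact mixedEmbedding_apply_isReal K (x i : K) ⟨w, h⟩
    rw [h1, h2]
    change f.localGauge (embedding_of_isReal h) _ ^ f.deg = _
    rw [f.localGauge_pow _ hd, evalAt_comp]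
    refine (norm_map_eq_iSup _ _).trans ?_
    simp only [norm_embedding_of_isReal]
  · have hc := not_isReal_iff_isComplex.1 h
    have h1 := (f.placeGauge hd).val_complex (integralVector x) ⟨w, hc⟩
    simp only at h1
    have h2 : (fun i => (integralVector x i).2 ⟨w, hc⟩) = w.embedding ∘ fun i => (x i : K) := by
      funext i
      exact mixedEmbedding_apply_isComplex K (x i : K) ⟨w, hc⟩
    rw [h1, h2]
    change f.localGauge w.embedding _ ^ f.deg = _
    rw [f.localGauge_pow _ hd, evalAt_comp]
    refine (norm_map_eq_iSup _ _).trans ?_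
    simp only [norm_embedding_eq]

section NumberField

variable [NumberField K]

/-- The image of an integral vector in `K_v ^ {m+1}`. -/
def _root_.localVector (v : HeightOneSpectrum (𝓞 K)) (x : Fin (m + 1) → 𝓞 K) :
    Fin (m + 1) → v.adicCompletion K :=
  FinitePlace.embedding v ∘ fun i => (x i : K)

theorem _root_.norm_localVector_le_one (v : HeightOneSpectrum (𝓞 K)) (x : Fin (m + 1) → 𝓞 K) :
    ‖localVector v x‖ ≤ 1 :=
  (pi_norm_le_iff_of_nonneg zero_le_one).2 fun i => FinitePlace.norm_le_one K v (x i)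

theorem _root_.localVector_ne_zero (v : HeightOneSpectrum (𝓞 K)) {x : Fin (m + 1) → 𝓞 K}
    (hx : x ≠ 0) : localVector v x ≠ 0 := by
  intro h
  refine hx (funext fun i => ?_)
  have : FinitePlace.embedding v (x i : K) = 0 := congrFun h i
  simpa using this

theorem _root_.finite_mulSupport_norm_localVector {x : Fin (m + 1) → 𝓞 K} (hx : x ≠ 0) :
    (fun v : HeightOneSpectrum (𝓞 K) => ‖localVector v x‖).HasFiniteMulSupport := by
  obtain ⟨i, hi⟩ := Function.ne_iff.1 hx
  have h1 := FinitePlace.hasFiniteMulSupport_int hi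
  refine (Set.Finite.preimage (f := FinitePlace.equivHeightOneSpectrum.symm)
    (Equiv.injective _).injOn h1).subset fun v hv => ?_
  contrapose! hv
  have h2 : ‖FinitePlace.embedding v (x i : K)‖ = 1 := by
    simpa [FinitePlace.equivHeightOneSpectrum_symm_apply] using hv
  simp only [Function.mem_mulSupport, not_not]
  refine le_antisymm (norm_localVector_le_one v x) (h2.symm.le.trans ?_)
  exact norm_le_pi_norm (localVector v x) i

theorem _root_.absNorm_mul_finprod_norm_localVector {x : Fin (m + 1) → 𝓞 K} (hx : x ≠ 0) :
    (Ideal.absNorm (Ideal.span (Set.range x)) : ℝ) *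
      ∏ᶠ v : HeightOneSpectrum (𝓞 K), ‖localVector v x‖ = 1 := by
  rw [← absNorm_mul_finprod_finitePlace_eq_one hx,
    ← finprod_comp_equiv (FinitePlace.equivHeightOneSpectrum (K := K)).symm]
  simp only [FinitePlace.equivHeightOneSpectrum_symm_apply]
  congr 1
  refine finprod_congr fun v => ?_
  exact norm_map_eq_iSup (FinitePlace.embedding v) fun i => (x i : K)

/-- The normalized height `H(f(P)) ^ {n/d}`. -/
def rootHeight (P : Projectivization K (Fin (m + 1) → K)) : ℝ :=
  (f.onPoints P).mulHeight ^ (1 / (f.deg : ℝ))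

theorem rootHeight_pow (hd : f.deg ≠ 0) (P : Projectivization K (Fin (m + 1) → K)) :
    f.rootHeight P ^ f.deg = (f.onPoints P).mulHeight := by
  rw [rootHeight, one_div, Real.rpow_inv_natCast_pow (Projectivization.mulHeight_pos _).le hd]

theorem one_le_rootHeight (P : Projectivization K (Fin (m + 1) → K)) : 1 ≤ f.rootHeight P :=
  Real.one_le_rpow (Projectivization.one_le_mulHeight _) (by positivity)

/-- The height as a product of local contributions. -/
theorem rootHeight_mul_absNorm (hd : f.deg ≠ 0) {S : Finset (HeightOneSpectrum (𝓞 K))}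
    (hS : ∀ v ∉ S, ∀ z, ‖f.evalAt (FinitePlace.embedding v) z‖ = ‖z‖ ^ f.deg)
    {x : Fin (m + 1) → 𝓞 K} (hx : x ≠ 0) (hx' : (fun i => (x i : K)) ≠ 0) :
    f.rootHeight (Projectivization.mk K (fun i => (x i : K)) hx') *
        Ideal.absNorm (Ideal.span (Set.range x)) =
      (f.placeGauge hd).norm (integralVector x) *
        ∏ v ∈ S, (f.localGauge (FinitePlace.embedding v) (localVector v x) / ‖localVector v x‖) := by
  have hnn : 0 ≤ (f.placeGauge hd).norm (integralVector x) *
      ∏ v ∈ S, (f.localGauge (FinitePlace.embedding v) (localVector v x) / ‖localVector v x‖) :=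
    mul_nonneg (PlaceGauge.norm_nonneg _ _) (Finset.prod_nonneg fun v _ =>
      div_nonneg (f.localGauge_nonneg _ _) (norm_nonneg _))
  -- Taking d-th powers replaces all the fractional powers by honest norms of F(x).
  refine (pow_left_inj₀ (mul_nonneg (zero_le_one.trans (f.one_le_rootHeight _))
    (Nat.cast_nonneg _)) hnn hd).1 ?_
  have hx0 (v : HeightOneSpectrum (𝓞 K)) : ‖localVector v x‖ ≠ 0 :=
    norm_ne_zero_iff.2 (localVector_ne_zero v hx)
  simp only [mul_pow]
  rw [rootHeight_pow _ hd, onPoints_mk, Projectivization.mulHeight_mk,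
    NumberField.mulHeight_eq (f.eval_ne_zero hx')]
  have harch : (f.placeGauge hd).norm (integralVector x) ^ f.deg =
      ∏ w : InfinitePlace K, (⨆ j, w (MvPolynomial.eval (fun i => (x i : K)) (f.lift j))) ^ w.mult := by
    rw [PlaceGauge.norm, ← Finset.prod_pow]
    refine Finset.prod_congr rfl fun w _ => ?_
    rw [← f.val_placeGauge_integralVector hd, ← pow_mul, ← pow_mul, mul_comm]
  have hfin : (∏ᶠ w : FinitePlace K, ⨆ j, w (MvPolynomial.eval (fun i => (x i : K)) (f.lift j))) =
      ∏ᶠ v : HeightOneSpectrum (𝓞 K), ‖f.evalAt (FinitePlace.embedding v) (localVector v x)‖ := by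
    rw [← finprod_comp_equiv (FinitePlace.equivHeightOneSpectrum (K := K)).symm]
    simp only [FinitePlace.equivHeightOneSpectrum_symm_apply]
    refine finprod_congr fun v => ?_
    rw [localVector, evalAt_comp]
    exact (norm_map_eq_iSup _ _).symm
  have hsplit : (∏ᶠ v : HeightOneSpectrum (𝓞 K),
      ‖f.evalAt (FinitePlace.embedding v) (localVector v x)‖) =
      (∏ v ∈ S, (f.localGauge (FinitePlace.embedding v) (localVector v x) / ‖localVector v x‖)) ^
        f.deg * (∏ᶠ v : HeightOneSpectrum (𝓞 K), ‖localVector v x‖) ^ f.deg := by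
    -- Outside S the quotient |F(x)|_v / |x|_v^d is 1, so the infinite product reduces to S and to
    -- the product of the |x|_v.
    have hsub : (fun v : HeightOneSpectrum (𝓞 K) =>
        ‖f.evalAt (FinitePlace.embedding v) (localVector v x)‖ / ‖localVector v x‖ ^
          f.deg).mulSupport ⊆ S := by
      intro v hv
      by_contra hvS
      exact hv (by simp only [hS v hvS]; rw [div_self (pow_ne_zero _ (hx0 v))])
    have hfs := finite_mulSupport_norm_localVector hx
    rw [finprod_pow hfs, ← Finset.prod_pow]
    simp only [div_pow, f.localGauge_pow _ hd]
    rw [← finprod_eq_prod_of_mulSupport_subset _ hsub, ← finprod_mul_distrib]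
    · refine finprod_congr fun v => ?_
      rw [div_mul_cancel₀ _ (pow_ne_zero _ (hx0 v))]
    · exact S.finite_toSet.subset hsub
    · exact hfs.subset fun v hv h => hv (by simp [h])
  have h1 : (Ideal.absNorm (Ideal.span (Set.range x)) : ℝ) ^ f.deg *
      (∏ᶠ v : HeightOneSpectrum (𝓞 K), ‖localVector v x‖) ^ f.deg = 1 := by
    rw [← mul_pow, absNorm_mul_finprod_norm_localVector hx, one_pow]
  rw [hfin, hsplit, harch]
  -- The norm of the content ideal is inverse to the product of all |x|_v.
  linear_combination (∏ w : InfinitePlace K,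
    (⨆ j, w (MvPolynomial.eval (fun i => (x i : K)) (f.lift j))) ^ w.mult) *
    (∏ v ∈ S, (f.localGauge (FinitePlace.embedding v) (localVector v x) / ‖localVector v x‖)) ^
        f.deg * h1

end NumberField

end ProjMorphism

end

noncomputable section

/-! ### Integrals over the nonarchimedean unit polydiscs -/

open ENNReal Module

namespace AdicHaar

variable {K : Type*} [Field K] [NumberField K] (v : HeightOneSpectrum (𝓞 K)) {m : ℕ}

/-- The cardinality of the residue field. -/
abbrev resCard : ℝ := (Ideal.absNorm v.asIdeal : ℝ)

theorem one_lt_resCard : 1 < resCard v := by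
  exact_mod_cast HeightOneSpectrum.one_lt_absNorm v

theorem norm_le_inv_resCard_pow_iff (x : v.adicCompletion K) (n : ℕ) :
    ‖x‖ ≤ (resCard v)⁻¹ ^ n ↔ Valued.v x ≤ WithZero.exp (-(n : ℤ)) := by
  have h := (WithZeroMulInt.toNNReal_strictMono (HeightOneSpectrum.one_lt_absNorm_nnreal v))
  rw [← h.le_iff_le, FinitePlace.norm_def, ← NNReal.coe_le_coe]
  congr! 1
  have h2 : WithZeroMulInt.toNNReal (HeightOneSpectrum.absNorm_ne_zero v)
      (WithZero.exp (-(n : ℤ))) = (Ideal.absNorm v.asIdeal : NNReal) ^ (-(n : ℤ)) := by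
    rw [WithZeroMulInt.toNNReal_neg_apply _ WithZero.exp_ne_zero]
    rfl
  rw [h2]
  simp [resCard]

theorem norm_lt_one_iff (x : v.adicCompletion K) : ‖x‖ < 1 ↔ ‖x‖ ≤ (resCard v)⁻¹ := by
  refine ⟨fun h => ?_, fun h => h.trans_lt (inv_lt_one_of_one_lt₀ (one_lt_resCard v))⟩
  have h1 := norm_le_inv_resCard_pow_iff v x 1
  rw [pow_one] at h1
  rw [h1]
  have h2 : Valued.v x < (1 : WithZero (Multiplicative ℤ)) := by
    rw [← WithZeroMulInt.toNNReal_lt_one_iff (HeightOneSpectrum.one_lt_absNorm_nnreal v),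
      ← NNReal.coe_lt_coe]
    rw [FinitePlace.norm_def] at h
    exact h
  rw [← WithZero.lt_mul_exp_iff_le WithZero.exp_ne_zero, ← WithZero.exp_add]
  simpa using h2

theorem norm_embedding_integer_le_iff (a : 𝓞 K) (n : ℕ) :
    ‖FinitePlace.embedding v (a : K)‖ ≤ (resCard v)⁻¹ ^ n ↔ a ∈ v.asIdeal ^ n := by
  rw [norm_le_inv_resCard_pow_iff, ← v.intValuation_le_pow_iff_mem, FinitePlace.embedding_apply,
    HeightOneSpectrum.valuedAdicCompletion_eq_valuation', HeightOneSpectrum.valuation_of_algebraMap]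

theorem norm_localVector_sub_le_iff (x y : Fin (m + 1) → 𝓞 K) (n : ℕ) :
    ‖localVector v x - localVector v y‖ ≤ (resCard v)⁻¹ ^ n ↔ ∀ i, x i - y i ∈ v.asIdeal ^ n := by
  rw [pi_norm_le_iff_of_nonneg (by positivity)]
  refine forall_congr' fun i => ?_
  rw [← norm_embedding_integer_le_iff]
  simp [localVector]

theorem exists_integer_norm_sub_le (x : v.adicCompletion K) (hx : ‖x‖ ≤ 1) (n : ℕ) :
    ∃ a : 𝓞 K, ‖x - FinitePlace.embedding v (a : K)‖ ≤ (resCard v)⁻¹ ^ n := by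
  have hq : 0 < (resCard v)⁻¹ ^ n := pow_pos (inv_pos.2 (zero_lt_one.trans (one_lt_resCard v))) _
  have hq1 : (resCard v)⁻¹ ^ n ≤ 1 :=
    pow_le_one₀ (by positivity) (inv_le_one_of_one_le₀ (one_lt_resCard v).le)
  obtain ⟨k, hk⟩ := (HeightOneSpectrum.denseRange_algebraMap K v).exists_dist_lt x hq
  have hk' : ‖x - FinitePlace.embedding v k‖ < (resCard v)⁻¹ ^ n := by
    rw [← dist_eq_norm]; exact hk
  have hk1 : ‖FinitePlace.embedding v k‖ ≤ 1 := by
    have : FinitePlace.embedding v k = x + (FinitePlace.embedding v k - x) := by ring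
    rw [this]
    rw [norm_sub_rev] at hk'
    exact (IsUltrametricDist.norm_add_le_max _ _).trans (max_le hx (hk'.le.trans hq1))
  have hk2 : v.valuation K k ≤ 1 := by
    have := (norm_le_inv_resCard_pow_iff v (FinitePlace.embedding v k) 0).1 (by simpa using hk1)
    rw [FinitePlace.embedding_apply, HeightOneSpectrum.valuedAdicCompletion_eq_valuation'] at this
    simpa using this
  obtain ⟨a, ha⟩ := v.exists_valuation_sub_lt_of_integer hk2
    (Units.mk0 (WithZero.exp (-(n : ℤ))) (by simp))
  refine ⟨a, ?_⟩
  have h3 : x - FinitePlace.embedding v (a : K) = (x - FinitePlace.embedding v k) +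
      -FinitePlace.embedding v ((a : K) - k) := by
    rw [map_sub]; ring
  rw [h3]
  refine (IsUltrametricDist.norm_add_le_max _ _).trans (max_le hk'.le ?_)
  rw [norm_neg]
  rw [norm_le_inv_resCard_pow_iff, FinitePlace.embedding_apply,
    HeightOneSpectrum.valuedAdicCompletion_eq_valuation']
  exact ha.le

theorem exists_localVector_norm_sub_le (z : Fin (m + 1) → v.adicCompletion K) (hz : ‖z‖ ≤ 1)
    (n : ℕ) : ∃ x : Fin (m + 1) → 𝓞 K, ‖z - localVector v x‖ ≤ (resCard v)⁻¹ ^ n := by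
  choose x hx using fun i => exists_integer_norm_sub_le v (z i) ((norm_le_pi_norm z i).trans hz) n
  have : 0 ≤ (resCard v)⁻¹ ^ n := by positivity
  exact ⟨x, (pi_norm_le_iff_of_nonneg this).2 hx⟩

instance isAddHaarMeasure_polydiscHaar : (polydiscHaar K v m).IsAddHaarMeasure :=
  inferInstanceAs (Measure.addHaarMeasure (unitPolydisc K v m)).IsAddHaarMeasure

theorem polydiscHaar_closedBall : polydiscHaar K v m (Metric.closedBall 0 1) = 1 :=
  Measure.addHaarMeasure_self

theorem mem_unitPolydisc {z : Fin (m + 1) → v.adicCompletion K} :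
    z ∈ (unitPolydisc K v m : Set (Fin (m + 1) → v.adicCompletion K)) ↔ ‖z‖ ≤ 1 :=
  mem_closedBall_zero_iff

instance finite_quotient_pow (n : ℕ) : Finite (𝓞 K ⧸ v.asIdeal ^ n) :=
  (v.asIdeal ^ n).finiteQuotientOfFreeOfNeBot (pow_ne_zero _ v.ne_bot)

instance fintype_quotient_pow (n : ℕ) : Fintype (𝓞 K ⧸ v.asIdeal ^ n) := Fintype.ofFinite _

/-- The residue class of radius `q ^ {-n}` given by a residue vector. -/
def residueBall (n : ℕ) (ρ : Fin (m + 1) → 𝓞 K ⧸ v.asIdeal ^ n) :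
    Set (Fin (m + 1) → v.adicCompletion K) :=
  Metric.closedBall (localVector v fun i => (ρ i).out) ((resCard v)⁻¹ ^ n)

theorem mem_residueBall_iff {n : ℕ} {ρ : Fin (m + 1) → 𝓞 K ⧸ v.asIdeal ^ n}
    {z : Fin (m + 1) → v.adicCompletion K} :
    z ∈ residueBall v n ρ ↔ ‖z - localVector v fun i => (ρ i).out‖ ≤ (resCard v)⁻¹ ^ n := by
  rw [residueBall, mem_closedBall_iff_norm]

theorem inv_resCard_pow_le_one (n : ℕ) : (resCard v)⁻¹ ^ n ≤ 1 :=
  pow_le_one₀ (by positivity) (inv_le_one_of_one_le₀ (one_lt_resCard v).le)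

theorem inv_resCard_pow_pos (n : ℕ) : 0 < (resCard v)⁻¹ ^ n :=
  pow_pos (inv_pos.2 (zero_lt_one.trans (one_lt_resCard v))) _

theorem iUnion_residueBall (n : ℕ) :
    ⋃ ρ, residueBall v n ρ = (unitPolydisc K v m : Set (Fin (m + 1) → v.adicCompletion K)) := by
  ext z
  rw [Set.mem_iUnion, mem_unitPolydisc]
  constructor
  · rintro ⟨ρ, hρ⟩
    rw [mem_residueBall_iff] at hρ
    rw [← sub_add_cancel z (localVector v fun i => (ρ i).out)]
    exact (IsUltrametricDist.norm_add_le_max _ _).trans (max_le (hρ.trans (inv_resCard_pow_le_one v n))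
      (norm_localVector_le_one _ _))
  · intro hz
    obtain ⟨x, hx⟩ := exists_localVector_norm_sub_le v z hz n
    refine ⟨fun i => Ideal.Quotient.mk _ (x i), ?_⟩
    rw [mem_residueBall_iff, ← sub_add_sub_cancel z (localVector v x)]
    refine (IsUltrametricDist.norm_add_le_max _ _).trans (max_le hx ?_)
    rw [norm_localVector_sub_le_iff]
    intro i
    rw [← Ideal.Quotient.mk_eq_mk_iff_sub_mem]
    exact (Ideal.Quotient.mk_out _).symm

theorem pairwise_disjoint_residueBall (n : ℕ) :
    Pairwise (Function.onFun Disjoint (residueBall (m := m) v n)) := by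
  intro ρ σ hρσ
  refine Set.disjoint_left.2 fun z hz hz' => hρσ ?_
  rw [mem_residueBall_iff] at hz hz'
  have h : ‖(localVector v fun i => (ρ i).out) - localVector v fun i => (σ i).out‖ ≤
      (resCard v)⁻¹ ^ n := by
    rw [← sub_add_sub_cancel _ z]
    refine (IsUltrametricDist.norm_add_le_max _ _).trans (max_le ?_ hz')
    rwa [norm_sub_rev]
  rw [norm_localVector_sub_le_iff] at h
  funext i
  rw [← Ideal.Quotient.mk_out (ρ i), ← Ideal.Quotient.mk_out (σ i)]
  exact Ideal.Quotient.eq.2 (h i)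

theorem measurableSet_residueBall (n : ℕ) (ρ : Fin (m + 1) → 𝓞 K ⧸ v.asIdeal ^ n) :
    MeasurableSet (residueBall v n ρ) := measurableSet_closedBall

theorem polydiscHaar_residueBall (n : ℕ) (ρ : Fin (m + 1) → 𝓞 K ⧸ v.asIdeal ^ n) :
    polydiscHaar K v m (residueBall v n ρ) =
      polydiscHaar K v m (Metric.closedBall 0 ((resCard v)⁻¹ ^ n)) := by
  rw [residueBall, ← measure_preimage_add _ (localVector v fun i => (ρ i).out)
    (Metric.closedBall (localVector v fun i => (ρ i).out) _)]
  congr 1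
  ext z
  simp

/-- The unit polydisc has measure 1 and is the disjoint union of q^{n(m+1)} translates of this ball,
where q is the residue cardinality. -/
theorem measureReal_closedBall (n : ℕ) :
    (polydiscHaar K v m).real (Metric.closedBall 0 ((resCard v)⁻¹ ^ n)) =
      ((resCard v)⁻¹ ^ n) ^ (m + 1) := by
  have h := measure_iUnion (μ := polydiscHaar K v m) (pairwise_disjoint_residueBall (m := m) v n)
    (measurableSet_residueBall v n)
  rw [iUnion_residueBall] at h
  simp only [polydiscHaar_residueBall, tsum_fintype, Finset.sum_const, Finset.card_univ] at h
  have h1 := (polydiscHaar_closedBall (m := m) v).symm.trans h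
  have h2 := congrArg ENNReal.toReal h1
  rw [ENNReal.toReal_one, nsmul_eq_mul, ENNReal.toReal_mul, ENNReal.toReal_natCast] at h2
  have hcard : (Fintype.card (Fin (m + 1) → 𝓞 K ⧸ v.asIdeal ^ n) : ℝ) =
      ((resCard v) ^ n) ^ (m + 1) := by
    rw [Fintype.card_fun, Fintype.card_fin, ← Nat.card_eq_fintype_card, ← Submodule.cardQuot_apply,
      ← Ideal.absNorm_apply, map_pow]
    push_cast
    rfl
  rw [hcard] at h2
  have h3 : (((resCard v)⁻¹ ^ n) ^ (m + 1)) = ((resCard v ^ n) ^ (m + 1))⁻¹ := by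
    rw [inv_pow, inv_pow]
  rw [measureReal_def, h3]
  exact eq_inv_of_mul_eq_one_right h2.symm

theorem measureReal_residueBall (n : ℕ) (ρ : Fin (m + 1) → 𝓞 K ⧸ v.asIdeal ^ n) :
    (polydiscHaar K v m).real (residueBall v n ρ) = ((resCard v)⁻¹ ^ n) ^ (m + 1) := by
  rw [← measureReal_closedBall, measureReal_def, polydiscHaar_residueBall, measureReal_def]

theorem norm_le_one_of_mem_residueBall {n : ℕ} {ρ : Fin (m + 1) → 𝓞 K ⧸ v.asIdeal ^ n}
    {z : Fin (m + 1) → v.adicCompletion K} (hz : z ∈ residueBall v n ρ) : ‖z‖ ≤ 1 := by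
  rw [← mem_unitPolydisc, ← iUnion_residueBall v n]
  exact Set.mem_iUnion_of_mem ρ hz

/-- The integral of a function that only depends on residues modulo a power of `v`. -/
theorem setIntegral_eq_sum_residues (n : ℕ) {g : (Fin (m + 1) → v.adicCompletion K) → ℝ}
    (hg : ∀ z z', ‖z‖ ≤ 1 → ‖z'‖ ≤ 1 → ‖z - z'‖ ≤ (resCard v)⁻¹ ^ n → g z = g z') :
    ∫ z in (unitPolydisc K v m : Set (Fin (m + 1) → v.adicCompletion K)), g z
        ∂(polydiscHaar K v m) =
      ((resCard v)⁻¹ ^ n) ^ (m + 1) *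
        ∑ ρ : Fin (m + 1) → 𝓞 K ⧸ v.asIdeal ^ n, g (localVector v fun i => (ρ i).out) := by
  have hconst (ρ : Fin (m + 1) → 𝓞 K ⧸ v.asIdeal ^ n) : Set.EqOn g
      (fun _ => g (localVector v fun i => (ρ i).out)) (residueBall v n ρ) := fun z hz =>
    hg _ _ (norm_le_one_of_mem_residueBall v hz) (norm_localVector_le_one v _)
      ((mem_residueBall_iff v).1 hz)
  have hfin (ρ : Fin (m + 1) → 𝓞 K ⧸ v.asIdeal ^ n) :
      polydiscHaar K v m (residueBall v n ρ) ≠ ⊤ :=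
    (isCompact_closedBall _ _).measure_lt_top.ne
  rw [← iUnion_residueBall v n, integral_iUnion_fintype (measurableSet_residueBall v n)
    (pairwise_disjoint_residueBall v n), Finset.mul_sum]
  · refine Finset.sum_congr rfl fun ρ _ => ?_
    rw [setIntegral_congr_fun (measurableSet_residueBall v n ρ) (hconst ρ), setIntegral_const,
      measureReal_residueBall, smul_eq_mul]
  · intro ρ
    exact (integrableOn_const (hfin ρ)).congr_fun (hconst ρ).symm (measurableSet_residueBall v n ρ)

theorem exists_uniformizer : ∃ ϖ : v.adicCompletion K, ‖ϖ‖ = (resCard v)⁻¹ := by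
  obtain ⟨a, ha⟩ := v.intValuation_exists_uniformizer
  refine ⟨FinitePlace.embedding v (a : K), ?_⟩
  rw [FinitePlace.norm_embedding_int K v a, ha, WithZeroMulInt.toNNReal_neg_apply _
    WithZero.exp_ne_zero]
  change (((Ideal.absNorm v.asIdeal : NNReal) ^ (-1 : ℤ) : NNReal) : ℝ) = _
  simp [resCard]

theorem setOf_norm_lt_one_eq_closedBall :
    {z : Fin (m + 1) → v.adicCompletion K | ‖z‖ < 1} =
      Metric.closedBall 0 ((resCard v)⁻¹ ^ 1) := by
  ext z
  rw [mem_closedBall_zero_iff, pow_one, Set.mem_ofPred_eq, pi_norm_lt_iff zero_lt_one,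
    pi_norm_le_iff_of_nonneg (by positivity)]
  exact forall_congr' fun i => norm_lt_one_iff v (z i)

/-- A scale invariant function. -/
theorem setIntegral_norm_lt_one_eq {g : (Fin (m + 1) → v.adicCompletion K) → ℝ}
    (hg : ∀ (t : v.adicCompletion K) z, t ≠ 0 → g (t • z) = g z) :
    ∫ z in {z | ‖z‖ < 1}, g z ∂(polydiscHaar K v m) =
      (resCard v)⁻¹ ^ (m + 1) *
        ∫ z in (unitPolydisc K v m : Set (Fin (m + 1) → v.adicCompletion K)), g z
        ∂(polydiscHaar K v m) := by
  set μ := polydiscHaar K v m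
  obtain ⟨ϖ, hϖ⟩ := exists_uniformizer v
  have hq : 0 < (resCard v)⁻¹ := by simpa using inv_resCard_pow_pos v 1
  have hϖ0 : ϖ ≠ 0 := norm_pos_iff.1 (hϖ ▸ hq)
  -- Multiplication by a uniformizer maps the unit polydisc onto the open unit ball. It scales Haar
  -- measure by a constant, which is then found from the volumes of these two sets.
  let e : (Fin (m + 1) → v.adicCompletion K) ≃L[v.adicCompletion K]
      (Fin (m + 1) → v.adicCompletion K) := ContinuousLinearEquiv.smulLeft (Units.mk0 ϖ hϖ0)
  have he (z) : e z = ϖ • z := rfl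
  have hHaar : (μ.map e).IsAddHaarMeasure := e.isAddHaarMeasure_map μ
  have hsmul := Measure.isAddLeftInvariant_eq_smul (μ.map e) μ
  set k := (μ.map e).addHaarScalarFactor μ
  have hemb : MeasurableEmbedding e := e.toHomeomorph.measurableEmbedding
  have hpre : e ⁻¹' {z | ‖z‖ < 1} =
      (unitPolydisc K v m : Set (Fin (m + 1) → v.adicCompletion K)) := by
    ext z
    rw [setOf_norm_lt_one_eq_closedBall, Set.mem_preimage, mem_closedBall_zero_iff,
      mem_unitPolydisc, he, norm_smul, pow_one, hϖ, mul_le_iff_le_one_right hq]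
  have h_int : ∫ z in {z | ‖z‖ < 1}, g z ∂(μ.map e) =
      ∫ z in (unitPolydisc K v m : Set (Fin (m + 1) → v.adicCompletion K)), g z ∂μ := by
    rw [hemb.setIntegral_map, hpre]
    simp only [he, hg ϖ _ hϖ0]
  have hk : (k : ℝ) * (resCard v)⁻¹ ^ (m + 1) = 1 := by
    have h1 : (μ.map e).real {z | ‖z‖ < 1} = 1 := by
      rw [measureReal_def, hemb.map_apply, hpre]
      have := polydiscHaar_closedBall (m := m) v
      rw [show μ (unitPolydisc K v m : Set (Fin (m + 1) → v.adicCompletion K)) = 1 from this]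
      rfl
    rw [hsmul, measureReal_nnreal_smul_apply, setOf_norm_lt_one_eq_closedBall,
      measureReal_closedBall, pow_one] at h1
    exact h1
  rw [← h_int, hsmul, Measure.restrict_smul, integral_smul_nnreal_measure, NNReal.smul_def,
    smul_eq_mul, ← mul_assoc, mul_comm _ (k : ℝ), hk, one_mul]

end AdicHaar

end

noncomputable section

/-! ### The local densities of a morphism -/

open AdicHaar

theorem AdicHaar.polydiscHaar_singleton_zero {K : Type*} [Field K] [NumberField K] {m : ℕ}
    (v : HeightOneSpectrum (𝓞 K)) :
    polydiscHaar K v m {z | z = 0} = 0 := by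
  have hlt : (resCard v)⁻¹ ^ (m + 1) < 1 := pow_lt_one₀ (by positivity)
    (inv_lt_one_of_one_lt₀ (one_lt_resCard v)) (Nat.succ_ne_zero m)
  have hfin : polydiscHaar K v m {z | z = 0} ≠ ⊤ := by
    rw [Set.ofPred_eq_eq_singleton]
    exact isCompact_singleton.measure_lt_top.ne
  rw [← measureReal_eq_zero_iff hfin]
  refine le_antisymm (ge_of_tendsto' (tendsto_pow_atTop_nhds_zero_of_lt_one
    (by positivity) hlt) fun n => ?_) measureReal_nonneg
  rw [← pow_mul, mul_comm, pow_mul, ← measureReal_closedBall (m := m) v n]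
  refine measureReal_mono ?_ (isCompact_closedBall _ _).measure_lt_top.ne
  rintro z rfl
  rw [mem_closedBall_zero_iff, norm_zero]
  positivity

namespace ProjMorphism

variable {K : Type*} [Field K] [NumberField K] {m M : ℕ} (f : ProjMorphism K m M)
  (v : HeightOneSpectrum (𝓞 K))

/-- The integrand `(|z| / |F(z)| ^ {1/d}) ^ {m+1}`. -/
def localRatio (z : Fin (m + 1) → v.adicCompletion K) : ℝ :=
  (‖z‖ / f.localGauge (FinitePlace.embedding v) z) ^ (m + 1)

/-- The integral of `(|z| / |F(z)| ^ {1/d}) ^ {m+1}` over the unit polydisc. -/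
def localDensity : ℝ :=
  ∫ z in (unitPolydisc K v m : Set (Fin (m + 1) → v.adicCompletion K)), f.localRatio v z
    ∂(polydiscHaar K v m)

open Classical in
/-- The function `|F(z)| ^ {-1/d}` on the primitive vectors. -/
def primWeight (z : Fin (m + 1) → v.adicCompletion K) : ℝ :=
  if ‖z‖ = 1 then (f.localGauge (FinitePlace.embedding v) z)⁻¹ else 0

theorem primWeight_nonneg (z : Fin (m + 1) → v.adicCompletion K) : 0 ≤ f.primWeight v z := by
  unfold primWeight
  split_ifs
  exacts [inv_nonneg.2 (f.localGauge_nonneg _ _), le_rfl]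

theorem primWeight_pos_iff (hd : f.deg ≠ 0) {z : Fin (m + 1) → v.adicCompletion K} :
    0 < f.primWeight v z ↔ ‖z‖ = 1 := by
  unfold primWeight
  split_ifs with h
  · simp only [h, iff_true]
    exact inv_pos.2 (f.localGauge_pos _ hd (norm_ne_zero_iff.1 (h ▸ one_ne_zero)))
  · simp [h]

theorem finiteFactor_eq :
    f.finiteFactor v = f.coeffNorm (FinitePlace.embedding v) ^ (((m : ℝ) + 1) / f.deg) *
      f.localDensity v := by
  unfold finiteFactor localDensity
  rw [← integral_const_mul]
  refine integral_congr_ae (Eventually.of_forall fun z => ?_)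
  have h := (f.coeffNorm_pos (FinitePlace.embedding v)).le
  have h2 : f.coeffNorm (FinitePlace.embedding v) ^ (((m : ℝ) + 1) / f.deg) =
      (f.coeffNorm (FinitePlace.embedding v) ^ (1 / (f.deg : ℝ))) ^ (m + 1) := by
    rw [← Real.rpow_mul_natCast h]
    congr 1
    push_cast
    ring
  simp only [localRatio, h2, ← mul_pow, localGauge]
  congr 1
  ring

theorem localDensity_eq_one (hd : f.deg ≠ 0)
    (hv : ∀ z, ‖f.evalAt (FinitePlace.embedding v) z‖ = ‖z‖ ^ f.deg) : f.localDensity v = 1 := by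
  unfold localDensity
  have hne : ∀ᵐ z ∂((polydiscHaar K v m).restrict
      (unitPolydisc K v m : Set (Fin (m + 1) → v.adicCompletion K))), f.localRatio v z = 1 := by
    have : ∀ᵐ z ∂((polydiscHaar K v m).restrict
      (unitPolydisc K v m : Set (Fin (m + 1) → v.adicCompletion K))), z ≠ 0 := by
      refine ae_restrict_of_ae ?_
      rw [ae_iff]
      simp only [ne_eq, not_not]
      exact polydiscHaar_singleton_zero v
    filter_upwards [this] with z hz
    have h1 : f.localGauge (FinitePlace.embedding v) z = ‖z‖ := by
      rw [localGauge, hv, one_div, Real.pow_rpow_inv_natCast (norm_nonneg _) hd]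
    rw [localRatio, h1, div_self (norm_ne_zero_iff.2 hz), one_pow]
  rw [integral_congr_ae hne]
  have := polydiscHaar_closedBall (m := m) v
  simp [measureReal_def, show (polydiscHaar K v m)
    (unitPolydisc K v m : Set (Fin (m + 1) → v.adicCompletion K)) = 1 from this]

/-- On primitive vectors |F| is at least c. If two values of F differ by less than c, the
ultrametric inequality forces equal norms; uniform continuity on the compact polydisc provides the
radius. -/
theorem exists_primWeight_eq_of_norm_sub_le (hd : f.deg ≠ 0) :
    ∃ n : ℕ, ∀ z z' : Fin (m + 1) → v.adicCompletion K, ‖z‖ ≤ 1 → ‖z'‖ ≤ 1 →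
      ‖z - z'‖ ≤ (resCard v)⁻¹ ^ n → f.primWeight v z = f.primWeight v z' := by
  obtain ⟨c, hc, hle⟩ := exists_le_norm_evalAt (FinitePlace.embedding v) f hd
  have hu := (isCompact_closedBall (0 : Fin (m + 1) → v.adicCompletion K) 1).uniformContinuousOn_of_continuous
    (f.continuous_evalAt (FinitePlace.embedding v)).continuousOn
  rw [Metric.uniformContinuousOn_iff] at hu
  obtain ⟨η, hη, h⟩ := hu c hc
  -- The bound η controls F, and the bound 1 ensures that a vector close to a primitive one is
  -- primitive.
  obtain ⟨n, hn⟩ := exists_pow_lt_of_lt_one (lt_min hη one_pos)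
    (inv_lt_one_of_one_lt₀ (one_lt_resCard v))
  have key (z z' : Fin (m + 1) → v.adicCompletion K) (hz : ‖z‖ ≤ 1) (hz' : ‖z'‖ ≤ 1)
      (hzz : ‖z - z'‖ ≤ (resCard v)⁻¹ ^ n) (h1 : ‖z‖ = 1) : ‖z'‖ = 1 ∧
      ‖f.evalAt (FinitePlace.embedding v) z'‖ = ‖f.evalAt (FinitePlace.embedding v) z‖ := by
    have hlt := hzz.trans_lt hn
    have hn1 : ‖z'‖ = 1 := by
      refine le_antisymm hz' ?_
      by_contra! hlt'
      have : z = (z - z') + z' := by abel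
      have h2 := IsUltrametricDist.norm_add_le_max (z - z') z'
      rw [← this, h1] at h2
      exact absurd h2 (not_le.2 (max_lt (hlt.trans_le (min_le_right _ _)) hlt'))
    refine ⟨hn1, ?_⟩
    have h3 := h z (by simpa using hz) z' (by simpa using hz')
      (by rw [dist_eq_norm]; exact hlt.trans_le (min_le_left _ _))
    rw [dist_eq_norm] at h3
    have h4 := hle z
    have h4' := hle z'
    rw [h1, one_pow, mul_one] at h4
    rw [hn1, one_pow, mul_one] at h4'
    have h5 := IsUltrametricDist.norm_add_le_max
      (f.evalAt (FinitePlace.embedding v) z - f.evalAt (FinitePlace.embedding v) z')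
      (f.evalAt (FinitePlace.embedding v) z')
    have h6 := IsUltrametricDist.norm_add_le_max
      (f.evalAt (FinitePlace.embedding v) z' - f.evalAt (FinitePlace.embedding v) z)
      (f.evalAt (FinitePlace.embedding v) z)
    rw [sub_add_cancel] at h5 h6
    rw [norm_sub_rev] at h6
    rw [max_eq_right (h3.le.trans h4')] at h5
    rw [max_eq_right (h3.le.trans h4)] at h6
    exact le_antisymm h6 h5
  refine ⟨n, fun z z' hz hz' hzz => ?_⟩
  unfold primWeight
  by_cases h1 : ‖z‖ = 1
  · obtain ⟨h2, h3⟩ := key z z' hz hz' hzz h1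
    rw [if_pos h1, if_pos h2, localGauge, localGauge, h3]
  · by_cases h2 : ‖z'‖ = 1
    · exact absurd (key z' z hz' hz (norm_sub_rev z z' ▸ hzz) h2).1 h1
    · rw [if_neg h1, if_neg h2]

theorem integrableOn_localRatio (hd : f.deg ≠ 0) :
    IntegrableOn (f.localRatio v) (unitPolydisc K v m : Set (Fin (m + 1) → v.adicCompletion K))
      (polydiscHaar K v m) := by
  obtain ⟨c, hc, hle⟩ := f.exists_le_localGauge (FinitePlace.embedding v) hd
  refine Measure.integrableOn_of_bounded (M := (c⁻¹) ^ (m + 1))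
    ((unitPolydisc K v m).isCompact.measure_lt_top.ne) ?_ ?_
  · have h := (f.continuous_localGauge (FinitePlace.embedding v)).measurable
    unfold localRatio
    exact ((measurable_norm.div h).pow_const _).aestronglyMeasurable
  · refine Eventually.of_forall fun z => ?_
    have h0 : 0 ≤ ‖z‖ / f.localGauge (FinitePlace.embedding v) z :=
      div_nonneg (norm_nonneg _) (f.localGauge_nonneg _ _)
    rw [localRatio, norm_pow, Real.norm_of_nonneg h0]
    gcongr
    refine div_le_of_le_mul₀ (f.localGauge_nonneg _ _) (by positivity) ?_
    rw [← div_eq_inv_mul, le_div_iff₀' hc]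
    exact hle z

/-- The ratio |z|/|F(z)|^{1/d} is invariant under scaling, so the open unit ball carries the
fraction q^{-(m+1)} of the integral over the polydisc. The rest lives on primitive vectors. The
resulting Euler factor is what later removes the zeta value. -/
theorem integral_primWeight_pow (hd : f.deg ≠ 0) :
    ∫ z in (unitPolydisc K v m : Set (Fin (m + 1) → v.adicCompletion K)), f.primWeight v z ^ (m + 1)
      ∂(polydiscHaar K v m) = (1 - (resCard v)⁻¹ ^ (m + 1)) * f.localDensity v := by
  have hinv (t : v.adicCompletion K) (z : Fin (m + 1) → v.adicCompletion K) (ht : t ≠ 0) :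
      f.localRatio v (t • z) = f.localRatio v z := by
    rw [localRatio, norm_smul, f.localGauge_smul _ hd, mul_div_mul_left _ _ (norm_ne_zero_iff.2 ht),
      localRatio]
  have hscale := setIntegral_norm_lt_one_eq v hinv
  have hmeas1 : MeasurableSet {z : Fin (m + 1) → v.adicCompletion K | ‖z‖ = 1} :=
    measurableSet_eq_fun measurable_norm measurable_const
  have hmeas2 : MeasurableSet {z : Fin (m + 1) → v.adicCompletion K | ‖z‖ < 1} :=
    measurableSet_lt measurable_norm measurable_const
  have hunion : (unitPolydisc K v m : Set (Fin (m + 1) → v.adicCompletion K)) =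
      {z | ‖z‖ = 1} ∪ {z | ‖z‖ < 1} := by
    ext z
    rw [mem_unitPolydisc, le_iff_eq_or_lt]
    rfl
  have hdisj : Disjoint {z : Fin (m + 1) → v.adicCompletion K | ‖z‖ = 1} {z | ‖z‖ < 1} :=
    Set.disjoint_left.2 fun z (h1 : ‖z‖ = 1) (h2 : ‖z‖ < 1) => h2.ne h1
  have hi := f.integrableOn_localRatio v hd
  have h1 : ∫ z in (unitPolydisc K v m : Set (Fin (m + 1) → v.adicCompletion K)),
      f.primWeight v z ^ (m + 1) ∂(polydiscHaar K v m) =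
      ∫ z in {z | ‖z‖ = 1}, f.localRatio v z ∂(polydiscHaar K v m) := by
    have : (fun z => f.primWeight v z ^ (m + 1)) =
        Set.indicator {z | ‖z‖ = 1} (f.localRatio v) := by
      funext z
      by_cases h : ‖z‖ = 1
      · rw [Set.indicator_of_mem (by exact h), primWeight, if_pos h, localRatio, h, one_div]
      · rw [Set.indicator_of_notMem (by exact h), primWeight, if_neg h, zero_pow (Nat.succ_ne_zero m)]
    rw [this, setIntegral_indicator hmeas1]
    congr 2
    rw [hunion, Set.inter_eq_right]
    exact Set.subset_union_left
  have h2 : f.localDensity v = ∫ z in {z | ‖z‖ = 1}, f.localRatio v z ∂(polydiscHaar K v m) +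
      ∫ z in {z | ‖z‖ < 1}, f.localRatio v z ∂(polydiscHaar K v m) := by
    rw [localDensity, hunion]
    rw [hunion] at hi
    exact setIntegral_union hdisj hmeas2 (hi.mono_set Set.subset_union_left)
      (hi.mono_set Set.subset_union_right)
  rw [hscale] at h2
  rw [h1]
  unfold localDensity at h2 ⊢
  linear_combination -h2

theorem one_sub_inv_resCard_pow_pos (m : ℕ) : 0 < 1 - (resCard v)⁻¹ ^ (m + 1) :=
  sub_pos.2 (pow_lt_one₀ (by positivity) (inv_lt_one_of_one_lt₀ (one_lt_resCard v))
    (Nat.succ_ne_zero m))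

theorem localDensity_pos (hd : f.deg ≠ 0) : 0 < f.localDensity v := by
  obtain ⟨n, hn⟩ := f.exists_primWeight_eq_of_norm_sub_le v hd
  have h := f.integral_primWeight_pow v hd
  rw [setIntegral_eq_sum_residues v n
    (fun z z' hz hz' hzz => by rw [hn z z' hz hz' hzz])] at h
  refine pos_of_mul_pos_right (h ▸ ?_) (one_sub_inv_resCard_pow_pos v m).le
  refine mul_pos (pow_pos (inv_resCard_pow_pos v n) _) ?_
  -- The residue class of (1, …, 1) is primitive and contributes a positive term.
  refine Finset.sum_pos' (fun ρ _ => pow_nonneg (f.primWeight_nonneg v _) _)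
    ⟨fun _ => Ideal.Quotient.mk _ 1, Finset.mem_univ _, pow_pos ?_ _⟩
  rw [hn _ (localVector v 1) (norm_localVector_le_one v _) (norm_localVector_le_one v _),
    f.primWeight_pos_iff v hd]
  · refine le_antisymm (norm_localVector_le_one v _) ?_
    refine le_trans (by simp [localVector]) (norm_le_pi_norm (localVector v 1) 0)
  · rw [norm_localVector_sub_le_iff]
    intro i
    rw [← Ideal.Quotient.mk_eq_mk_iff_sub_mem]
    exact Ideal.Quotient.mk_out _

theorem finite_mulSupport_coeffNorm : (fun v : HeightOneSpectrum (𝓞 K) =>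
    f.coeffNorm (FinitePlace.embedding v)).HasFiniteMulSupport := by
  have hne := f.nonempty_index_coeffs
  obtain ⟨p, hp⟩ := Function.ne_iff.1 f.coeffs_ne_zero
  have h1 := (Set.Finite.preimage (f := FinitePlace.equivHeightOneSpectrum.symm)
    (Equiv.injective _).injOn (FinitePlace.hasFiniteMulSupport hp))
  have h2 (p) : {v : HeightOneSpectrum (𝓞 K) |
      1 < ‖FinitePlace.embedding v (f.coeffs p)‖}.Finite := finite_one_lt_norm_embedding _
  refine (h1.union (Set.finite_iUnion h2)).subset fun v hv => ?_
  by_contra hcon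
  simp only [Set.mem_union, Set.mem_preimage, Function.mem_mulSupport, Set.mem_iUnion,
    Set.mem_ofPred_eq, not_or, not_not, not_exists, not_lt] at hcon
  refine hv (le_antisymm ?_ ?_)
  · exact (pi_norm_le_iff_of_nonneg zero_le_one).2 hcon.2
  · have h3 : ‖FinitePlace.embedding v (f.coeffs p)‖ = 1 := hcon.1
    exact h3.symm.le.trans (norm_le_pi_norm (fun p => FinitePlace.embedding v (f.coeffs p)) p)

theorem mulHeight_coeffs_eq : Height.mulHeight f.coeffs =
    (∏ w : InfinitePlace K, (⨆ p, w (f.coeffs p)) ^ w.mult) *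
      ∏ᶠ v : HeightOneSpectrum (𝓞 K), f.coeffNorm (FinitePlace.embedding v) := by
  rw [NumberField.mulHeight_eq f.coeffs_ne_zero,
    ← finprod_comp_equiv (FinitePlace.equivHeightOneSpectrum (K := K)).symm]
  simp only [FinitePlace.equivHeightOneSpectrum_symm_apply, coeffNorm_eq_iSup]

/-- The coefficients of the lift cancel in the constant. -/
theorem _root_.pullbackConst_eq (hd : f.deg ≠ 0) {S : Finset (HeightOneSpectrum (𝓞 K))}
    (hS : ∀ v ∉ S, ∀ z, ‖f.evalAt (FinitePlace.embedding v) z‖ = ‖z‖ ^ f.deg) :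
    pullbackConst f = schanuelConst K m * (∏ w, (f.placeGauge hd).vol w) *
      ∏ v ∈ S, f.localDensity v := by
  classical
  have hw (w : InfinitePlace K) : 0 < ⨆ p, w (f.coeffs p) := by
    have := f.coeffNorm_pos w.embedding
    rwa [coeffNorm_eq_iSup, funext fun p => InfinitePlace.norm_embedding_eq w (f.coeffs p)] at this
  -- Outside T both the density and the coefficient norm are 1, so all infinite products run over T.
  set T := S ∪ (f.finite_mulSupport_coeffNorm).toFinset
  have hT1 : ∏ᶠ v : HeightOneSpectrum (𝓞 K), f.coeffNorm (FinitePlace.embedding v) =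
      ∏ v ∈ T, f.coeffNorm (FinitePlace.embedding v) :=
    finprod_eq_prod_of_mulSupport_toFinset_subset _ _ Finset.subset_union_right
  have hT2 : ∏ᶠ v : HeightOneSpectrum (𝓞 K), f.finiteFactor v = ∏ v ∈ T, f.finiteFactor v := by
    refine finprod_eq_prod_of_mulSupport_subset _ fun v hv => ?_
    by_contra hvT
    simp only [T, Finset.coe_union, Set.mem_union, Finset.mem_coe, not_or] at hvT
    have h1 : f.coeffNorm (FinitePlace.embedding v) = 1 := by
      by_contra h
      exact hvT.2 ((Set.Finite.mem_toFinset _).2 h)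
    refine hv ?_
    rw [finiteFactor_eq, h1, Real.one_rpow, one_mul, f.localDensity_eq_one v hd (hS v hvT.1)]
  have hT3 : ∏ v ∈ T, f.localDensity v = ∏ v ∈ S, f.localDensity v :=
    (Finset.prod_subset Finset.subset_union_left fun v _ hv =>
      f.localDensity_eq_one v hd (hS v hv)).symm
  have hH : f.height ^ ((Module.finrank ℚ K : ℝ) * ((m : ℝ) + 1) / (f.deg : ℝ)) =
      (∏ w : InfinitePlace K, (⨆ p, w (f.coeffs p)) ^ (w.mult * ((m : ℝ) + 1) / f.deg)) *
      ∏ v ∈ T, f.coeffNorm (FinitePlace.embedding v) ^ (((m : ℝ) + 1) / f.deg) := by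
    have hn : (Module.finrank ℚ K : ℝ) ≠ 0 := by exact_mod_cast Module.finrank_pos.ne'
    rw [height, ← Real.rpow_mul (Height.mulHeight_pos _).le]
    have he : 1 / (Module.finrank ℚ K : ℝ) * ((Module.finrank ℚ K : ℝ) * ((m : ℝ) + 1) / f.deg) =
        ((m : ℝ) + 1) / f.deg := by field_simp
    rw [he, mulHeight_coeffs_eq, hT1, Real.mul_rpow
      (Finset.prod_nonneg fun w _ => pow_nonneg (hw w).le _)
      (Finset.prod_nonneg fun v _ => (f.coeffNorm_pos _).le),
      ← Real.finsetProd_rpow _ _ (fun w _ => pow_nonneg (hw w).le _),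
      ← Real.finsetProd_rpow _ _ (fun v _ => (f.coeffNorm_pos _).le)]
    congr 1
    refine Finset.prod_congr rfl fun w _ => ?_
    rw [← Real.rpow_natCast_mul (hw w).le, mul_div_assoc]
  have hpos : 0 < f.height ^ ((Module.finrank ℚ K : ℝ) * ((m : ℝ) + 1) / (f.deg : ℝ)) :=
    Real.rpow_pos_of_pos (Real.rpow_pos_of_pos (Height.mulHeight_pos _) _) _
  rw [pullbackConst, div_eq_iff hpos.ne', hT2, hH, ← hT3]
  simp only [f.archFactor_eq hd, f.finiteFactor_eq, Finset.prod_mul_distrib]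
  ring

end ProjMorphism

end

noncomputable section

/-! ### Integral representatives of projective points -/

open NumberField.mixedEmbedding NumberField.mixedEmbedding.fundamentalCone nonZeroDivisors

section Representatives

variable {K : Type*} [Field K] {m : ℕ}

/-- The integral vector `x` is a vector of homogeneous coordinates of the point `P`. -/
def Represents (x : Fin (m + 1) → 𝓞 K) (P : Projectivization K (Fin (m + 1) → K)) : Prop :=
  ∃ h : (fun i => (x i : K)) ≠ 0, Projectivization.mk K (fun i => (x i : K)) h = P

theorem coe_integralVector_ne_zero {x : Fin (m + 1) → 𝓞 K} (hx : x ≠ 0) :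
    (fun i => (x i : K)) ≠ 0 := by
  obtain ⟨i, hi⟩ := Function.ne_iff.1 hx
  exact Function.ne_iff.2 ⟨i, RingOfIntegers.coe_ne_zero_iff.2 hi⟩

theorem Represents.ne_zero {x : Fin (m + 1) → 𝓞 K} {P : Projectivization K (Fin (m + 1) → K)}
    (h : Represents x P) : x ≠ 0 := by
  rintro rfl
  exact h.1 (by funext i; simp)

theorem Represents.unique {x : Fin (m + 1) → 𝓞 K} {P Q : Projectivization K (Fin (m + 1) → K)}
    (h : Represents x P) (h' : Represents x Q) : P = Q := by
  obtain ⟨_, rfl⟩ := h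
  obtain ⟨_, rfl⟩ := h'
  rfl

theorem span_range_mul (a : 𝓞 K) (x : Fin (m + 1) → 𝓞 K) :
    Ideal.span (Set.range fun i => a * x i) = Ideal.span {a} * Ideal.span (Set.range x) := by
  rw [Ideal.span_mul_span', Set.singleton_mul, ← Set.range_comp]
  rfl

theorem span_range_ne_bot {x : Fin (m + 1) → 𝓞 K} (hx : x ≠ 0) : Ideal.span (Set.range x) ≠ ⊥ := by
  obtain ⟨i, hi⟩ := Function.ne_iff.1 hx
  intro h
  rw [Ideal.span_eq_bot] at h
  exact hi (h _ ⟨i, rfl⟩)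

theorem PlaceGauge.val_integralVector_pos (G : PlaceGauge K m) {x : Fin (m + 1) → 𝓞 K} (hx : x ≠ 0) (w : InfinitePlace K) :
    0 < G.val (integralVector x) w := by
  obtain ⟨i, hi⟩ := Function.ne_iff.1 hx
  by_cases h : w.IsReal
  · have h1 := G.val_real (integralVector x) ⟨w, h⟩
    simp only at h1
    rw [h1]
    obtain ⟨c, hc, hle⟩ := G.exists_le_re ⟨w, h⟩
    refine (mul_pos hc (norm_pos_iff.2 fun h0 => hi ?_)).trans_le (hle _)
    have := congrFun h0 i
    simp only [integralVector] at this
    simpa using this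
  · have hc := InfinitePlace.not_isReal_iff_isComplex.1 h
    have h1 := G.val_complex (integralVector x) ⟨w, hc⟩
    simp only at h1
    rw [h1]
    obtain ⟨c, hc', hle⟩ := G.exists_le_im ⟨w, hc⟩
    refine (mul_pos hc' (norm_pos_iff.2 fun h0 => hi ?_)).trans_le (hle _)
    have := congrFun h0 i
    simp only [integralVector] at this
    simpa using this

theorem represents_of_mul_eq {x y : Fin (m + 1) → 𝓞 K}
    {P : Projectivization K (Fin (m + 1) → K)} (hx : Represents x P) {a b : 𝓞 K} (ha : a ≠ 0)
    (hb : b ≠ 0) (h : ∀ i, b * x i = a * y i) : Represents y P := by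
  obtain ⟨hx0, rfl⟩ := hx
  have ha0 : (algebraMap (𝓞 K) K a) ≠ 0 := by simpa using ha
  have hb0 : (algebraMap (𝓞 K) K b) ≠ 0 := by simpa using hb
  have hy : (fun i => (y i : K)) = ((b : K) / a) • fun i => (x i : K) := by
    funext i
    have := congrArg (algebraMap (𝓞 K) K) (h i)
    rw [map_mul, map_mul] at this
    simp only [Pi.smul_apply, smul_eq_mul]
    rw [div_mul_eq_mul_div, eq_div_iff ha0, mul_comm]
    exact this.symm
  refine ⟨hy ▸ smul_ne_zero (div_ne_zero hb0 ha0) hx0, ?_⟩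
  rw [Projectivization.mk_eq_mk_iff']
  exact ⟨_, hy.symm⟩

theorem span_range_unit_mul (u : (𝓞 K)ˣ) (x : Fin (m + 1) → 𝓞 K) :
    Ideal.span (Set.range fun i => (u : 𝓞 K) * x i) = Ideal.span (Set.range x) := by
  rw [span_range_mul, Ideal.span_singleton_eq_top.2 u.isUnit, Ideal.top_mul]

theorem represents_unit_mul {x : Fin (m + 1) → 𝓞 K} {P : Projectivization K (Fin (m + 1) → K)}
    (hx : Represents x P) (u : (𝓞 K)ˣ) : Represents (fun i => (u : 𝓞 K) * x i) P :=
  represents_of_mul_eq hx one_ne_zero u.ne_zero fun i => by rw [one_mul]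

variable [NumberField K]

theorem exists_represents (P : Projectivization K (Fin (m + 1) → K)) :
    ∃ x : Fin (m + 1) → 𝓞 K, Represents x P := by
  obtain ⟨b, hb⟩ := IsLocalization.exist_integer_multiples_of_finite (𝓞 K)⁰ P.rep
  choose x hx using hb
  have hb0 : ((b : 𝓞 K) : K) ≠ 0 := RingOfIntegers.coe_ne_zero_iff.2 (nonZeroDivisors.coe_ne_zero b)
  have hxe : (fun i => (x i : K)) = ((b : 𝓞 K) : K) • P.rep := by
    funext i
    rw [Pi.smul_apply, smul_eq_mul, ← Algebra.smul_def]
    exact hx i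
  have h0 : (fun i => (x i : K)) ≠ 0 := by
    rw [hxe]
    exact smul_ne_zero hb0 P.rep_nonzero
  refine ⟨x, h0, ?_⟩
  conv_rhs => rw [← P.mk_rep]
  rw [Projectivization.mk_eq_mk_iff']
  exact ⟨_, hxe.symm⟩

theorem Represents.exists_mul_eq {x y : Fin (m + 1) → 𝓞 K}
    {P : Projectivization K (Fin (m + 1) → K)} (hx : Represents x P) (hy : Represents y P) :
    ∃ a b : 𝓞 K, a ≠ 0 ∧ b ≠ 0 ∧ ∀ i, b * x i = a * y i := by
  obtain ⟨hx0, rfl⟩ := hx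
  obtain ⟨hy0, h⟩ := hy
  rw [Projectivization.mk_eq_mk_iff'] at h
  obtain ⟨t, ht⟩ := h
  have ht0 : t ≠ 0 := by
    rintro rfl
    exact hy0 (by rw [← ht, zero_smul])
  obtain ⟨b, a, ha, rfl⟩ := IsFractionRing.div_surjective (A := 𝓞 K) t
  have ha0 : (algebraMap (𝓞 K) K a) ≠ 0 := by
    simpa using nonZeroDivisors.ne_zero ha
  refine ⟨a, b, nonZeroDivisors.ne_zero ha, ?_, fun i => RingOfIntegers.coe_injective ?_⟩
  · rintro rfl
    simp at ht0
  · have := congrFun ht i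
    simp only [Pi.smul_apply, smul_eq_mul] at this
    rw [div_mul_eq_mul_div, div_eq_iff ha0] at this
    rw [map_mul, map_mul]
    exact this.trans (mul_comm _ _)

/-- The two vectors are proportional with ratio a/b; equality of the contents gives (a) = (b), so
the ratio is a unit. -/
theorem Represents.exists_unit_mul_eq {x y : Fin (m + 1) → 𝓞 K}
    {P : Projectivization K (Fin (m + 1) → K)} (hx : Represents x P) (hy : Represents y P)
    (hspan : Ideal.span (Set.range x) = Ideal.span (Set.range y)) :
    ∃ u : (𝓞 K)ˣ, x = fun i => u * y i := by
  obtain ⟨a, b, ha, hb, h⟩ := hx.exists_mul_eq hy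
  have h1 : Ideal.span {b} * Ideal.span (Set.range x) =
      Ideal.span {a} * Ideal.span (Set.range x) := by
    nth_rewrite 2 [hspan]
    rw [← span_range_mul, ← span_range_mul]
    simp only [h]
  have h2 := mul_right_cancel₀ (span_range_ne_bot hx.ne_zero) h1
  obtain ⟨u, hu⟩ := Ideal.span_singleton_eq_span_singleton.1 h2
  refine ⟨u, funext fun i => mul_left_cancel₀ hb ?_⟩
  rw [h i, ← hu]
  ring

/-- The ideal of a vector of homogeneous coordinates as an element of the monoid of nonzero
ideals. -/
def contentIdeal (x : Fin (m + 1) → 𝓞 K) (hx : x ≠ 0) : (Ideal (𝓞 K))⁰ :=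
  ⟨Ideal.span (Set.range x), mem_nonZeroDivisors_of_ne_zero (span_range_ne_bot hx)⟩

theorem Represents.mk0_contentIdeal_eq {x y : Fin (m + 1) → 𝓞 K}
    {P : Projectivization K (Fin (m + 1) → K)} (hx : Represents x P) (hy : Represents y P) :
    ClassGroup.mk0 (contentIdeal x hx.ne_zero) = ClassGroup.mk0 (contentIdeal y hy.ne_zero) := by
  obtain ⟨a, b, ha, hb, h⟩ := hx.exists_mul_eq hy
  rw [ClassGroup.mk0_eq_mk0_iff]
  refine ⟨b, a, hb, ha, ?_⟩
  simp only [contentIdeal]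
  rw [← span_range_mul, ← span_range_mul]
  simp only [h]

/-- Rescaling the coordinates multiplies the content by a principal fractional ideal, so every
integral ideal of the class is reached. -/
theorem Represents.exists_span_eq {x : Fin (m + 1) → 𝓞 K}
    {P : Projectivization K (Fin (m + 1) → K)} (hx : Represents x P) {J : (Ideal (𝓞 K))⁰}
    (hJ : ClassGroup.mk0 (contentIdeal x hx.ne_zero) = ClassGroup.mk0 J) :
    ∃ y, Represents y P ∧ Ideal.span (Set.range y) = J := by
  obtain ⟨b, a, hb, ha, h⟩ := ClassGroup.mk0_eq_mk0_iff.1 hJ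
  simp only [contentIdeal] at h
  have hmem (i : Fin (m + 1)) : ∃ y : 𝓞 K, b * x i = a * y := by
    have h1 : b * x i ∈ Ideal.span {a} * (J : Ideal (𝓞 K)) := by
      rw [← h]
      exact Ideal.mul_mem_mul (Ideal.mem_span_singleton_self b) (Ideal.subset_span ⟨i, rfl⟩)
    obtain ⟨y, -, hy⟩ := Ideal.mem_span_singleton_mul.1 h1
    exact ⟨y, hy.symm⟩
  choose y hy using hmem
  refine ⟨y, represents_of_mul_eq hx ha hb hy, ?_⟩
  have ha' : Ideal.span {a} ≠ ⊥ := by simpa using ha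
  refine mul_left_cancel₀ (a := Ideal.span {a}) ha' ?_
  rw [← h, ← span_range_mul, ← span_range_mul]
  simp only [hy]

/-- The points with homogeneous coordinates that generate a given ideal. -/
def pointsWithContent (I : Ideal (𝓞 K)) (Q : Set (Projectivization K (Fin (m + 1) → K))) :
    Set (Projectivization K (Fin (m + 1) → K)) :=
  {P | P ∈ Q ∧ ∃ x, Ideal.span (Set.range x) = I ∧ Represents x P}

/-- The ideal class of the content depends only on the point. Exactly one of the ideals A(C) b, with
C ranging over the classes, lies in it. -/
theorem existsUnique_class {A : ClassGroup (𝓞 K) → (Ideal (𝓞 K))⁰}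
    (hA : ∀ C, ClassGroup.mk0 (A C) = C) (b : (Ideal (𝓞 K))⁰)
    (P : Projectivization K (Fin (m + 1) → K)) :
    ∃! C, ∃ x, Ideal.span (Set.range x) = ((A C * b : (Ideal (𝓞 K))⁰) : Ideal (𝓞 K)) ∧ Represents x P := by
  obtain ⟨x, hx⟩ := exists_represents P
  refine ⟨ClassGroup.mk0 (contentIdeal x hx.ne_zero) * (ClassGroup.mk0 b)⁻¹, ?_, ?_⟩
  · obtain ⟨y, hy, hspan⟩ := hx.exists_span_eq
      (J := A (ClassGroup.mk0 (contentIdeal x hx.ne_zero) * (ClassGroup.mk0 b)⁻¹) * b)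
      (by rw [map_mul, hA, inv_mul_cancel_right])
    exact ⟨y, hspan, hy⟩
  · rintro C ⟨y, hspan, hy⟩
    have h1 : contentIdeal y hy.ne_zero = A C * b := Subtype.ext hspan
    rw [hx.mk0_contentIdeal_eq hy, h1, map_mul, hA, mul_inv_cancel_right]

theorem sum_ncard_pointsWithContent {A : ClassGroup (𝓞 K) → (Ideal (𝓞 K))⁰}
    (hA : ∀ C, ClassGroup.mk0 (A C) = C) (b : (Ideal (𝓞 K))⁰)
    {Q : Set (Projectivization K (Fin (m + 1) → K))} (hQ : Q.Finite) :
    ∑ C, (pointsWithContent ((A C * b : (Ideal (𝓞 K))⁰) : Ideal (𝓞 K)) Q).ncard = Q.ncard := by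
  classical
  choose cl hcl huniq using existsUnique_class (m := m) hA b
  rw [Set.ncard_eq_toFinset_card Q hQ,
    Finset.card_eq_sum_card_fiberwise (f := cl) (t := Finset.univ) fun _ _ => Finset.mem_univ _]
  refine Finset.sum_congr rfl fun C _ => ?_
  rw [← Set.ncard_coe_finset]
  congr 1
  ext P
  simp only [pointsWithContent, Set.mem_ofPred_eq, Finset.coe_filter, Set.Finite.mem_toFinset]
  exact and_congr_right fun _ => ⟨fun h => (huniq P C h).symm, fun h => h ▸ hcl P⟩

/-! ### Coordinate vectors in the cone, modulo roots of unity -/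

namespace PlaceGauge

variable (G : PlaceGauge K m)

/-- Membership in the fundamental cone depends only on the absolute values at the infinite places,
and these agree for the two vectors. -/
theorem mem_cone_unit_mul_iff (u : (𝓞 K)ˣ) (x : Fin (m + 1) → 𝓞 K) :
    integralVector (fun i => (u : 𝓞 K) * x i) ∈ G.cone ↔
      u • mixedSpaceOfRealSpace (G.val (integralVector x)) ∈ fundamentalCone K := by
  have h1 (w : InfinitePlace K) : G.val (integralVector fun i => (u : 𝓞 K) * x i) w =
      w (u : K) * G.val (integralVector x) w := by
    rw [← G.val_mul]
    congr 1
    funext i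
    simp [integralVector]
  have h2 (w : InfinitePlace K) :
      normAtPlace w (mixedSpaceOfRealSpace (G.val (integralVector fun i => (u : 𝓞 K) * x i))) =
      normAtPlace w (u • mixedSpaceOfRealSpace (G.val (integralVector x))) := by
    rw [normAtPlace_mixedSpaceOfRealSpace (G.val_nonneg _ _), h1, unitSMul_smul, map_mul,
      normAtPlace_apply, normAtPlace_mixedSpaceOfRealSpace (G.val_nonneg _ _)]
  exact ⟨fun h => mem_of_normAtPlace_eq h fun w => (h2 w).symm, fun h => mem_of_normAtPlace_eq h h2⟩

theorem ne_zero_of_mem_cone {x : Fin (m + 1) → 𝓞 K} (hx : integralVector x ∈ G.cone) : x ≠ 0 := by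
  rintro rfl
  have h := normAtPlace_pos_of_mem hx (Classical.arbitrary _)
  rw [normAtPlace_mixedSpaceOfRealSpace (G.val_nonneg _ _)] at h
  have h0 : integralVector (0 : Fin (m + 1) → 𝓞 K) =
      fun i => mixedEmbedding K 0 * integralVector (0 : Fin (m + 1) → 𝓞 K) i := by
    funext i
    simp [integralVector]
  rw [h0, G.val_mul, map_zero, zero_mul] at h
  exact lt_irrefl _ h

theorem exists_unit_mul_mem_cone {x : Fin (m + 1) → 𝓞 K} (hx : x ≠ 0) :
    ∃ u : (𝓞 K)ˣ, integralVector (fun i => (u : 𝓞 K) * x i) ∈ G.cone := by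
  simp only [mem_cone_unit_mul_iff]
  refine exists_unit_smul_mem (mixedEmbedding.norm_ne_zero_iff.2 fun w => ?_)
  rw [normAtPlace_mixedSpaceOfRealSpace (G.val_nonneg _ _)]
  exact (G.val_integralVector_pos hx w).ne'

/-- The homogeneous coordinates in the cone with given content. -/
def coneVectors (I : Ideal (𝓞 K)) (Q : Set (Projectivization K (Fin (m + 1) → K))) :
    Set (Fin (m + 1) → 𝓞 K) :=
  {x | integralVector x ∈ G.cone ∧ Ideal.span (Set.range x) = I ∧ ∃ P ∈ Q, Represents x P}

/-- The coordinate vectors of a point with fixed content form one orbit of the units. The cone meets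
this orbit in one free orbit of the torsion units. -/
theorem ncard_coneVectors (I : Ideal (𝓞 K)) (Q : Set (Projectivization K (Fin (m + 1) → K))) :
    (G.coneVectors I Q).ncard = Units.torsionOrder K * (pointsWithContent I Q).ncard := by
  have hrep (P : pointsWithContent I Q) : ∃ x, integralVector x ∈ G.cone ∧
      Ideal.span (Set.range x) = I ∧ Represents x P.1 := by
    obtain ⟨P, hP, x, hx, hxP⟩ := P
    obtain ⟨u, hu⟩ := G.exists_unit_mul_mem_cone hxP.ne_zero
    exact ⟨_, hu, (span_range_unit_mul u x).trans hx, represents_unit_mul hxP u⟩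
  choose s hs1 hs2 hs3 using hrep
  let φ : Units.torsion K × pointsWithContent I Q → G.coneVectors I Q := fun p =>
    ⟨fun i => ((p.1 : (𝓞 K)ˣ) : 𝓞 K) * s p.2 i,
      (G.mem_cone_unit_mul_iff _ _).2 (torsion_smul_mem_of_mem (hs1 p.2) p.1.2),
      (span_range_unit_mul _ _).trans (hs2 p.2), p.2.1, p.2.2.1, represents_unit_mul (hs3 p.2) _⟩
  have hφ : Function.Bijective φ := by
    constructor
    · rintro ⟨ζ, P⟩ ⟨ζ', P'⟩ h
      have h1 := congrArg Subtype.val h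
      simp only [φ] at h1
      have hP : P = P' := by
        refine Subtype.ext ((represents_unit_mul (hs3 P) ζ).unique ?_)
        rw [h1]
        exact represents_unit_mul (hs3 P') ζ'
      subst hP
      obtain ⟨i, hi⟩ := Function.ne_iff.1 (hs3 P).ne_zero
      have h2 := mul_right_cancel₀ hi (congrFun h1 i)
      rw [Subtype.ext (Units.ext h2)]
    · rintro ⟨x, hx, hspan, P, hPQ, hxP⟩
      have hP : P ∈ pointsWithContent I Q := ⟨hPQ, x, hspan, hxP⟩
      obtain ⟨u, rfl⟩ := hxP.exists_unit_mul_eq (hs3 ⟨P, hP⟩) (hspan.trans (hs2 ⟨P, hP⟩).symm)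
      have hu : u ∈ Units.torsion K := by
        rw [← unit_smul_mem_iff_mem_torsion (hs1 ⟨P, hP⟩)]
        exact (G.mem_cone_unit_mul_iff _ _).1 hx
      exact ⟨(⟨u, hu⟩, ⟨P, hP⟩), rfl⟩
  rw [← Nat.card_coe_set_eq, ← Nat.card_congr (Equiv.ofBijective φ hφ), Nat.card_prod,
    Nat.card_coe_set_eq, Units.torsionOrder]

theorem sum_ncard_coneVectors {A : ClassGroup (𝓞 K) → (Ideal (𝓞 K))⁰}
    (hA : ∀ C, ClassGroup.mk0 (A C) = C) (b : (Ideal (𝓞 K))⁰)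
    {Q : Set (Projectivization K (Fin (m + 1) → K))} (hQ : Q.Finite) :
    ∑ C, (G.coneVectors ((A C * b : (Ideal (𝓞 K))⁰) : Ideal (𝓞 K)) Q).ncard = Units.torsionOrder K * Q.ncard := by
  simp only [ncard_coneVectors, ← Finset.mul_sum, sum_ncard_pointsWithContent hA b hQ]

end PlaceGauge

/-- Every ideal class is represented by an integral ideal that is coprime to a given one. -/
theorem exists_class_representatives_coprime {c : Ideal (𝓞 K)} (hc : c ≠ ⊥) :
    ∃ A : ClassGroup (𝓞 K) → (Ideal (𝓞 K))⁰, ∀ C, ClassGroup.mk0 (A C) = C ∧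
      (A C : Ideal (𝓞 K)) ⊔ c = ⊤ := by
  have key (C : ClassGroup (𝓞 K)) : ∃ J : (Ideal (𝓞 K))⁰, ClassGroup.mk0 J = C ∧
      (J : Ideal (𝓞 K)) ⊔ c = ⊤ := by
    rcases eq_or_ne c ⊤ with rfl | hc1
    · obtain ⟨J, hJ⟩ := ClassGroup.mk0_surjective C
      exact ⟨J, hJ, sup_top_eq _⟩
    obtain ⟨I, hI⟩ := ClassGroup.mk0_surjective C⁻¹
    have hI0 : (I : Ideal (𝓞 K)) ≠ 0 := nonZeroDivisors.coe_ne_zero I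
    -- With Ic + (a) = I, the quotient J = (a)/I is coprime to c. Its class is inverse to that of I,
    -- which was chosen in the class of C⁻¹.
    obtain ⟨a, ha⟩ := IsDedekindDomain.exists_sup_span_eq
      (I := (I : Ideal (𝓞 K)) * c) (J := I) Ideal.mul_le_left (mul_ne_zero hI0 hc)
    -- For a = 0 one would have Ic = I, hence c = ⊤, a case already treated.
    have ha0 : a ≠ 0 := by
      rintro rfl
      refine hc1 (mul_left_cancel₀ hI0 ?_)
      rw [Ideal.mul_top]
      simpa using ha
    obtain ⟨J, hJ⟩ : (I : Ideal (𝓞 K)) ∣ Ideal.span {a} := Ideal.dvd_iff_le.2 (ha ▸ le_sup_right)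
    have hJ0 : J ≠ 0 := by
      rintro rfl
      rw [mul_zero, Ideal.zero_eq_bot, Ideal.span_singleton_eq_bot] at hJ
      exact ha0 hJ
    refine ⟨⟨J, mem_nonZeroDivisors_of_ne_zero hJ0⟩, ?_, ?_⟩
    · have h1 : ClassGroup.mk0 (I * ⟨J, mem_nonZeroDivisors_of_ne_zero hJ0⟩) = 1 := by
        rw [ClassGroup.mk0_eq_one_iff]
        exact ⟨a, hJ.symm⟩
      rw [map_mul, hI, inv_mul_eq_one] at h1
      exact h1.symm
    · refine mul_left_cancel₀ hI0 ?_
      rw [Ideal.mul_top, Ideal.mul_sup, ← hJ, sup_comm]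
      exact ha
  choose A hA using key
  exact ⟨A, hA⟩

end Representatives

end

noncomputable section

/-! ### Weighted counting over residue classes -/

open AdicHaar nonZeroDivisors

section Residues

variable {K : Type*} [Field K] {m : ℕ}

theorem exists_mem_congruent {a c : Ideal (𝓞 K)} (hac : a ⊔ c = ⊤) (ρ : Fin (m + 1) → 𝓞 K ⧸ c) :
    ∃ x₀ : Fin (m + 1) → 𝓞 K, (∀ i, x₀ i ∈ a) ∧ ∀ i, Ideal.Quotient.mk c (x₀ i) = ρ i := by
  have key (i : Fin (m + 1)) : ∃ y ∈ a, Ideal.Quotient.mk c y = ρ i := by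
    obtain ⟨r, hr⟩ := Ideal.Quotient.mk_surjective (ρ i)
    obtain ⟨y, hy, z, hz, h⟩ := Submodule.mem_sup.1 (hac ▸ Submodule.mem_top : r ∈ a ⊔ c)
    refine ⟨y, hy, ?_⟩
    rw [← hr, ← h, map_add, Ideal.Quotient.eq_zero_iff_mem.2 hz, add_zero]
  choose x₀ h1 h2 using key
  exact ⟨x₀, h1, h2⟩

variable [NumberField K]

instance finite_quotient_of_neZero (c : Ideal (𝓞 K)) [NeZero c] : Finite (𝓞 K ⧸ c) :=
  c.finiteQuotientOfFreeOfNeBot (NeZero.ne c)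

namespace PlaceGauge

variable (G : PlaceGauge K m)

/-- The integral vectors in the cone with coordinates in `a` and norm at most `U x * T`. -/
def weightedSet (a : Ideal (𝓞 K)) (U : (Fin (m + 1) → 𝓞 K) → ℝ) (T : ℝ) :
    Set (Fin (m + 1) → 𝓞 K) :=
  {x | (∀ i, x i ∈ a) ∧ integralVector x ∈ G.cone ∧ 0 < U x ∧ G.norm (integralVector x) ≤ U x * T}

variable {a c : Ideal (𝓞 K)} {U : (Fin (m + 1) → 𝓞 K) → ℝ}

/-- As a and c are coprime, lying in a and in a fixed class modulo c is one congruence condition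
modulo ac, and the weight is constant there. -/
theorem setOf_weightedSet_residue_eq (hac : a ⊔ c = ⊤)
    (hU : ∀ x y, (∀ i, x i - y i ∈ c) → U x = U y) {x₀ : Fin (m + 1) → 𝓞 K}
    (hx₀ : ∀ i, x₀ i ∈ a) (h0 : 0 < U x₀) (T : ℝ) :
    {x | x ∈ G.weightedSet a U T ∧ ∀ i, x i - x₀ i ∈ c} =
      G.congruenceSet (a * c) x₀ (U x₀ * T) := by
  ext x
  simp only [weightedSet, congruenceSet, Set.mem_ofPred_eq]
  have hmem : (∀ i, x i - x₀ i ∈ a * c) ↔ (∀ i, x i ∈ a) ∧ ∀ i, x i - x₀ i ∈ c := by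
    rw [Ideal.mul_eq_inf_of_isCoprime (Ideal.isCoprime_iff_sup_eq.2 hac)]
    simp only [Ideal.mem_inf, forall_and]
    refine and_congr_left fun _ => forall_congr' fun i => ?_
    exact ⟨fun h => by simpa using a.add_mem h (hx₀ i), fun h => a.sub_mem h (hx₀ i)⟩
  rw [hmem]
  constructor
  · rintro ⟨⟨h1, h2, h3, h4⟩, h5⟩
    exact ⟨⟨h1, h5⟩, h2, hU x x₀ h5 ▸ h4⟩
  · rintro ⟨⟨h1, h5⟩, h2, h4⟩
    exact ⟨⟨h1, h2, (hU x x₀ h5).symm ▸ h0, (hU x x₀ h5).symm ▸ h4⟩, h5⟩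

theorem finite_weightedSet (hc : c ≠ ⊥) (ha : a ≠ ⊥) (hac : a ⊔ c = ⊤)
    (hU : ∀ x y, (∀ i, x i - y i ∈ c) → U x = U y) (T : ℝ) : (G.weightedSet a U T).Finite := by
  have : NeZero c := ⟨hc⟩
  choose x₀ hx₀ hx₀ρ using exists_mem_congruent (m := m) hac
  refine (Set.finite_iUnion fun ρ => G.finite_congruenceSet (a * c) (mul_ne_zero ha hc) (x₀ ρ)
    (U (x₀ ρ) * T)).subset fun x hx => ?_
  refine Set.mem_iUnion_of_mem (fun i => Ideal.Quotient.mk c (x i)) ?_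
  have hcongr (i) : x i - x₀ (fun i => Ideal.Quotient.mk c (x i)) i ∈ c :=
    Ideal.Quotient.eq.1 (hx₀ρ (fun i => Ideal.Quotient.mk c (x i)) i).symm
  rw [← G.setOf_weightedSet_residue_eq hac hU (hx₀ _)]
  · exact ⟨hx, hcongr⟩
  · exact hU _ _ hcongr ▸ hx.2.2.1

/-- Sum the lattice count over the classes modulo c. A class of weight U contributes with bound UT,
hence with the factor U^{m+1}; classes of weight 0 are empty. -/
theorem tendsto_ncard_weightedSet_div [Fintype (𝓞 K ⧸ c)] (hc : c ≠ ⊥) (ha : a ≠ ⊥)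
    (hac : a ⊔ c = ⊤) (hU : ∀ x y, (∀ i, x i - y i ∈ c) → U x = U y) (hU0 : ∀ x, 0 ≤ U x) :
    Tendsto (fun T : ℝ => ((G.weightedSet a U T).ncard : ℝ) / T ^ (m + 1)) atTop
      (𝓝 (G.latticeConst / (a.absNorm : ℝ) ^ (m + 1) * ((c.absNorm : ℝ)⁻¹ ^ (m + 1) *
        ∑ ρ : Fin (m + 1) → 𝓞 K ⧸ c, U (fun i => (ρ i).out) ^ (m + 1)))) := by
  classical
  choose x₀ hx₀ hx₀ρ using exists_mem_congruent (m := m) hac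
  have hUeq (ρ : Fin (m + 1) → 𝓞 K ⧸ c) : U (x₀ ρ) = U (fun i => (ρ i).out) :=
    hU _ _ fun i => Ideal.Quotient.eq.1 ((hx₀ρ ρ i).trans (Ideal.Quotient.mk_out _).symm)
  have hsum (T : ℝ) : (G.weightedSet a U T).ncard = ∑ ρ : Fin (m + 1) → 𝓞 K ⧸ c,
      if 0 < U (x₀ ρ) then (G.congruenceSet (a * c) (x₀ ρ) (U (x₀ ρ) * T)).ncard else 0 := by
    have hfin := G.finite_weightedSet hc ha hac hU T
    rw [Set.ncard_eq_toFinset_card _ hfin, Finset.card_eq_sum_card_fiberwise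
      (f := fun x i => Ideal.Quotient.mk c (x i)) (t := Finset.univ) fun _ _ => Finset.mem_univ _]
    refine Finset.sum_congr rfl fun ρ _ => ?_
    have hiff (x : Fin (m + 1) → 𝓞 K) : (fun i => Ideal.Quotient.mk c (x i)) = ρ ↔
        ∀ i, x i - x₀ ρ i ∈ c := by
      rw [funext_iff]
      refine forall_congr' fun i => ?_
      rw [← hx₀ρ ρ i]
      exact Ideal.Quotient.eq
    split_ifs with h
    · rw [← G.setOf_weightedSet_residue_eq hac hU (hx₀ ρ) h, ← Set.ncard_coe_finset]
      congr 1
      ext x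
      simp [hiff]
    · rw [Finset.card_eq_zero, Finset.filter_eq_empty_iff]
      intro x hx hxρ
      rw [Set.Finite.mem_toFinset] at hx
      exact h (hU _ _ ((hiff x).1 hxρ) ▸ hx.2.2.1)
  have hlim (ρ : Fin (m + 1) → 𝓞 K ⧸ c) : Tendsto (fun T : ℝ =>
      (((if 0 < U (x₀ ρ) then (G.congruenceSet (a * c) (x₀ ρ) (U (x₀ ρ) * T)).ncard else 0 : ℕ) :
        ℝ)) / T ^ (m + 1)) atTop
      (𝓝 (U (x₀ ρ) ^ (m + 1) * (G.latticeConst / ((a * c).absNorm : ℝ) ^ (m + 1)))) := by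
    split_ifs with h
    · have h1 := (G.tendsto_ncard_congruenceSet_div (a * c) (mul_ne_zero ha hc) (x₀ ρ)).comp
        (tendsto_id.const_mul_atTop h)
      refine (h1.const_mul (U (x₀ ρ) ^ (m + 1))).congr' ?_
      filter_upwards [eventually_gt_atTop 0] with T hT
      simp only [Function.comp_apply, id_eq]
      rw [mul_pow]
      field_simp
    · have : U (x₀ ρ) = 0 := le_antisymm (not_lt.1 h) (hU0 _)
      simp [this]
  have h := tendsto_finsetSum Finset.univ fun ρ _ => hlim ρ
  refine (h.congr fun T => ?_).trans (le_of_eq ?_)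
  · rw [hsum, Nat.cast_sum, Finset.sum_div]
  · congr 1
    rw [← Finset.sum_mul, map_mul]
    simp only [hUeq]
    push_cast
    rw [mul_pow, inv_pow]
    have : (a.absNorm : ℝ) ≠ 0 := by exact_mod_cast Ideal.absNorm_eq_zero_iff.not.2 ha
    have : (c.absNorm : ℝ) ≠ 0 := by exact_mod_cast Ideal.absNorm_eq_zero_iff.not.2 hc
    field_simp

end PlaceGauge

end Residues

/-! ### The weights at the bad places as functions of residues -/

namespace ProjMorphism

variable {K : Type*} [Field K] [NumberField K] {m M : ℕ} (f : ProjMorphism K m M)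

/-- The product of the primitive weights over a finite set of places. -/
def weight (S : Finset (HeightOneSpectrum (𝓞 K))) (x : Fin (m + 1) → 𝓞 K) : ℝ :=
  ∏ v ∈ S, f.primWeight v (localVector v x)

theorem weight_nonneg (S : Finset (HeightOneSpectrum (𝓞 K))) (x : Fin (m + 1) → 𝓞 K) :
    0 ≤ f.weight S x := Finset.prod_nonneg fun v _ => f.primWeight_nonneg v _

theorem exists_primWeight_eq_of_sub_mem (hd : f.deg ≠ 0) (v : HeightOneSpectrum (𝓞 K)) :
    ∃ n : ℕ, n ≠ 0 ∧ ∀ z z' : Fin (m + 1) → v.adicCompletion K, ‖z‖ ≤ 1 → ‖z'‖ ≤ 1 →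
      ‖z - z'‖ ≤ (resCard v)⁻¹ ^ n → f.primWeight v z = f.primWeight v z' := by
  obtain ⟨n, hn⟩ := f.exists_primWeight_eq_of_norm_sub_le v hd
  refine ⟨n + 1, Nat.succ_ne_zero n, fun z z' hz hz' h => hn z z' hz hz' (h.trans ?_)⟩
  exact pow_le_pow_of_le_one (by positivity) (inv_le_one_of_one_le₀ (one_lt_resCard v).le)
    (Nat.le_succ n)

/-- Take for c a product of powers of the primes in S. By the Chinese remainder theorem the average
over residues modulo c factors into local averages, and each of these is an integral of `primWeight
^ (m + 1)`. -/
theorem exists_modulus (hd : f.deg ≠ 0) (S : Finset (HeightOneSpectrum (𝓞 K))) :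
    ∃ c : Ideal (𝓞 K), c ≠ ⊥ ∧ (∀ v ∈ S, c ≤ v.asIdeal) ∧
      (∀ x y, (∀ i, x i - y i ∈ c) → f.weight S x = f.weight S y) ∧
      ∀ [Fintype (𝓞 K ⧸ c)], (c.absNorm : ℝ)⁻¹ ^ (m + 1) *
        ∑ ρ : Fin (m + 1) → 𝓞 K ⧸ c, f.weight S (fun i => (ρ i).out) ^ (m + 1) =
      ∏ v ∈ S, ((1 - (resCard v)⁻¹ ^ (m + 1)) * f.localDensity v) := by
  classical
  choose n hn0 hn using f.exists_primWeight_eq_of_sub_mem hd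
  have hprim (v : HeightOneSpectrum (𝓞 K)) (x y : Fin (m + 1) → 𝓞 K)
      (h : ∀ i, x i - y i ∈ v.asIdeal ^ n v) :
      f.primWeight v (localVector v x) = f.primWeight v (localVector v y) :=
    hn v _ _ (norm_localVector_le_one v x) (norm_localVector_le_one v y)
      ((norm_localVector_sub_le_iff v x y _).2 h)
  have hle (v) (hv : v ∈ S) : ∏ v ∈ S, v.asIdeal ^ n v ≤ v.asIdeal ^ n v :=
    Ideal.dvd_iff_le.1 (Finset.dvd_prod_of_mem _ hv)
  refine ⟨∏ v ∈ S, v.asIdeal ^ n v, Finset.prod_ne_zero_iff.2 fun v _ => pow_ne_zero _ v.ne_bot,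
    fun v hv => (hle v hv).trans (Ideal.pow_le_self (hn0 v)), fun x y h => ?_, ?_⟩
  · exact Finset.prod_congr rfl fun v hv => hprim v x y fun i => hle v hv (h i)
  · intro _
    let e := HeightOneSpectrum.quotientEquivPiOfProdEq (∏ v ∈ S, v.asIdeal ^ n v)
      (fun v : S => v.1) (fun v : S => n v.1) (fun v w h => Subtype.coe_injective.ne h)
      (Finset.prod_coe_sort S fun v => v.asIdeal ^ n v)
    have he (x : 𝓞 K) (v : S) : e (Ideal.Quotient.mk _ x) v = Ideal.Quotient.mk _ x := rfl
    let E : (Fin (m + 1) → 𝓞 K ⧸ ∏ v ∈ S, v.asIdeal ^ n v) ≃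
        ∀ v : S, Fin (m + 1) → 𝓞 K ⧸ v.1.asIdeal ^ n v.1 :=
      (Equiv.piCongrRight fun _ => e.toEquiv).trans (Equiv.piComm _)
    have hE (ρ : Fin (m + 1) → 𝓞 K ⧸ ∏ v ∈ S, v.asIdeal ^ n v) :
        f.weight S (fun i => (ρ i).out) ^ (m + 1) = ∏ v : S,
          f.primWeight v.1 (localVector v.1 fun i => (E ρ v i).out) ^ (m + 1) := by
      rw [weight, ← Finset.prod_pow, ← Finset.prod_coe_sort S
        fun v => f.primWeight v (localVector v fun i => (ρ i).out) ^ (m + 1)]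
      refine Finset.prod_congr rfl fun v _ => ?_
      rw [hprim v.1 _ fun i => (E ρ v i).out]
      intro i
      rw [← Ideal.Quotient.eq, Ideal.Quotient.mk_out]
      change _ = e (ρ i) v
      rw [← he, Ideal.Quotient.mk_out]
    have h_int (v : HeightOneSpectrum (𝓞 K)) : (1 - (resCard v)⁻¹ ^ (m + 1)) * f.localDensity v =
        ((resCard v)⁻¹ ^ n v) ^ (m + 1) * ∑ ρ : Fin (m + 1) → 𝓞 K ⧸ v.asIdeal ^ n v,
          f.primWeight v (localVector v fun i => (ρ i).out) ^ (m + 1) := by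
      rw [← f.integral_primWeight_pow v hd, setIntegral_eq_sum_residues v (n v)]
      intro z z' hz hz' h
      rw [hn v z z' hz hz' h]
    simp only [hE, h_int]
    rw [Equiv.sum_comp E fun σ => ∏ v : S,
      f.primWeight v.1 (localVector v.1 fun i => (σ v i).out) ^ (m + 1),
      Finset.prod_mul_distrib, ← Finset.prod_coe_sort S fun v =>
        ∑ ρ : Fin (m + 1) → 𝓞 K ⧸ v.asIdeal ^ n v,
          f.primWeight v (localVector v fun i => (ρ i).out) ^ (m + 1), Fintype.prod_sum]
    congr 1
    rw [map_prod, Finset.prod_pow]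
    push_cast
    rw [← Finset.prod_inv_distrib]
    congr 1
    exact Finset.prod_congr rfl fun v _ => by rw [map_pow, Nat.cast_pow, inv_pow]

theorem weight_pos_iff (hd : f.deg ≠ 0) {S : Finset (HeightOneSpectrum (𝓞 K))}
    {x : Fin (m + 1) → 𝓞 K} : 0 < f.weight S x ↔
      ∀ v ∈ S, ¬ Ideal.span (Set.range x) ≤ v.asIdeal := by
  have h1 : 0 < f.weight S x ↔ ∀ v ∈ S, 0 < f.primWeight v (localVector v x) := by
    refine ⟨fun h v hv => ?_, fun h => Finset.prod_pos h⟩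
    exact lt_of_le_of_ne (f.primWeight_nonneg v _)
      (Finset.prod_ne_zero_iff.1 h.ne' v hv).symm
  rw [h1]
  refine forall₂_congr fun v _ => ?_
  rw [f.primWeight_pos_iff v hd]
  have h2 : ‖localVector v x‖ < 1 ↔ Ideal.span (Set.range x) ≤ v.asIdeal := by
    rw [pi_norm_lt_iff one_pos, Ideal.span_le, Set.range_subset_iff]
    exact forall_congr' fun i => FinitePlace.norm_lt_one_iff_mem K v (x i)
  rw [← h2, not_lt]
  exact ⟨fun h => h.ge, fun h => le_antisymm (norm_localVector_le_one v x) h⟩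

end ProjMorphism

end

noncomputable section

/-! ### Counting points through their integral representatives -/

open AdicHaar nonZeroDivisors

namespace ProjMorphism

variable {K : Type*} [Field K] [NumberField K] {m M : ℕ} (f : ProjMorphism K m M)

/-- The points of bounded height. -/
def boundedPoints (T : ℝ) : Set (Projectivization K (Fin (m + 1) → K)) :=
  {P | f.rootHeight P ≤ T}

/-- The nonzero ideals that are coprime to the places in `S`. -/
def coprimeIdeals (S : Finset (HeightOneSpectrum (𝓞 K))) : Set (Ideal (𝓞 K))⁰ :=
  {b | ∀ v ∈ S, ¬ (b : Ideal (𝓞 K)) ≤ v.asIdeal}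

theorem one_mem_coprimeIdeals {L : Type*} [Field L] (S : Finset (HeightOneSpectrum (𝓞 L))) :
    (1 : (Ideal (𝓞 L))⁰) ∈ coprimeIdeals S := fun v _ h =>
  v.isPrime.ne_top (top_le_iff.1 (by simpa [Ideal.one_eq_top] using h))

theorem finite_absNorm_le (T : ℝ) :
    {b : (Ideal (𝓞 K))⁰ | (Ideal.absNorm (b : Ideal (𝓞 K)) : ℝ) ≤ T}.Finite := by
  refine ((Ideal.finite_setOfPred_absNorm_le ⌊T⌋₊).preimage
    (Subtype.val_injective (p := fun b => b ∈ (Ideal (𝓞 K))⁰)).injOn).subset fun b hb => ?_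
  exact Nat.le_floor hb

theorem one_le_absNorm (b : (Ideal (𝓞 K))⁰) : (1 : ℝ) ≤ Ideal.absNorm (b : Ideal (𝓞 K)) := by
  have : Ideal.absNorm (b : Ideal (𝓞 K)) ≠ 0 :=
    Ideal.absNorm_eq_zero_iff.not.2 (nonZeroDivisors.coe_ne_zero b)
  exact_mod_cast Nat.one_le_iff_ne_zero.2 this

theorem absNorm_pos (b : (Ideal (𝓞 K))⁰) : (0 : ℝ) < Ideal.absNorm (b : Ideal (𝓞 K)) :=
  zero_lt_one.trans_le (one_le_absNorm b)

variable {S : Finset (HeightOneSpectrum (𝓞 K))}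

/-- Positive weight means that x is primitive at every place of S. There |x|_v = 1, and the weight
cancels exactly the factor |F(x)|^{1/d}. -/
theorem rootHeight_mul_absNorm_mul_weight (hd : f.deg ≠ 0)
    (hS : ∀ v ∉ S, ∀ z, ‖f.evalAt (FinitePlace.embedding v) z‖ = ‖z‖ ^ f.deg)
    {x : Fin (m + 1) → 𝓞 K} {P : Projectivization K (Fin (m + 1) → K)} (hx : Represents x P)
    (hw : 0 < f.weight S x) :
    f.rootHeight P * Ideal.absNorm (Ideal.span (Set.range x)) * f.weight S x =
      (f.placeGauge hd).norm (integralVector x) := by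
  have hx0 := hx.ne_zero
  obtain ⟨hx', rfl⟩ := hx
  rw [f.rootHeight_mul_absNorm hd hS hx0 hx', weight, mul_assoc, ← Finset.prod_mul_distrib]
  refine (congrArg _ (Finset.prod_eq_one fun v hv => ?_)).trans (mul_one _)
  have hpos : 0 < f.primWeight v (localVector v x) := lt_of_le_of_ne (f.primWeight_nonneg v _)
    (Finset.prod_ne_zero_iff.1 hw.ne' v hv).symm
  have h1 := (f.primWeight_pos_iff v hd).1 hpos
  rw [primWeight, if_pos h1, h1, div_one]
  exact mul_inv_cancel₀ (f.localGauge_pos _ hd (localVector_ne_zero v hx0)).ne'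

/-- For content ab the norm equals the height times N(a) N(b) times the weight. The bound with T
N(a) thus becomes height at most T/N(b), so a vector records a pair (P, b). -/
theorem mem_weightedSet_and_span_eq_iff (hd : f.deg ≠ 0)
    (hS : ∀ v ∉ S, ∀ z, ‖f.evalAt (FinitePlace.embedding v) z‖ = ‖z‖ ^ f.deg)
    {a b : (Ideal (𝓞 K))⁰} (ha : a ∈ coprimeIdeals S) (hb : b ∈ coprimeIdeals S) {T : ℝ}
    {x : Fin (m + 1) → 𝓞 K} :
    (x ∈ (f.placeGauge hd).weightedSet a (f.weight S) (T * Ideal.absNorm (a : Ideal (𝓞 K))) ∧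
        Ideal.span (Set.range x) = ((a * b : (Ideal (𝓞 K))⁰) : Ideal (𝓞 K))) ↔
      x ∈ (f.placeGauge hd).coneVectors ((a * b : (Ideal (𝓞 K))⁰) : Ideal (𝓞 K))
        (f.boundedPoints (T / Ideal.absNorm (b : Ideal (𝓞 K)))) := by
  have hab : ((a * b : (Ideal (𝓞 K))⁰) : Ideal (𝓞 K)) = (a : Ideal (𝓞 K)) * (b : Ideal (𝓞 K)) := rfl
  have key (P : Projectivization K (Fin (m + 1) → K)) (hP : Represents x P)
      (hspan : Ideal.span (Set.range x) = ((a * b : (Ideal (𝓞 K))⁰) : Ideal (𝓞 K)))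
      (hw : 0 < f.weight S x) :
      f.rootHeight P ≤ T / Ideal.absNorm (b : Ideal (𝓞 K)) ↔
        (f.placeGauge hd).norm (integralVector x) ≤
          f.weight S x * (T * Ideal.absNorm (a : Ideal (𝓞 K))) := by
    rw [← f.rootHeight_mul_absNorm_mul_weight hd hS hP hw, hspan, hab, map_mul, Nat.cast_mul,
      mul_comm _ (f.weight S x), mul_le_mul_iff_right₀ hw, mul_left_comm, mul_comm T,
      mul_le_mul_iff_right₀ (absNorm_pos a), le_div_iff₀ (absNorm_pos b)]
  constructor
  · rintro ⟨⟨-, h2, h3, h4⟩, hspan⟩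
    have hP : Represents x _ := ⟨coe_integralVector_ne_zero ((f.placeGauge hd).ne_zero_of_mem_cone h2),
      rfl⟩
    exact ⟨h2, hspan, _, (key _ hP hspan h3).2 h4, hP⟩
  · rintro ⟨h2, hspan, P, hPT, hP⟩
    have hw : 0 < f.weight S x := by
      rw [f.weight_pos_iff hd, hspan, hab]
      intro v hv h
      rcases v.isPrime.mul_le.1 h with h | h
      exacts [ha v hv h, hb v hv h]
    refine ⟨⟨fun i => ?_, h2, hw, (key P hP hspan hw).1 hPT⟩, hspan⟩
    have : x i ∈ Ideal.span (Set.range x) := Ideal.subset_span ⟨i, rfl⟩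
    rw [hspan, hab] at this
    exact Ideal.mul_le_left this

/-- Coordinates in a make the content divisible by a, and primitivity at S makes the cofactor b
coprime to S. Since heights are at least 1, N(b) ≤ T. -/
theorem exists_span_eq_of_mem_weightedSet (hd : f.deg ≠ 0)
    (hS : ∀ v ∉ S, ∀ z, ‖f.evalAt (FinitePlace.embedding v) z‖ = ‖z‖ ^ f.deg)
    {a : (Ideal (𝓞 K))⁰} (ha : a ∈ coprimeIdeals S) {T : ℝ} {x : Fin (m + 1) → 𝓞 K}
    (hx : x ∈ (f.placeGauge hd).weightedSet a (f.weight S)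
      (T * Ideal.absNorm (a : Ideal (𝓞 K)))) :
    ∃ b ∈ coprimeIdeals S, (Ideal.absNorm (b : Ideal (𝓞 K)) : ℝ) ≤ T ∧
      Ideal.span (Set.range x) = ((a * b : (Ideal (𝓞 K))⁰) : Ideal (𝓞 K)) := by
  have hle : Ideal.span (Set.range x) ≤ a := Ideal.span_le.2 (Set.range_subset_iff.2 hx.1)
  obtain ⟨b, hb⟩ := Ideal.dvd_iff_le.2 hle
  have hb0 : b ≠ 0 := by
    rintro rfl
    refine span_range_ne_bot ((f.placeGauge hd).ne_zero_of_mem_cone hx.2.1) ?_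
    rw [hb, mul_zero, Ideal.zero_eq_bot]
  have hbS : (⟨b, mem_nonZeroDivisors_of_ne_zero hb0⟩ : (Ideal (𝓞 K))⁰) ∈ coprimeIdeals S := by
    intro v hv h
    refine (f.weight_pos_iff hd).1 hx.2.2.1 v hv ?_
    rw [hb]
    exact Ideal.mul_le_right.trans h
  refine ⟨⟨b, mem_nonZeroDivisors_of_ne_zero hb0⟩, hbS, ?_, hb⟩
  obtain ⟨-, -, P, hP, -⟩ := (f.mem_weightedSet_and_span_eq_iff hd hS ha hbS).1 ⟨hx, hb⟩
  have := (f.one_le_rootHeight P).trans hP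
  rwa [one_le_div (absNorm_pos _)] at this

open Classical in
theorem ncard_weightedSet_eq_sum (hd : f.deg ≠ 0)
    (hS : ∀ v ∉ S, ∀ z, ‖f.evalAt (FinitePlace.embedding v) z‖ = ‖z‖ ^ f.deg)
    {a : (Ideal (𝓞 K))⁰} (ha : a ∈ coprimeIdeals S) {T : ℝ}
    (hfin : ((f.placeGauge hd).weightedSet a (f.weight S)
      (T * Ideal.absNorm (a : Ideal (𝓞 K)))).Finite) :
    ((f.placeGauge hd).weightedSet a (f.weight S) (T * Ideal.absNorm (a : Ideal (𝓞 K)))).ncard =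
      ∑ b ∈ (finite_absNorm_le (K := K) T).toFinset with b ∈ coprimeIdeals S,
        ((f.placeGauge hd).coneVectors ((a * b : (Ideal (𝓞 K))⁰) : Ideal (𝓞 K))
          (f.boundedPoints (T / Ideal.absNorm (b : Ideal (𝓞 K))))).ncard := by
  -- This is the cofactor of a in the content; the default value 1 is never reached on the weighted
  -- set.
  let F : (Fin (m + 1) → 𝓞 K) → (Ideal (𝓞 K))⁰ := fun x =>
    if h : ∃ b : (Ideal (𝓞 K))⁰, Ideal.span (Set.range x) =
      ((a * b : (Ideal (𝓞 K))⁰) : Ideal (𝓞 K)) then h.choose else 1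
  have hF {x : Fin (m + 1) → 𝓞 K} {b : (Ideal (𝓞 K))⁰}
      (h : Ideal.span (Set.range x) = ((a * b : (Ideal (𝓞 K))⁰) : Ideal (𝓞 K))) : F x = b := by
    have hex : ∃ b : (Ideal (𝓞 K))⁰, Ideal.span (Set.range x) =
      ((a * b : (Ideal (𝓞 K))⁰) : Ideal (𝓞 K)) := ⟨b, h⟩
    have h1 : F x = hex.choose := dif_pos hex
    rw [h1]
    exact mul_left_cancel (Subtype.ext (hex.choose_spec.symm.trans h))
  rw [Set.ncard_eq_toFinset_card _ hfin, Finset.card_eq_sum_card_fiberwise (f := F)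
    (t := {b ∈ (finite_absNorm_le (K := K) T).toFinset | b ∈ coprimeIdeals S})]
  · refine Finset.sum_congr rfl fun b hb => ?_
    rw [← Set.ncard_coe_finset]
    congr 1
    ext x
    rw [← f.mem_weightedSet_and_span_eq_iff hd hS ha (Finset.mem_filter.1 hb).2]
    simp only [Finset.coe_filter, Set.Finite.mem_toFinset, Set.mem_ofPred_eq]
    refine and_congr_right fun hx => ⟨fun h => ?_, hF⟩
    obtain ⟨b', -, -, hb'⟩ := f.exists_span_eq_of_mem_weightedSet hd hS ha hx
    rw [← h, hF hb', hb']
  · intro x hx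
    obtain ⟨b', hb1, hb2, hb'⟩ := f.exists_span_eq_of_mem_weightedSet hd hS ha
      ((Set.Finite.mem_toFinset _).1 hx)
    rw [hF hb']
    exact Finset.mem_coe.2 (Finset.mem_filter.2 ⟨(Set.Finite.mem_toFinset _).2 hb2, hb1⟩)

/-- Admissible auxiliary data for the counting: class representatives coprime to a modulus. -/
theorem exists_counting_data (hd : f.deg ≠ 0) (S : Finset (HeightOneSpectrum (𝓞 K))) :
    ∃ A : ClassGroup (𝓞 K) → (Ideal (𝓞 K))⁰, (∀ C, ClassGroup.mk0 (A C) = C) ∧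
      (∀ C, A C ∈ coprimeIdeals S) ∧
      (∀ C T, ((f.placeGauge hd).weightedSet (A C) (f.weight S) T).Finite) ∧
      ∀ C, Tendsto (fun T : ℝ => (((f.placeGauge hd).weightedSet (A C) (f.weight S)
          (T * Ideal.absNorm (A C : Ideal (𝓞 K)))).ncard : ℝ) / T ^ (m + 1)) atTop
        (𝓝 ((f.placeGauge hd).latticeConst *
          ∏ v ∈ S, ((1 - (resCard v)⁻¹ ^ (m + 1)) * f.localDensity v))) := by
  obtain ⟨c, hc, hcS, hU, hsum⟩ := f.exists_modulus hd S
  obtain ⟨A, hA⟩ := exists_class_representatives_coprime hc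
  have hA0 (C) : (A C : Ideal (𝓞 K)) ≠ ⊥ := nonZeroDivisors.coe_ne_zero _
  refine ⟨A, fun C => (hA C).1, fun C v hv h => ?_, fun C T =>
    (f.placeGauge hd).finite_weightedSet hc (hA0 C) (hA C).2 hU T, fun C => ?_⟩
  · refine v.isPrime.ne_top (top_le_iff.1 ?_)
    rw [← (hA C).2]
    exact sup_le h (hcS v hv)
  · have : NeZero c := ⟨hc⟩
    have : Fintype (𝓞 K ⧸ c) := Fintype.ofFinite _
    have h := (f.placeGauge hd).tendsto_ncard_weightedSet_div hc (hA0 C) (hA C).2 hU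
      (f.weight_nonneg S)
    rw [hsum] at h
    have h1 := (h.comp (tendsto_id.atTop_mul_const (absNorm_pos (A C)))).const_mul
      ((Ideal.absNorm (A C : Ideal (𝓞 K)) : ℝ) ^ (m + 1))
    have hne := (absNorm_pos (A C)).ne'
    refine (h1.congr' ?_).trans (le_of_eq ?_)
    · filter_upwards [eventually_gt_atTop 0] with T hT
      simp only [Function.comp_apply, id_eq]
      rw [mul_pow]
      field_simp
    · congr 1
      field_simp

/-- The case b = 1 injects the points into a finite union of weighted sets, one for each ideal
class. -/
theorem finite_boundedPoints (hd : f.deg ≠ 0) (T : ℝ) : (f.boundedPoints T).Finite := by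
  obtain ⟨S, hS⟩ := exists_finset_norm_evalAt_eq f hd
  obtain ⟨A, hA, hAS, hfin, -⟩ := f.exists_counting_data hd S
  have hrep (P : Projectivization K (Fin (m + 1) → K)) : ∃ x, Represents x P ∧
      integralVector x ∈ (f.placeGauge hd).cone ∧
      ∃ C, Ideal.span (Set.range x) = ((A C * 1 : (Ideal (𝓞 K))⁰) : Ideal (𝓞 K)) := by
    obtain ⟨C, ⟨x, hx, hxP⟩, -⟩ := existsUnique_class hA 1 P
    obtain ⟨u, hu⟩ := (f.placeGauge hd).exists_unit_mul_mem_cone hxP.ne_zero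
    exact ⟨_, represents_unit_mul hxP u, hu, C, (span_range_unit_mul u x).trans hx⟩
  choose s hs1 hs2 hs3 using hrep
  have h1 := one_mem_coprimeIdeals S
  refine Set.Finite.of_injOn (f := s) (t := ⋃ C, (f.placeGauge hd).weightedSet (A C) (f.weight S)
    (T * Ideal.absNorm (A C : Ideal (𝓞 K)))) (fun P hP => ?_) (fun P _ Q _ h => ?_)
    (Set.finite_iUnion fun C => hfin C _)
  · obtain ⟨C, hC⟩ := hs3 P
    refine Set.mem_iUnion_of_mem C ((f.mem_weightedSet_and_span_eq_iff hd hS (hAS C) h1).2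
      ⟨hs2 P, hC, P, ?_, hs1 P⟩).1
    simpa [boundedPoints] using hP
  · exact (hs1 P).unique (h ▸ hs1 Q)

open Classical in
/-- The asymptotics for the number of pairs of a point and an ideal coprime to `S`. -/
theorem tendsto_sum_ncard_boundedPoints (hd : f.deg ≠ 0)
    (hS : ∀ v ∉ S, ∀ z, ‖f.evalAt (FinitePlace.embedding v) z‖ = ‖z‖ ^ f.deg) :
    Tendsto (fun T : ℝ => (∑ b ∈ (finite_absNorm_le (K := K) T).toFinset with b ∈ coprimeIdeals S,
        ((f.boundedPoints (T / Ideal.absNorm (b : Ideal (𝓞 K)))).ncard : ℝ)) / T ^ (m + 1)) atTop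
      (𝓝 (classNumber K * (f.placeGauge hd).latticeConst / Units.torsionOrder K *
        ∏ v ∈ S, ((1 - (resCard v)⁻¹ ^ (m + 1)) * f.localDensity v))) := by
  obtain ⟨A, hA, hAS, hfin, hlim⟩ := f.exists_counting_data hd S
  have hw : (Units.torsionOrder K : ℝ) ≠ 0 := by exact_mod_cast (Units.torsionOrder_pos K).ne'
  have h := (tendsto_finsetSum Finset.univ fun C _ => hlim C).div_const
    (Units.torsionOrder K : ℝ)
  refine (h.congr fun T => ?_).trans (le_of_eq ?_)
  · rw [← Finset.sum_div, div_right_comm]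
    congr 1
    rw [div_eq_iff hw, ← Nat.cast_sum, ← Nat.cast_sum, ← Nat.cast_mul]
    congr 1
    -- For fixed b the sum over ideal classes collects all points of bounded height, each w times.
    simp only [f.ncard_weightedSet_eq_sum hd hS (hAS _) (hfin _ _)]
    rw [Finset.sum_comm, Finset.sum_mul]
    refine Finset.sum_congr rfl fun b _ => ?_
    rw [(f.placeGauge hd).sum_ncard_coneVectors hA b (f.finite_boundedPoints hd _), mul_comm]
  · congr 1
    rw [Finset.sum_const, Finset.card_univ, nsmul_eq_mul, classNumber]
    ring

end ProjMorphism

end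

noncomputable section

/-! ### The Dedekind zeta function and the sieve over its Euler factors -/

open AdicHaar nonZeroDivisors ProjMorphism

section Zeta

variable (K : Type*) [Field K] [NumberField K]

/-- The number of ideals of norm at most n is O(n), which gives convergence for real part above 1.
-/
theorem LSeriesSummable_card_ideals {s : ℂ} (hs : 1 < s.re) :
    LSeriesSummable (fun n => (Nat.card {I : Ideal (𝓞 K) // Ideal.absNorm I = n} : ℂ)) s := by
  have h1 : Tendsto (fun n : ℕ => (∑ k ∈ Finset.Icc 1 n,
      (Nat.card {I : Ideal (𝓞 K) // Ideal.absNorm I = k} : ℝ)) / n) atTop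
      (𝓝 (dedekindZeta_residue K)) := by
    refine ((Ideal.tendsto_norm_le_div_atTop₀ K).comp tendsto_natCast_atTop_atTop).congr fun n ↦ ?_
    simp only [Function.comp_apply, Nat.cast_le, ← Nat.cast_sum]
    congr
    rw [← add_left_inj 1, ← Ideal.card_norm_le_eq_card_norm_le_add_one,
      show Finset.Icc 1 n = Finset.Ioc 0 n from Finset.Icc_succ_left_eq_Ioc _ _,
      show 1 = Nat.card {I : Ideal (𝓞 K) // Ideal.absNorm I = 0} by
        simp [Ideal.absNorm_eq_zero_iff],
      Finset.sum_Ioc_add_eq_sum_Icc (n.zero_le),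
      ← Finset.card_preimage_eq_sum_card_image_eq (fun k _ ↦ Ideal.finite_setOfPred_absNorm_eq k)]
    simp [Set.coe_eq_subtype]
  have h2 := LSeriesSummable_of_sum_norm_bigO_and_nonneg
    (f := fun n => (Nat.card {I : Ideal (𝓞 K) // Ideal.absNorm I = n} : ℝ)) (r := 1) (s := s)
    ?_ (fun _ => Nat.cast_nonneg _) zero_le_one hs
  · simpa using h2
  · have h3 := h1.isBigO_one ℝ
    have h4 := h3.mul (Asymptotics.isBigO_refl (fun n : ℕ => (n : ℝ)) atTop)
    refine h4.congr' ?_ ?_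
    · filter_upwards [eventually_gt_atTop 0] with n hn
      have : (n : ℝ) ≠ 0 := by exact_mod_cast hn.ne'
      field_simp
    · filter_upwards with n
      simp

variable {K}

theorem hasSum_inv_absNorm_pow {k : ℕ} (hk : 1 < k) :
    HasSum (fun b : (Ideal (𝓞 K))⁰ => ((Ideal.absNorm (b : Ideal (𝓞 K)) : ℝ)⁻¹) ^ k)
      (dedekindZeta K k).re := by
  have hL := LSeriesSummable_card_ideals K (s := (k : ℂ)) (by simpa using hk)
  -- The value 0 at n = 0 agrees with the L-series term and with the absence of nonzero ideals of
  -- norm 0.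
  set c : ℕ → ℝ := fun n => if n = 0 then 0 else
    (Nat.card {I : Ideal (𝓞 K) // Ideal.absNorm I = n} : ℝ) * ((n : ℝ)⁻¹) ^ k with hc
  have hterm (n : ℕ) : LSeries.term
      (fun n => (Nat.card {I : Ideal (𝓞 K) // Ideal.absNorm I = n} : ℂ)) k n = (c n : ℂ) := by
    rcases eq_or_ne n 0 with rfl | hn
    · simp [hc]
    · rw [LSeries.term_of_ne_zero hn, hc]
      simp [hn, div_eq_mul_inv]
  have hcs : HasSum c (dedekindZeta K k).re := by
    have h := hL.hasSum
    have h2 := Complex.hasSum_re h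
    simp only [hterm, Complex.ofReal_re] at h2
    rw [dedekindZeta, LSeries]
    simpa only [hterm] using h2
  let e := Equiv.sigmaFiberEquiv fun b : (Ideal (𝓞 K))⁰ => Ideal.absNorm (b : Ideal (𝓞 K))
  rw [← e.hasSum_iff]
  have hfin (n : ℕ) : Finite {b : (Ideal (𝓞 K))⁰ // Ideal.absNorm (b : Ideal (𝓞 K)) = n} := by
    have := Ideal.finite_setOfPred_absNorm_le₀ (S := 𝓞 K) n
    exact (this.subset fun b (hb : _ = n) => hb.le)
  have hinner (n : ℕ) : HasSum (fun b : {b : (Ideal (𝓞 K))⁰ // Ideal.absNorm (b : Ideal (𝓞 K)) = n} =>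
      ((Ideal.absNorm ((e ⟨n, b⟩ : (Ideal (𝓞 K))⁰) : Ideal (𝓞 K)) : ℝ)⁻¹) ^ k) (c n) := by
    have hfintype := Fintype.ofFinite
      {b : (Ideal (𝓞 K))⁰ // Ideal.absNorm (b : Ideal (𝓞 K)) = n}
    have hval (b : {b : (Ideal (𝓞 K))⁰ // Ideal.absNorm (b : Ideal (𝓞 K)) = n}) :
        ((Ideal.absNorm ((e ⟨n, b⟩ : (Ideal (𝓞 K))⁰) : Ideal (𝓞 K)) : ℝ)⁻¹) ^ k =
          ((n : ℝ)⁻¹) ^ k := by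
      have : Ideal.absNorm ((e ⟨n, b⟩ : (Ideal (𝓞 K))⁰) : Ideal (𝓞 K)) = n := b.2
      rw [this]
    simp only [hval]
    convert hasSum_fintype _ using 1
    rw [Finset.sum_const, Finset.card_univ, nsmul_eq_mul, ← Nat.card_eq_fintype_card]
    rcases eq_or_ne n 0 with rfl | hn
    · simp [hc, show k ≠ 0 by lia]
    · simp only [hc, hn, if_false]
      congr 2
      refine Nat.card_congr ⟨fun I => ⟨⟨I.1, mem_nonZeroDivisors_of_ne_zero ?_⟩, I.2⟩,
        fun b => ⟨b.1.1, b.2⟩, fun _ => rfl, fun _ => rfl⟩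
      intro h0
      apply hn
      rw [← I.2, h0]
      simp
  refine HasSum.sigma_of_hasSum hcs hinner ?_
  refine (summable_sigma_of_nonneg fun _ => by rw [Function.comp_apply]; positivity).2 ⟨fun n => (hinner n).summable, ?_⟩
  exact hcs.summable.congr fun n => (hinner n).tsum_eq.symm

variable {k : ℕ}

/-- The sum of `N(b) ^ {-k}` over the ideals coprime to `S`. -/
def partialZeta (k : ℕ) (S : Finset (HeightOneSpectrum (𝓞 K))) : ℝ :=
  ∑' b : (Ideal (𝓞 K))⁰, (coprimeIdeals S).indicator
    (fun b => ((Ideal.absNorm (b : Ideal (𝓞 K)) : ℝ)⁻¹) ^ k) b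

theorem summable_partialZeta (hk : 1 < k) (t : Set (Ideal (𝓞 K))⁰) :
    Summable (t.indicator fun b => ((Ideal.absNorm (b : Ideal (𝓞 K)) : ℝ)⁻¹) ^ k) :=
  (hasSum_inv_absNorm_pow hk).summable.indicator t

theorem partialZeta_empty (hk : 1 < k) :
    partialZeta k (∅ : Finset (HeightOneSpectrum (𝓞 K))) = (dedekindZeta K k).re := by
  rw [partialZeta, ← (hasSum_inv_absNorm_pow hk).tsum_eq]
  refine tsum_congr fun b => Set.indicator_of_mem ?_ _
  simp [coprimeIdeals]

/-- A maximal ideal as a nonzero ideal. -/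
def primeIdeal (v : HeightOneSpectrum (𝓞 K)) : (Ideal (𝓞 K))⁰ :=
  ⟨v.asIdeal, mem_nonZeroDivisors_of_ne_zero v.ne_bot⟩

open Classical in
-- The ideals coprime to S and divisible by v are exactly the products of v with an ideal coprime to
-- S, because v is not in S. Removing them removes one Euler factor.
theorem partialZeta_insert (hk : 1 < k) {S : Finset (HeightOneSpectrum (𝓞 K))}
    {v : HeightOneSpectrum (𝓞 K)} (hv : v ∉ S) :
    partialZeta k (insert v S) = (1 - (resCard v)⁻¹ ^ k) * partialZeta k S := by
  set w : (Ideal (𝓞 K))⁰ → ℝ := fun b => ((Ideal.absNorm (b : Ideal (𝓞 K)) : ℝ)⁻¹) ^ k with hw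
  set D : Set (Ideal (𝓞 K))⁰ := {b | b ∈ coprimeIdeals S ∧ (b : Ideal (𝓞 K)) ≤ v.asIdeal} with hD
  have hsplit : (coprimeIdeals S).indicator w =
      (coprimeIdeals (insert v S)).indicator w + D.indicator w := by
    have hunion : coprimeIdeals S = coprimeIdeals (insert v S) ∪ D := by
      ext b
      simp only [coprimeIdeals, hD, Set.mem_union, Set.mem_ofPred_eq, Finset.forall_mem_insert]
      tauto
    have hdisj : Disjoint (coprimeIdeals (insert v S)) D :=
      Set.disjoint_left.2 fun b h1 h2 => h1 v (Finset.mem_insert_self v S) h2.2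
    rw [hunion, Set.indicator_union_of_disjoint hdisj]
    rfl
  have hmul : ∑' b, D.indicator w b = (resCard v)⁻¹ ^ k * partialZeta k S := by
    have hinj : Function.Injective fun b => primeIdeal v * b := fun b b' h => mul_left_cancel h
    rw [← hinj.tsum_eq (f := D.indicator w), partialZeta, ← tsum_mul_left]
    · refine tsum_congr fun b => ?_
      have hval : w (primeIdeal v * b) = (resCard v)⁻¹ ^ k * w b := by
        simp only [hw, primeIdeal, Submonoid.coe_mul, map_mul, Nat.cast_mul, mul_inv, mul_pow]
      have hmem : primeIdeal v * b ∈ D ↔ b ∈ coprimeIdeals S := by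
        have hle : ((primeIdeal v * b : (Ideal (𝓞 K))⁰) : Ideal (𝓞 K)) ≤ v.asIdeal :=
          Ideal.mul_le_right.trans' (by rw [Submonoid.coe_mul, mul_comm]; rfl)
        simp only [hD, Set.mem_ofPred_eq, hle, and_true, coprimeIdeals]
        refine forall₂_congr fun v' hv' => not_congr ?_
        rw [Submonoid.coe_mul, v'.isPrime.mul_le]
        refine or_iff_right fun h => hv ?_
        have := v.isMaximal.eq_of_le v'.isPrime.ne_top h
        rwa [HeightOneSpectrum.ext this]
      by_cases hb : b ∈ coprimeIdeals S
      · rw [Set.indicator_of_mem (hmem.2 hb), Set.indicator_of_mem hb, hval]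
      · rw [Set.indicator_of_notMem (hmem.not.2 hb), Set.indicator_of_notMem hb, mul_zero]
    · intro b hb
      have hbD : b ∈ D := Set.mem_of_indicator_ne_zero hb
      obtain ⟨b', hb'⟩ := Ideal.dvd_iff_le.2 hbD.2
      have hb0 : b' ≠ 0 := by
        rintro rfl
        exact nonZeroDivisors.coe_ne_zero b (by rw [hb', mul_zero])
      exact ⟨⟨b', mem_nonZeroDivisors_of_ne_zero hb0⟩, Subtype.ext hb'.symm⟩
  have h1 : partialZeta k S = partialZeta k (insert v S) + ∑' b, D.indicator w b := by
    rw [partialZeta, partialZeta, ← Summable.tsum_add (summable_partialZeta hk _)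
      (summable_partialZeta hk _), hsplit]
    rfl
  rw [hmul] at h1
  linear_combination -h1

theorem partialZeta_eq (hk : 1 < k) (S : Finset (HeightOneSpectrum (𝓞 K))) :
    partialZeta k S = (dedekindZeta K k).re * ∏ v ∈ S, (1 - (resCard v)⁻¹ ^ k) := by
  classical
  induction S using Finset.induction_on with
  | empty => rw [partialZeta_empty hk, Finset.prod_empty, mul_one]
  | insert v S hv ih =>
    rw [partialZeta_insert hk hv, ih, Finset.prod_insert hv]
    ring

/-- Every ideal other than 1 lies in some prime and drops out once S contains that prime; the full
zeta series dominates. -/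
theorem tendsto_partialZeta (hk : 1 < k) :
    Tendsto (fun S : Finset (HeightOneSpectrum (𝓞 K)) => partialZeta k S) atTop (𝓝 1) := by
  have hlim : ∑' b : (Ideal (𝓞 K))⁰, ({1} : Set (Ideal (𝓞 K))⁰).indicator
      (fun b => ((Ideal.absNorm (b : Ideal (𝓞 K)) : ℝ)⁻¹) ^ k) b = 1 := by
    rw [tsum_eq_single 1 fun b hb => Set.indicator_of_notMem (Set.mem_singleton_iff.not.2 hb) _,
      Set.indicator_of_mem (Set.mem_singleton _)]
    simp
  rw [← hlim]
  refine tendsto_tsum_of_dominated_convergence (hasSum_inv_absNorm_pow hk).summable (fun b => ?_)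
    (Eventually.of_forall fun S b => ?_)
  · refine tendsto_const_nhds.congr' ?_
    rcases eq_or_ne b 1 with rfl | hb
    · refine Eventually.of_forall fun S => ?_
      beta_reduce
      rw [Set.indicator_of_mem (Set.mem_singleton _),
        Set.indicator_of_mem (one_mem_coprimeIdeals S)]
    · have hb1 : (b : Ideal (𝓞 K)) ≠ ⊤ := fun h =>
        hb (Subtype.ext (by rw [h]; exact Ideal.one_eq_top.symm))
      obtain ⟨p, hp, hle⟩ := Ideal.exists_le_maximal _ hb1
      have hp0 : p ≠ ⊥ := by
        rintro rfl
        exact nonZeroDivisors.coe_ne_zero b (le_bot_iff.1 hle)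
      filter_upwards [eventually_ge_atTop {⟨p, hp.isPrime, hp0⟩}] with S hS
      rw [Set.indicator_of_notMem (Set.mem_singleton_iff.not.2 hb), Set.indicator_of_notMem]
      exact fun h => h _ (hS (Finset.mem_singleton_self _)) hle
  · rw [Real.norm_of_nonneg (Set.indicator_nonneg (fun _ _ => by positivity) b)]
    exact Set.indicator_le_self' (fun _ _ => by positivity) b

theorem one_le_dedekindZeta (hk : 1 < k) : 1 ≤ (dedekindZeta K k).re := by
  have h := (hasSum_inv_absNorm_pow (K := K) hk)
  have h1 := le_hasSum h 1 fun b _ => by positivity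
  simpa using h1

end Zeta

end

noncomputable section

/-! ### The asymptotics for the pullback of the height -/

open AdicHaar nonZeroDivisors

namespace ProjMorphism

variable {K : Type*} [Field K] [NumberField K] {m M : ℕ} (f : ProjMorphism K m M)

theorem boundedPoints_mono (hd : f.deg ≠ 0) {T T' : ℝ} (h : T ≤ T') :
    (f.boundedPoints T).ncard ≤ (f.boundedPoints T').ncard :=
  Set.ncard_le_ncard (fun P (hP : f.rootHeight P ≤ T) => show f.rootHeight P ≤ T' from hP.trans h)
    (f.finite_boundedPoints hd T')

theorem boundedPoints_eq_empty {T : ℝ} (hT : T < 1) : f.boundedPoints T = ∅ :=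
  Set.eq_empty_of_forall_notMem fun P (hP : f.rootHeight P ≤ T) =>
    absurd ((f.one_le_rootHeight P).trans hP) (not_le.2 hT)

open Classical in
theorem ncard_boundedPoints_le_sum (S : Finset (HeightOneSpectrum (𝓞 K))) {T : ℝ} (hT : 1 ≤ T) :
    ((f.boundedPoints T).ncard : ℝ) ≤
      ∑ b ∈ (finite_absNorm_le (K := K) T).toFinset with b ∈ coprimeIdeals S,
        ((f.boundedPoints (T / Ideal.absNorm (b : Ideal (𝓞 K)))).ncard : ℝ) := by
  have h1 : (1 : (Ideal (𝓞 K))⁰) ∈ {b ∈ (finite_absNorm_le (K := K) T).toFinset |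
      b ∈ coprimeIdeals S} := by
    refine Finset.mem_filter.2 ⟨(Set.Finite.mem_toFinset _).2 ?_, one_mem_coprimeIdeals S⟩
    simpa using hT
  refine le_trans (le_of_eq ?_) (Finset.single_le_sum (fun b _ => Nat.cast_nonneg _) h1)
  simp

/-- The term b = 1 is bounded by the whole sum over pairs, which settles large T. On the remaining
range T ≥ 1 monotonicity and T^{m+1} ≥ 1 suffice, and below 1 there are no points. -/
theorem exists_ncard_boundedPoints_le (hd : f.deg ≠ 0) :
    ∃ C : ℝ, 0 ≤ C ∧ ∀ T : ℝ, 0 ≤ T → ((f.boundedPoints T).ncard : ℝ) ≤ C * T ^ (m + 1) := by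
  classical
  obtain ⟨S, hS⟩ := exists_finset_norm_evalAt_eq f hd
  have hlim := f.tendsto_sum_ncard_boundedPoints hd hS
  set L := classNumber K * (f.placeGauge hd).latticeConst / Units.torsionOrder K *
        ∏ v ∈ S, ((1 - (resCard v)⁻¹ ^ (m + 1)) * f.localDensity v)
  obtain ⟨T₀, hT₀⟩ := eventually_atTop.1 (hlim.eventually_le_const (lt_add_one L))
  set T₁ := max T₀ 1
  refine ⟨max (L + 1) (f.boundedPoints T₁).ncard, le_max_of_le_right (Nat.cast_nonneg _),
    fun T hT => ?_⟩
  have hpow : 0 ≤ T ^ (m + 1) := by positivity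
  rcases lt_or_ge T 1 with h1 | h1
  · rw [f.boundedPoints_eq_empty h1, Set.ncard_empty, Nat.cast_zero]
    exact mul_nonneg (le_max_of_le_right (Nat.cast_nonneg _)) hpow
  rcases le_total T₁ T with h2 | h2
  · have h3 := hT₀ T ((le_max_left _ _).trans h2)
    rw [div_le_iff₀ (by positivity)] at h3
    exact ((f.ncard_boundedPoints_le_sum S h1).trans h3).trans
      (mul_le_mul_of_nonneg_right (le_max_left _ _) hpow)
  · calc ((f.boundedPoints T).ncard : ℝ) ≤ (f.boundedPoints T₁).ncard := by
          exact_mod_cast f.boundedPoints_mono hd h2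
      _ ≤ max (L + 1) (f.boundedPoints T₁).ncard * 1 := by
          rw [mul_one]; exact le_max_right _ _
      _ ≤ _ := mul_le_mul_of_nonneg_left (one_le_pow₀ h1)
          (le_max_of_le_right (Nat.cast_nonneg _))

open Classical in
-- The a priori bound at T/N(b) dominates the terms with b ≠ 1, and these sum to the partial zeta
-- value minus the term of b = 1.
theorem sum_ncard_boundedPoints_le (hm : 1 ≤ m) {C : ℝ} (hC : 0 ≤ C)
    (hle : ∀ T : ℝ, 0 ≤ T → ((f.boundedPoints T).ncard : ℝ) ≤ C * T ^ (m + 1))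
    (S : Finset (HeightOneSpectrum (𝓞 K))) {T : ℝ} (hT : 1 ≤ T) :
    ∑ b ∈ (finite_absNorm_le (K := K) T).toFinset with b ∈ coprimeIdeals S,
        ((f.boundedPoints (T / Ideal.absNorm (b : Ideal (𝓞 K)))).ncard : ℝ) ≤
      (f.boundedPoints T).ncard + C * T ^ (m + 1) * (partialZeta (m + 1) S - 1) := by
  set w : (Ideal (𝓞 K))⁰ → ℝ := fun b => ((Ideal.absNorm (b : Ideal (𝓞 K)) : ℝ)⁻¹) ^ (m + 1) with hw
  set F := {b ∈ (finite_absNorm_le (K := K) T).toFinset | b ∈ coprimeIdeals S} with hF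
  have h1 : (1 : (Ideal (𝓞 K))⁰) ∈ F := by
    refine Finset.mem_filter.2 ⟨(Set.Finite.mem_toFinset _).2 ?_, one_mem_coprimeIdeals S⟩
    simpa using hT
  have hsum : ∑ b ∈ F, w b ≤ partialZeta (m + 1) S := by
    have hs := summable_partialZeta (K := K) (show 1 < m + 1 by lia) (coprimeIdeals S)
    refine le_trans (Finset.sum_le_sum fun b hb => ?_)
      (hs.sum_le_tsum F fun b _ => Set.indicator_nonneg (fun _ _ => by positivity) b)
    rw [Set.indicator_of_mem (Finset.mem_filter.1 hb).2]
  rw [← Finset.add_sum_erase F _ h1]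
  rw [← Finset.add_sum_erase F _ h1] at hsum
  have hw1 : w 1 = 1 := by simp [hw]
  refine add_le_add (le_of_eq (by simp)) ?_
  calc ∑ b ∈ F.erase 1, ((f.boundedPoints (T / Ideal.absNorm (b : Ideal (𝓞 K)))).ncard : ℝ)
      ≤ ∑ b ∈ F.erase 1, C * T ^ (m + 1) * w b := Finset.sum_le_sum fun b _ => by
        refine (hle _ (by positivity)).trans (le_of_eq ?_)
        rw [div_eq_mul_inv, mul_pow, mul_assoc]
    _ ≤ _ := by
        rw [← Finset.mul_sum]
        refine mul_le_mul_of_nonneg_left ?_ (by positivity)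
        linarith

/-- The number of points of bounded height. -/
theorem tendsto_ncard_boundedPoints_div (hm : 1 ≤ m) (hd : f.deg ≠ 0) :
    Tendsto (fun T : ℝ => ((f.boundedPoints T).ncard : ℝ) / T ^ (m + 1)) atTop
      (𝓝 (pullbackConst f)) := by
  classical
  obtain ⟨S₀, hS₀⟩ := exists_finset_norm_evalAt_eq f hd
  obtain ⟨C, hC, hle⟩ := f.exists_ncard_boundedPoints_le hd
  have hk : 1 < m + 1 := by lia
  have hζ : (dedekindZeta K ((m : ℂ) + 1)).re ≠ 0 := by
    have := one_le_dedekindZeta (K := K) hk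
    push_cast at this
    exact (zero_lt_one.trans_le this).ne'
  set L := pullbackConst f with hL
  -- The Euler factors at S combine with the zeta value in the constant into the partial zeta value.
  have hlimS (S : Finset (HeightOneSpectrum (𝓞 K))) (hS : S₀ ⊆ S) :
      Tendsto (fun T : ℝ => (∑ b ∈ (finite_absNorm_le (K := K) T).toFinset with b ∈ coprimeIdeals S,
        ((f.boundedPoints (T / Ideal.absNorm (b : Ideal (𝓞 K)))).ncard : ℝ)) / T ^ (m + 1)) atTop
      (𝓝 (L * partialZeta (m + 1) S)) := by
    have hgood : ∀ v ∉ S, ∀ z, ‖f.evalAt (FinitePlace.embedding v) z‖ = ‖z‖ ^ f.deg :=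
      fun v hv => hS₀ v fun h => hv (hS h)
    refine (f.tendsto_sum_ncard_boundedPoints hd hgood).trans (le_of_eq ?_)
    congr 1
    rw [hL, pullbackConst_eq f hd hgood, partialZeta_eq hk, schanuelConst, PlaceGauge.latticeConst,
      Finset.prod_mul_distrib]
    push_cast
    field_simp
  rw [Metric.tendsto_atTop]
  intro ε hε
  -- The summand |L| pays for replacing L Z by L, and C pays for the pairs with b ≠ 1. S is fixed
  -- before T grows.
  have hZ : Tendsto (fun S : Finset (HeightOneSpectrum (𝓞 K)) =>
      (|L| + C) * |partialZeta (m + 1) S - 1|) atTop (𝓝 0) := by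
    have := ((tendsto_partialZeta (K := K) hk).sub_const 1).abs.const_mul (|L| + C)
    simpa using this
  obtain ⟨S, hS, hSε⟩ := ((eventually_ge_atTop S₀).and
    (hZ.eventually_lt_const (half_pos hε))).exists
  obtain ⟨T₀, hT₀⟩ := Metric.tendsto_atTop.1 (hlimS S hS) (ε / 2) (half_pos hε)
  refine ⟨max T₀ 1, fun T hT => ?_⟩
  have hT1 : 1 ≤ T := (le_max_right _ _).trans hT
  have h1 := hT₀ T ((le_max_left _ _).trans hT)
  have h2 := f.ncard_boundedPoints_le_sum S hT1
  have h3 := f.sum_ncard_boundedPoints_le hm hC hle S hT1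
  set A := ∑ b ∈ (finite_absNorm_le (K := K) T).toFinset with b ∈ coprimeIdeals S,
        ((f.boundedPoints (T / Ideal.absNorm (b : Ideal (𝓞 K)))).ncard : ℝ)
  set N : ℝ := ((f.boundedPoints T).ncard : ℝ)
  set Z := partialZeta (m + 1) S
  have hp : 0 < T ^ (m + 1) := by positivity
  have h2' : N / T ^ (m + 1) ≤ A / T ^ (m + 1) := by gcongr
  have h3' : A / T ^ (m + 1) ≤ N / T ^ (m + 1) + C * (Z - 1) := by
    rw [div_le_iff₀ hp]
    refine h3.trans (le_of_eq ?_)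
    field_simp
  rw [Real.dist_eq] at h1 ⊢
  have h4 : L * Z - L = L * (Z - 1) := by ring
  have h5 : |L * (Z - 1)| = |L| * |Z - 1| := abs_mul _ _
  have h6 := mul_le_mul_of_nonneg_left (le_abs_self (Z - 1)) hC
  have h7 := abs_le.1 (le_of_eq h5)
  rw [abs_lt] at h1 ⊢
  constructor <;> nlinarith [h1.1, h1.2, h7.1, h7.2]

theorem setOf_mulHeight_onPoints_le (hd : f.deg ≠ 0) {X : ℝ} (hX : 0 ≤ X) :
    {P | (f.onPoints P).mulHeight ≤ X} = f.boundedPoints (X ^ (1 / (f.deg : ℝ))) := by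
  ext P
  simp only [boundedPoints, rootHeight, Set.mem_ofPred_eq]
  rw [Real.rpow_le_rpow_iff (Projectivization.mulHeight_pos _).le hX (by positivity)]

theorem finite_setOf_mulHeight_onPoints_le (hd : f.deg ≠ 0) (X : ℝ) :
    {P | (f.onPoints P).mulHeight ≤ X}.Finite := by
  refine Set.Finite.subset (s := {P | (f.onPoints P).mulHeight ≤ max X 0}) ?_
    fun P (hP : (f.onPoints P).mulHeight ≤ X) =>
      show (f.onPoints P).mulHeight ≤ max X 0 from hP.trans (le_max_left _ _)
  rw [f.setOf_mulHeight_onPoints_le hd (le_max_right _ _)]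
  exact f.finite_boundedPoints hd _

theorem tendsto_ncard_mulHeight_onPoints_le (hm : 1 ≤ m) (hd : f.deg ≠ 0) :
    Tendsto (fun X : ℝ => ({P | (f.onPoints P).mulHeight ≤ X}.ncard : ℝ) /
      X ^ (((m : ℝ) + 1) / f.deg)) atTop (𝓝 (pullbackConst f)) := by
  refine ((f.tendsto_ncard_boundedPoints_div hm hd).comp
    (tendsto_rpow_atTop (y := 1 / (f.deg : ℝ)) (by positivity))).congr' ?_
  filter_upwards [eventually_ge_atTop 0] with X hX
  rw [f.setOf_mulHeight_onPoints_le hd hX, Function.comp_apply, ← Real.rpow_mul_natCast hX]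
  congr 2
  push_cast
  ring

theorem _root_.pullbackConst_pos (hm : 1 ≤ m) (hd : f.deg ≠ 0) : 0 < pullbackConst f := by
  obtain ⟨S, hS⟩ := exists_finset_norm_evalAt_eq f hd
  rw [pullbackConst_eq f hd hS]
  have h1 : 0 < ∏ w, (f.placeGauge hd).vol w :=
    Finset.prod_pos fun w _ => f.placeGauge_vol_pos hd w
  have h2 : 0 < ∏ v ∈ S, f.localDensity v := Finset.prod_pos fun v _ => f.localDensity_pos v hd
  refine mul_pos (mul_pos ?_ h1) h2
  have hζ : 0 < (dedekindZeta K ((m : ℂ) + 1)).re := by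
    have := one_le_dedekindZeta (K := K) (show 1 < m + 1 by lia)
    push_cast at this
    exact zero_lt_one.trans_le this
  have hh : (0 : ℝ) < classNumber K := by exact_mod_cast Fintype.card_pos
  have hR := Units.regulator_pos K
  have hw : (0 : ℝ) < Units.torsionOrder K := by exact_mod_cast Units.torsionOrder_pos K
  have hD : 0 < √|(discr K : ℝ)| := Real.sqrt_pos.2 (abs_pos.2 (by exact_mod_cast discr_ne_zero K))
  unfold schanuelConst
  positivity

end ProjMorphism

end

/-! ### The main theorem -/

theorem theorem2p7 {K : Type*} [Field K] [NumberField K] {m M : ℕ} (hm : 1 ≤ m)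
    (f : ProjMorphism K M M) (hf : 2 ≤ f.deg) (g : ProjMorphism K m M) (hg : 1 ≤ g.deg) :
    (∀ P : Projectivization K (Fin (M + 1) → K),
      Tendsto (canonicalHeightSeq f P) atTop (𝓝 (canonicalHeight f P))) ∧
    ∃ c : ℝ, 0 < c ∧
      Tendsto (fun i : ℕ => pullbackConst (f.iterComp g i)) atTop (𝓝 c) ∧
      (∀ X : ℝ,
        {P : Projectivization K (Fin (m + 1) → K) | canonicalHeight f (g.onPoints P) ≤ X}.Finite) ∧
      Asymptotics.IsEquivalent atTop (fun X : ℝ => (canonicalCount f g X : ℝ))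
        (fun X : ℝ => c * X ^ ((Module.finrank ℚ K : ℝ) * ((m : ℝ) + 1) / (g.deg : ℝ))) := by
  obtain ⟨B, hB⟩ := exists_canonicalHeight_bounds f hf
  refine ⟨fun P => (hB P).1, ?_⟩
  have hd (i : ℕ) : (f.iterComp g i).deg ≠ 0 := by
    rw [ProjMorphism.deg_iterComp]
    exact mul_ne_zero (pow_ne_zero _ (by lia)) (by lia)
  exact canonical_asymptotics_of_pullback_asymptotics f hf g
    (fun i X => (f.iterComp g i).finite_setOf_mulHeight_onPoints_le (hd i) X)
    (fun i => pullbackConst_pos (f.iterComp g i) hm (hd i))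
    (fun i => (f.iterComp g i).tendsto_ncard_mulHeight_onPoints_le hm (hd i))
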